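/- Let $n\ge 1$ and let $\Omega\subset\mathbb{R}^n$ be a bounded domain (open, connected, non-empty) with Lipschitz boundary. All functions are real-valued. Let $H^1(\Omega)\subset L^2(\Omega)$ be the Sobolev space of functions with weak first derivatives in $L^2(\Omega)$, with norm $\|u\|_{H^1(\Omega)}^2=\|u\|_{L^2(\Omega)}^2+\sum_{i=1}^n\|\partial_i u\|_{L^2(\Omega)}^2$, and let $H^1_0(\Omega)$ be the closure of $C_c^\infty(\Omega)$ in $H^1(\Omega)$. Let $\gamma\colon H^1(\Omega)\to L^2(\partial\Omega)$ be the Sobolev trace map, i.e. the continuous extension of the restriction $\psi\mapsto\psi|_{\partial\Omega}$ of functions smooth up to the boundary, and let $$H^{1/2}(\partial\Omega)=\Big\{f\in L^2(\partial\Omega):\int_{\partial\Omega}\int_{\partial\Omega}\frac{|f(x)-f(y)|^2}{|x-y|^{n}}\,d\sigma(x)\,d\sigma(y)<\infty\Big\},$$ where $\sigma$ is the surface measure, i.e. $(n-1)$-dimensional Hausdorff measure, on $\partial\Omega$. Let $L^2_c(\Omega)$ be a closed linear subspace of $L^2(\Omega)$ whose orthogonal complement is spanned by finitely many functions in $H^1(\Omega)$: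 $L^2_c(\Omega)^\perp=\operatorname{span}\{\phi_1,\dots,\phi_m\}$ with $\phi_1,\dots,\phi_m\in H^1(\Omega)$. Then: (i) $\gamma\big(H^1(\Omega)\cap L^2_c(\Omega)\big)=H^{1/2}(\partial\Omega)$; (ii) $\overline{H^1_0(\Omega)\cap L^2_c(\Omega)}=L^2_c(\Omega)$, the closure being taken in $L^2(\Omega)$; (iii) $L^2_c(\Omega)^\perp$ is continuously embedded in $H^1(\Omega)$: $L^2_c(\Omega)^\perp\subset H^1(\Omega)$, and there is a constant $C>0$ such that $\|\phi\|_{H^1(\Omega)}\le C\|\phi\|_{L^2(\Omega)}$ for all $\phi\in L^2_c(\Omega)^\perp$. -/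

import Mathlib

open MeasureTheory Filter Topology
open scoped NNReal ContDiff

noncomputable section

namespace ConstrainedSobolev

variable {n : ℕ}

/-- The Euclidean space `ℝⁿ`. -/
abbrev Euc (n : ℕ) : Type := EuclideanSpace ℝ (Fin n)

/-- A bounded domain with Lipschitz boundary: near each boundary point the domain coincides,
up to the choice of a direction `ν`, with the region strictly above the graph of a Lipschitz
function on the hyperplane orthogonal to `ν`. -/
structure IsBoundedLipschitzDomain (Ω : Set (Euc n)) : Prop where
  isOpen : IsOpen Ω
  isConnected : IsConnected Ω
  isBounded : Bornology.IsBounded Ω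
  boundary : ∀ x₀ ∈ frontier Ω, ∃ (W : Set (Euc n)) (ν : Euc n)
    (ζ : (ℝ ∙ ν)ᗮ → ℝ) (K : ℝ≥0),
    IsOpen W ∧ x₀ ∈ W ∧ ‖ν‖ = 1 ∧ LipschitzWith K ζ ∧
      Ω ∩ W = {x | ζ ((ℝ ∙ ν)ᗮ.orthogonalProjectionOnto x) < inner ℝ ν x} ∩ W

/-- Real `L²(Ω)` with respect to Lebesgue measure. -/
abbrev L2 (Ω : Set (Euc n)) := Lp ℝ 2 (volume.restrict Ω)

/-- Surface measure on `∂Ω`: the `(n-1)`-dimensional Hausdorff measure. -/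
def surfaceMeasure (Ω : Set (Euc n)) : Measure (Euc n) :=
  (Measure.hausdorffMeasure ((n : ℝ) - 1)).restrict (frontier Ω)

/-- Real `L²(∂Ω)`. -/
abbrev L2Boundary (Ω : Set (Euc n)) := Lp ℝ 2 (surfaceMeasure Ω)

/-- The classical `i`-th partial derivative. -/
def partialDeriv (i : Fin n) (ψ : Euc n → ℝ) (x : Euc n) : ℝ :=
  fderiv ℝ ψ x (EuclideanSpace.single i 1)

/-- Test functions `C_c^∞(Ω)`. -/
def IsTestFunction (Ω : Set (Euc n)) (ψ : Euc n → ℝ) : Prop :=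
  ContDiff ℝ ∞ ψ ∧ HasCompactSupport ψ ∧ tsupport ψ ⊆ Ω

/-- `g` is the weak `i`-th partial derivative of `u` in `Ω`. -/
def HasWeakPartial (Ω : Set (Euc n)) (i : Fin n) (u g : L2 Ω) : Prop :=
  ∀ ψ : Euc n → ℝ, IsTestFunction Ω ψ →
    ∫ x in Ω, u x * partialDeriv i ψ x = - ∫ x in Ω, g x * ψ x

/-- The Sobolev space `H¹(Ω)`, as a subset of `L²(Ω)`. -/
def H1 (Ω : Set (Euc n)) : Set (L2 Ω) :=
  {u | ∀ i : Fin n, ∃ g : L2 Ω, HasWeakPartial Ω i u g}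

open Classical in
/-- The weak `i`-th partial derivative of `u` (set to `0` when there is none). -/
def weakPartial (Ω : Set (Euc n)) (i : Fin n) (u : L2 Ω) : L2 Ω :=
  if h : ∃ g : L2 Ω, HasWeakPartial Ω i u g then h.choose else 0

/-- The norm of `H¹(Ω)`. -/
def h1Norm (Ω : Set (Euc n)) (u : L2 Ω) : ℝ :=
  Real.sqrt (‖u‖ ^ 2 + ∑ i : Fin n, ‖weakPartial Ω i u‖ ^ 2)

/-- The restrictions to `Ω` of the (smooth) functions `ψ k` converge to `u` in `H¹(Ω)`. -/
def TendstoInH1 (Ω : Set (Euc n)) (ψ : ℕ → Euc n → ℝ) (u : L2 Ω) : Prop :=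
  Tendsto (fun k => eLpNorm (fun x => ψ k x - u x) 2 (volume.restrict Ω)) atTop (𝓝 0) ∧
  ∀ i : Fin n, Tendsto
    (fun k => eLpNorm (fun x => partialDeriv i (ψ k) x - weakPartial Ω i u x) 2
      (volume.restrict Ω)) atTop (𝓝 0)

/-- `H¹₀(Ω)`: the closure of `C_c^∞(Ω)` in `H¹(Ω)`. -/
def H10 (Ω : Set (Euc n)) : Set (L2 Ω) :=
  {u | u ∈ H1 Ω ∧ ∃ ψ : ℕ → Euc n → ℝ, (∀ k, IsTestFunction Ω (ψ k)) ∧ TendstoInH1 Ω ψ u}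

/-- `g` is the boundary trace of `u ∈ H¹(Ω)`: some functions smooth up to the boundary converge
to `u` in `H¹(Ω)` while their restrictions to `∂Ω` converge to `g` in `L²(∂Ω)`. -/
def IsTrace (Ω : Set (Euc n)) (u : L2 Ω) (g : L2Boundary Ω) : Prop :=
  u ∈ H1 Ω ∧ ∃ ψ : ℕ → Euc n → ℝ, (∀ k, ContDiff ℝ ∞ (ψ k)) ∧ TendstoInH1 Ω ψ u ∧
    Tendsto (fun k => eLpNorm (fun x => ψ k x - g x) 2 (surfaceMeasure Ω)) atTop (𝓝 0)

open Classical in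
/-- The Sobolev trace map, the extension by continuity of `ψ ↦ ψ|_∂Ω` from smooth functions to
`H¹(Ω)`. On a bounded Lipschitz domain every `u ∈ H¹(Ω)` has exactly one trace; the value `0` is
only used for `u` outside `H¹(Ω)`. -/
def trace (Ω : Set (Euc n)) (u : L2 Ω) : L2Boundary Ω :=
  if h : ∃ g : L2Boundary Ω, IsTrace Ω u g then h.choose else 0

/-- The Sobolev–Slobodeckij space `H^{1/2}(∂Ω)`: the functions in `L²(∂Ω)` with
`∬ |f(x) - f(y)|² / |x - y|ⁿ dσ(x) dσ(y) < ∞`. -/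
def HHalf (Ω : Set (Euc n)) : Set (L2Boundary Ω) :=
  {f | ∫⁻ x, ∫⁻ y, ‖f x - f y‖ₑ ^ 2 / edist x y ^ n ∂(surfaceMeasure Ω)
    ∂(surfaceMeasure Ω) < ⊤}

end ConstrainedSobolev

end

open MeasureTheory Filter Topology
open scoped NNReal ContDiff

noncomputable section

namespace ConstrainedSobolev

variable {n : ℕ}

/-! ### Weak derivatives, test functions and their density in `L²(Ω)`. -/

section WeakDerivative

variable {Ω : Set (Euc n)}

/-! The constraint costs nothing because `Lcᗮ` is finite-dimensional while test functions are dense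
in `L²(Ω)`. The orthogonal projection `P` onto `Lcᗮ` maps test functions onto a dense, hence full,
subspace, so there is a linear `T` from `Lcᗮ` to test functions with `P ∘ T = id`
(`exists_section_of_dense`). Then `u - T (P u)` lies in `Lc` and differs from `u` by a test
function, which does not alter the trace (`IsTrace.sub_test`); so (i) reduces to the unconstrained
trace. The same correction, applied to test functions converging to an element of `Lc`, gives (ii).
For (iii), the weak derivatives are linear maps on a finite-dimensional space, hence bounded.

It remains to see that traces fill exactly `H^{1/2}(∂Ω)`. For a smooth `ψ`, boundary points are
vertices of interior cones of locally uniform size. The values at `x` and `y` are compared through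
the overlap of their cones at levels `s` comparable to `|x - y|`. This bounds the near-diagonal
Gagliardo integral by the mean oscillation on cones with weight `s⁻²`; Hardy's inequality along rays
turns that into a gradient integral over cones, and a bound on the overlap of the cones turns it
into the Dirichlet integral over `Ω`. Lower semicontinuity carries the estimate to traces
(`IsTrace.mem_HHalf`).

Conversely (`exists_isTrace`), `g` is extended by its weighted mean over `∂Ω` with kernel `|x -
y|^(-2n)`, regularised to `(|x - y|² + ε²)⁻ⁿ` so that the approximants are smooth on the whole
space. The lower bound `r^(n-1)` for the surface measure of balls controls the normalisation. The
squared gradient is then at most a constant times `∬ |g(y) - g(y')|² (|x - y|² + |x - y'|²)⁻ⁿ`,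
uniformly in `ε`, and integration in `x` yields the Gagliardo kernel `|y - y'|⁻ⁿ`. Dominated
convergence produces the extension; on `∂Ω` the squared `L²` distance to `g` is `O(ε)` times the
Gagliardo integral. -/

lemma IsTestFunction.memLp {ψ : Euc n → ℝ} (hψ : IsTestFunction Ω ψ) :
    MemLp ψ 2 (volume.restrict Ω) :=
  (hψ.1.continuous.memLp_of_hasCompactSupport hψ.2.1).restrict Ω

lemma contDiff_partialDeriv {ψ : Euc n → ℝ} (hψ : ContDiff ℝ ∞ ψ) (i : Fin n) :
    ContDiff ℝ ∞ (partialDeriv i ψ) :=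
  (hψ.fderiv_right (m := ∞) (by simp)).clm_apply contDiff_const

lemma partialDeriv_sub {ψ χ : Euc n → ℝ} (hψ : ContDiff ℝ ∞ ψ) (hχ : ContDiff ℝ ∞ χ) (i : Fin n)
    (x : Euc n) :
    partialDeriv i (fun y => ψ y - χ y) x = partialDeriv i ψ x - partialDeriv i χ x := by
  have h1 := (hψ.differentiable (by simp)) x
  have h2 := (hχ.differentiable (by simp)) x
  simp [partialDeriv, fderiv_fun_sub h1 h2]

lemma IsTestFunction.partialDeriv {ψ : Euc n → ℝ} (hψ : IsTestFunction Ω ψ) (i : Fin n) :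
    IsTestFunction Ω (partialDeriv i ψ) := by
  have hsub : tsupport (ConstrainedSobolev.partialDeriv i ψ) ⊆ tsupport ψ := by
    refine (closure_mono ?_).trans (tsupport_fderiv_subset ℝ (f := ψ))
    intro x hx hx'
    simp only [Function.mem_support] at hx
    apply hx
    simp [ConstrainedSobolev.partialDeriv, hx']
  exact ⟨contDiff_partialDeriv hψ.1 i, hψ.2.1.mono' ((subset_tsupport _).trans hsub),
    hsub.trans hψ.2.2⟩

lemma IsTestFunction.add {ψ χ : Euc n → ℝ} (hψ : IsTestFunction Ω ψ) (hχ : IsTestFunction Ω χ) :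
    IsTestFunction Ω (fun x => ψ x + χ x) :=
  ⟨hψ.1.add hχ.1, hψ.2.1.add hχ.2.1,
    (tsupport_add (f := ψ) (g := χ)).trans (Set.union_subset hψ.2.2 hχ.2.2)⟩

lemma IsTestFunction.smul {ψ : Euc n → ℝ} (hψ : IsTestFunction Ω ψ) (c : ℝ) :
    IsTestFunction Ω (fun x => c * ψ x) :=
  ⟨contDiff_const.mul hψ.1, hψ.2.1.mul_left, (tsupport_mul_subset_right).trans hψ.2.2⟩

lemma integral_mul_eq_inner (u : L2 Ω) {ψ : Euc n → ℝ} (hψ : MemLp ψ 2 (volume.restrict Ω)) :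
    ∫ x in Ω, u x * ψ x = inner ℝ (hψ.toLp ψ) u := by
  rw [L2.inner_def]
  refine integral_congr_ae ?_
  filter_upwards [hψ.coeFn_toLp] with x hx
  simp [hx]

/-- Weak derivatives expressed through the inner product of `L²(Ω)`. -/
lemma hasWeakPartial_iff_inner {i : Fin n} {u g : L2 Ω} :
    HasWeakPartial Ω i u g ↔ ∀ ψ (hψ : IsTestFunction Ω ψ),
      inner ℝ ((hψ.partialDeriv i).memLp.toLp _) u = - inner ℝ (hψ.memLp.toLp _) g := by
  refine forall₂_congr fun ψ hψ => ?_
  rw [integral_mul_eq_inner u (hψ.partialDeriv i).memLp, integral_mul_eq_inner g hψ.memLp]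

lemma HasWeakPartial.add {i : Fin n} {u v g h : L2 Ω} (hu : HasWeakPartial Ω i u g)
    (hv : HasWeakPartial Ω i v h) : HasWeakPartial Ω i (u + v) (g + h) := by
  rw [hasWeakPartial_iff_inner] at *
  intro ψ hψ
  rw [inner_add_right, inner_add_right, hu ψ hψ, hv ψ hψ, neg_add]

lemma HasWeakPartial.smul {i : Fin n} {u g : L2 Ω} (hu : HasWeakPartial Ω i u g) (c : ℝ) :
    HasWeakPartial Ω i (c • u) (c • g) := by
  rw [hasWeakPartial_iff_inner] at *
  intro ψ hψ
  rw [inner_smul_right, inner_smul_right, hu ψ hψ, mul_neg]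

lemma HasWeakPartial.sub {i : Fin n} {u v g h : L2 Ω} (hu : HasWeakPartial Ω i u g)
    (hv : HasWeakPartial Ω i v h) : HasWeakPartial Ω i (u - v) (g - h) := by
  simpa [sub_eq_add_neg] using hu.add (hv.smul (-1))

/-- For a fixed test function both sides of the defining identity are continuous on `L²(Ω)`, so the
graph of the weak derivative is closed. -/
lemma HasWeakPartial.of_tendsto {i : Fin n} {u g : L2 Ω} {U G : ℕ → L2 Ω}
    (h : ∀ k, HasWeakPartial Ω i (U k) (G k)) (hU : Tendsto U atTop (𝓝 u))
    (hG : Tendsto G atTop (𝓝 g)) : HasWeakPartial Ω i u g := by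
  simp only [hasWeakPartial_iff_inner] at *
  intro ψ hψ
  refine tendsto_nhds_unique (tendsto_const_nhds.inner hU) ?_
  simp_rw [h _ ψ hψ]
  exact (tendsto_const_nhds.inner hG).neg

/-- The span of the test functions in `L²(Ω)`. -/
def testSubmodule (Ω : Set (Euc n)) : Submodule ℝ (L2 Ω) where
  carrier := {u | ∃ ψ, IsTestFunction Ω ψ ∧ u =ᵐ[volume.restrict Ω] ψ}
  add_mem' := by
    rintro u v ⟨ψ, hψ, hu⟩ ⟨χ, hχ, hv⟩
    refine ⟨_, hψ.add hχ, ?_⟩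
    filter_upwards [Lp.coeFn_add u v, hu, hv] with x h1 h2 h3
    rw [h1, Pi.add_apply, h2, h3]
  zero_mem' := by
    refine ⟨fun _ => 0, ⟨contDiff_const, HasCompactSupport.zero, ?_⟩, Lp.coeFn_zero _ _ _⟩
    simp [tsupport]
  smul_mem' := by
    rintro c u ⟨ψ, hψ, hu⟩
    refine ⟨_, hψ.smul c, ?_⟩
    filter_upwards [Lp.coeFn_smul c u, hu] with x h1 h2
    simp [h1, h2]

/-- The fundamental lemma of the calculus of variations. Both the density of test functions and the
uniqueness of weak derivatives come from it. -/
lemma eq_zero_of_inner_test (hΩ : IsOpen Ω) {u : L2 Ω}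
    (h : ∀ ψ (hψ : IsTestFunction Ω ψ), inner ℝ (hψ.memLp.toLp _) u = 0) : u = 0 := by
  rw [Lp.eq_zero_iff_ae_eq_zero]
  have hloc : LocallyIntegrableOn u Ω volume := by
    refine (locallyIntegrableOn_iff hΩ.isLocallyClosed).2 fun k hk hkc => ?_
    have : MemLp u 2 ((volume.restrict Ω).restrict k) := (Lp.memLp u).restrict k
    rw [Measure.restrict_restrict hkc.measurableSet, Set.inter_eq_left.2 hk] at this
    have hfin : IsFiniteMeasure (volume.restrict k : Measure (Euc n)) :=
      ⟨by simpa using hkc.measure_lt_top⟩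
    exact this.integrable (by norm_num)
  have := hΩ.ae_eq_zero_of_integral_contDiff_smul_eq_zero hloc (fun ψ h1 h2 h3 => by
    have hψ : IsTestFunction Ω ψ := ⟨h1, h2, h3⟩
    have h0 := h ψ hψ
    rw [← integral_mul_eq_inner] at h0
    rw [← h0, ← setIntegral_eq_integral_of_forall_compl_eq_zero (s := Ω)]
    · simp [mul_comm]
    · intro x hx
      rw [image_eq_zero_of_notMem_tsupport (fun hx' => hx (h3 hx')), zero_smul])
  exact (ae_restrict_iff' hΩ.measurableSet).2 this

lemma dense_testSubmodule (hΩ : IsOpen Ω) : (testSubmodule Ω).topologicalClosure = ⊤ := by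
  rw [Submodule.topologicalClosure_eq_top_iff, Submodule.eq_bot_iff]
  intro u hu
  refine eq_zero_of_inner_test hΩ fun ψ hψ => ?_
  exact (Submodule.mem_orthogonal _ _).1 hu _ ⟨ψ, hψ, hψ.memLp.coeFn_toLp⟩

lemma HasWeakPartial.unique (hΩ : IsOpen Ω) {i : Fin n} {u g h : L2 Ω}
    (hg : HasWeakPartial Ω i u g) (hh : HasWeakPartial Ω i u h) : g = h := by
  rw [hasWeakPartial_iff_inner] at *
  rw [← sub_eq_zero]
  refine eq_zero_of_inner_test hΩ fun ψ hψ => ?_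
  rw [inner_sub_right, ← neg_inj, neg_sub, neg_zero, sub_eq_zero]
  have h1 := hg ψ hψ
  have h2 := hh ψ hψ
  linarith

lemma hasWeakPartial_weakPartial {u : L2 Ω} (hu : u ∈ H1 Ω) (i : Fin n) :
    HasWeakPartial Ω i u (weakPartial Ω i u) := by
  rw [weakPartial, dif_pos (hu i)]
  exact (hu i).choose_spec

lemma HasWeakPartial.weakPartial_eq (hΩ : IsOpen Ω) {i : Fin n} {u g : L2 Ω}
    (hg : HasWeakPartial Ω i u g) : weakPartial Ω i u = g := by
  have h : ∃ g : L2 Ω, HasWeakPartial Ω i u g := ⟨g, hg⟩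
  rw [weakPartial, dif_pos h]
  exact h.choose_spec.unique hΩ hg

/-- Classical derivatives of smooth functions are weak derivatives. -/
lemma hasWeakPartial_of_contDiff {ψ : Euc n → ℝ} (hψ : ContDiff ℝ ∞ ψ) {i : Fin n}
    {u g : L2 Ω} (hu : u =ᵐ[volume.restrict Ω] ψ)
    (hg : g =ᵐ[volume.restrict Ω] partialDeriv i ψ) : HasWeakPartial Ω i u g := by
  intro χ hχ
  have hc : ∀ {f : Euc n → ℝ}, Continuous f → ∀ {h : Euc n → ℝ}, IsTestFunction Ω h →
      ∫ x in Ω, f x * h x = ∫ x, f x * h x := by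
    intro f _ h hh
    refine setIntegral_eq_integral_of_forall_compl_eq_zero fun x hx => ?_
    rw [image_eq_zero_of_notMem_tsupport (fun hx' => hx (hh.2.2 hx')), mul_zero]
  have hi : ∀ {f : Euc n → ℝ}, Continuous f → ∀ {h : Euc n → ℝ}, IsTestFunction Ω h →
      Integrable (fun x => f x * h x) := fun hf h hh =>
    (hf.mul hh.1.continuous).integrable_of_hasCompactSupport hh.2.1.mul_left
  have hψ' := (contDiff_partialDeriv hψ i).continuous
  have h1 : ∫ x in Ω, u x * partialDeriv i χ x = ∫ x in Ω, ψ x * partialDeriv i χ x :=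
    integral_congr_ae (hu.mono fun x hx => by simp [hx])
  have h2 : ∫ x in Ω, g x * χ x = ∫ x in Ω, partialDeriv i ψ x * χ x :=
    integral_congr_ae (hg.mono fun x hx => by simp [hx])
  rw [h1, h2, hc hψ.continuous (hχ.partialDeriv i), hc hψ' hχ]
  exact integral_mul_fderiv_eq_neg_fderiv_mul_of_integrable (hi hψ' hχ)
    (hi hψ.continuous (hχ.partialDeriv i)) (hi hψ.continuous hχ)
    (fun x _ => hψ.differentiable (by simp) x) (fun x _ => hχ.1.differentiable (by simp) x)

/-- `H¹(Ω)` as a linear subspace of `L²(Ω)`. -/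
def H1Submodule (Ω : Set (Euc n)) : Submodule ℝ (L2 Ω) where
  carrier := H1 Ω
  add_mem' := fun hu hv i =>
    ⟨_, (hasWeakPartial_weakPartial hu i).add (hasWeakPartial_weakPartial hv i)⟩
  zero_mem' := fun i => ⟨0, hasWeakPartial_iff_inner.2 fun ψ hψ => by simp⟩
  smul_mem' := fun c _ hu i => ⟨_, (hasWeakPartial_weakPartial hu i).smul c⟩

lemma mem_H10_of_mem_testSubmodule (hΩ : IsOpen Ω) {u : L2 Ω} (hu : u ∈ testSubmodule Ω) :
    u ∈ H10 Ω := by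
  obtain ⟨ψ, hψ, hu⟩ := hu
  have hw : ∀ i, HasWeakPartial Ω i u ((hψ.partialDeriv i).memLp.toLp _) := fun i =>
    hasWeakPartial_of_contDiff hψ.1 hu (MemLp.coeFn_toLp _)
  refine ⟨fun i => ⟨_, hw i⟩, fun _ => ψ, fun _ => hψ, ?_, fun i => ?_⟩
  · have h0 : eLpNorm (fun x => ψ x - u x) 2 (volume.restrict Ω) = 0 := by
      rw [← eLpNorm_zero' (ε := ℝ)]
      exact eLpNorm_congr_ae (hu.mono fun x hx => by simp [hx])
    simp [h0]
  · have h0 : eLpNorm (fun x => partialDeriv i ψ x - (hψ.partialDeriv i).memLp.toLp _ x) 2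
        (volume.restrict Ω) = 0 := by
      rw [← eLpNorm_zero' (ε := ℝ)]
      exact eLpNorm_congr_ae
        ((hψ.partialDeriv i).memLp.coeFn_toLp.mono fun x hx => by simp [hx])
    simp [(hw i).weakPartial_eq hΩ, h0]

/-- Subtracting a test function does not change the trace. -/
lemma IsTrace.sub_test (hΩ : IsOpen Ω) {u v : L2 Ω} {g : L2Boundary Ω} (hu : IsTrace Ω u g)
    (hv : v ∈ testSubmodule Ω) : IsTrace Ω (u - v) g := by
  obtain ⟨χ, hχ, hvχ⟩ := hv
  obtain ⟨hu1, ψ, hψ, ⟨hL, hD⟩, hB⟩ := hu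
  have hw : ∀ i, HasWeakPartial Ω i v ((hχ.partialDeriv i).memLp.toLp _) := fun i =>
    hasWeakPartial_of_contDiff hχ.1 hvχ (MemLp.coeFn_toLp _)
  have hsub := fun i => (hasWeakPartial_weakPartial hu1 i).sub (hw i)
  refine ⟨fun i => ⟨_, hsub i⟩, fun k x => ψ k x - χ x, fun k => (hψ k).sub hχ.1,
    ⟨hL.congr fun k => ?_, fun i => (hD i).congr fun k => ?_⟩, hB.congr fun k => ?_⟩
  · refine eLpNorm_congr_ae ?_
    filter_upwards [Lp.coeFn_sub u v, hvχ] with x h1 h2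
    rw [h1, Pi.sub_apply, h2]
    ring
  · rw [(hsub i).weakPartial_eq hΩ]
    refine eLpNorm_congr_ae ?_
    filter_upwards [Lp.coeFn_sub (weakPartial Ω i u) ((hχ.partialDeriv i).memLp.toLp _),
      (hχ.partialDeriv i).memLp.coeFn_toLp] with x h1 h2
    rw [h1, Pi.sub_apply, h2, partialDeriv_sub (hψ k) hχ.1]
    ring
  · refine eLpNorm_congr_ae ?_
    -- Test functions vanish on `∂Ω`, since their support lies in the open set `Ω`; the boundary
    -- values are therefore unchanged almost everywhere.
    have hfr : ∀ᵐ x ∂surfaceMeasure Ω, x ∈ frontier Ω :=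
      ae_restrict_mem isClosed_frontier.measurableSet
    filter_upwards [hfr] with x hx
    have hxΩ : x ∉ Ω := by
      rw [hΩ.frontier_eq] at hx
      exact hx.2
    simp [image_eq_zero_of_notMem_tsupport (fun h => hxΩ (hχ.2.2 h))]

end WeakDerivative

/-! ### Correcting vectors into a closed subspace of finite codimension. -/

section FiniteCodimension

variable {H : Type*} [NormedAddCommGroup H] [InnerProductSpace ℝ H]

/-- A dense subspace contains a linear right inverse of the orthogonal projection onto any
finite-dimensional subspace. -/
lemma exists_section_of_dense {D V : Submodule ℝ H} (hD : D.topologicalClosure = ⊤)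
    [FiniteDimensional ℝ V] :
    ∃ T : V →ₗ[ℝ] H, (∀ v, T v ∈ D) ∧ ∀ v, V.orthogonalProjectionOnto (T v) = v := by
  let p : D →ₗ[ℝ] V := V.orthogonalProjectionOnto.toLinearMap ∘ₗ D.subtype
  have hp : LinearMap.range p = ⊤ := by
    have hd : DenseRange p := by
      have h1 : DenseRange V.orthogonalProjectionOnto :=
        (fun v => subset_closure ⟨(v : H), by simp⟩)
      have h2 : DenseRange D.subtype := by
        intro x
        have : x ∈ D.topologicalClosure := by simp [hD]
        rw [← SetLike.mem_coe, Submodule.topologicalClosure_coe] at this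
        simpa using this
      exact h1.comp h2 V.orthogonalProjectionOnto.continuous
    -- A dense subspace of the finite-dimensional `V` is closed, hence everything; so `p` is onto
    -- and splits linearly.
    have hc : IsClosed (LinearMap.range p : Set V) := Submodule.closed_of_finiteDimensional _
    rw [← SetLike.coe_set_eq, Submodule.top_coe, ← hc.closure_eq]
    exact hd.closure_range
  obtain ⟨s, hs⟩ := p.exists_rightInverse_of_surjective hp
  refine ⟨D.subtype ∘ₗ s, fun v => (s v).2, fun v => ?_⟩
  exact LinearMap.congr_fun hs v

variable [CompleteSpace H]

lemma mem_of_orthogonalProjectionOnto_orthogonal_eq_zero {L : Submodule ℝ H}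
    (hL : IsClosed (L : Set H)) [Lᗮ.HasOrthogonalProjection] {x : H}
    (hx : Lᗮ.orthogonalProjectionOnto x = 0) : x ∈ L := by
  rw [Submodule.orthogonalProjectionOnto_eq_zero_iff, Submodule.orthogonal_orthogonal_eq_closure,
    hL.submodule_topologicalClosure_eq] at hx
  exact hx

/-- Approximants `d k` in `D` are replaced by `d k - T (P (d k))`, which has no component in `Lᗮ`.
Since `T` is continuous on a finite-dimensional space and `P (d k) → P u = 0`, the limit is
unchanged. -/
lemma closure_inter_eq_of_dense {D L : Submodule ℝ H} (hD : D.topologicalClosure = ⊤)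
    (hL : IsClosed (L : Set H)) [FiniteDimensional ℝ Lᗮ] :
    closure ((D : Set H) ∩ L) = L := by
  refine subset_antisymm (hL.closure_subset_iff.2 Set.inter_subset_right) fun u hu => ?_
  obtain ⟨T, hT, hPT⟩ := exists_section_of_dense hD (V := Lᗮ)
  have huD : u ∈ closure (D : Set H) := by
    have : u ∈ D.topologicalClosure := by simp [hD]
    rwa [← SetLike.mem_coe, Submodule.topologicalClosure_coe] at this
  obtain ⟨d, hd, hlim⟩ := mem_closure_iff_seq_limit.1 huD
  have hTc : Continuous T := T.continuous_of_finiteDimensional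
  have hPu : Lᗮ.orthogonalProjectionOnto u = 0 := by
    rw [Submodule.orthogonalProjectionOnto_eq_zero_iff]
    exact L.le_orthogonal_orthogonal hu
  refine mem_closure_iff_seq_limit.2
    ⟨fun k => d k - T (Lᗮ.orthogonalProjectionOnto (d k)), fun k => ⟨?_, ?_⟩, ?_⟩
  · exact D.sub_mem (hd k) (hT _)
  · refine mem_of_orthogonalProjectionOnto_orthogonal_eq_zero hL ?_
    rw [map_sub, hPT, sub_self]
  · have := hlim.sub (((hTc.comp Lᗮ.orthogonalProjectionOnto.continuous).tendsto u).comp hlim)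
    simpa [hPu] using this

end FiniteCodimension

/-- A finite-dimensional subspace of `H¹(Ω)` is continuously embedded. -/
lemma exists_h1Norm_le {Ω : Set (Euc n)} (hΩ : IsOpen Ω) (V : Submodule ℝ (L2 Ω))
    [FiniteDimensional ℝ V] (hV : ∀ v ∈ V, v ∈ H1 Ω) :
    ∃ C : ℝ, 0 < C ∧ ∀ v ∈ V, h1Norm Ω v ≤ C * ‖v‖ := by
  -- Uniqueness of weak derivatives makes `weakPartial` linear on `V`, although it is defined by
  -- choice; finite dimension then makes it bounded.
  let d : Fin n → V →ₗ[ℝ] L2 Ω := fun i =>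
    { toFun := fun v => weakPartial Ω i v
      map_add' := fun u v => ((hasWeakPartial_weakPartial (hV u u.2) i).add
        (hasWeakPartial_weakPartial (hV v v.2) i)).weakPartial_eq hΩ
      map_smul' := fun c v =>
        ((hasWeakPartial_weakPartial (hV v v.2) i).smul c).weakPartial_eq hΩ }
  let d' : Fin n → V →L[ℝ] L2 Ω := fun i => LinearMap.toContinuousLinearMap (d i)
  refine ⟨Real.sqrt (1 + ∑ i, ‖d' i‖ ^ 2), Real.sqrt_pos.2 (by positivity), fun v hv => ?_⟩
  rw [h1Norm, ← Real.sqrt_sq (norm_nonneg v), ← Real.sqrt_mul (by positivity)]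
  refine Real.sqrt_le_sqrt ?_
  rw [Real.sqrt_sq (norm_nonneg v), add_mul, one_mul, Finset.sum_mul]
  gcongr with i
  rw [← mul_pow]
  gcongr
  exact (d' i).le_opNorm ⟨v, hv⟩

/-! ### Lipschitz graphs over hyperplanes. -/

section Graph

variable {Ω W : Set (Euc n)} {ν : Euc n} {ζ : (ℝ ∙ ν)ᗮ → ℝ}

/-- A boundary point in `W` is a limit of points of `Ω ∩ W`, so it lies on or above the graph;
strictly above, it would belong to the open set `Ω`. -/
lemma inner_eq_of_mem_frontier (hΩ : IsOpen Ω) (hW : IsOpen W) (hζ : Continuous ζ)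
    (hΩW : Ω ∩ W = {x | ζ ((ℝ ∙ ν)ᗮ.orthogonalProjectionOnto x) < inner ℝ ν x} ∩ W)
    {x : Euc n} (hx : x ∈ frontier Ω) (hxW : x ∈ W) :
    ζ ((ℝ ∙ ν)ᗮ.orthogonalProjectionOnto x) = inner ℝ ν x := by
  rw [hΩ.frontier_eq] at hx
  refine le_antisymm ?_ (not_lt.1 fun h => hx.2 ?_)
  · have h1 : x ∈ closure (Ω ∩ W) := by
      rw [Set.inter_comm]
      exact hW.inter_closure ⟨hxW, hx.1⟩
    rw [hΩW] at h1
    have hc : Continuous fun x => ζ ((ℝ ∙ ν)ᗮ.orthogonalProjectionOnto x) := by fun_prop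
    exact closure_lt_subset_le hc (by fun_prop) (closure_mono Set.inter_subset_left h1)
  · exact (hΩW.symm.subset ⟨h, hxW⟩).1

lemma orthogonalProjectionOnto_add_smul (x : Euc n) (t : ℝ) :
    (ℝ ∙ ν)ᗮ.orthogonalProjectionOnto (x + t • ν) = (ℝ ∙ ν)ᗮ.orthogonalProjectionOnto x := by
  have h : (ℝ ∙ ν)ᗮ.orthogonalProjectionOnto ν = 0 :=
    Submodule.orthogonalProjectionOnto_eq_zero_iff.2
    (Submodule.le_orthogonal_orthogonal _ (Submodule.mem_span_singleton_self ν))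
  rw [map_add, map_smul, h, smul_zero, add_zero]

/-- Moving from a point of the graph in the direction `ν` enters `Ω` at once, while the point itself
is not in `Ω`. -/
lemma mem_frontier_of_inner_eq (hΩ : IsOpen Ω) (hW : IsOpen W) (hν : ‖ν‖ = 1)
    (hΩW : Ω ∩ W = {x | ζ ((ℝ ∙ ν)ᗮ.orthogonalProjectionOnto x) < inner ℝ ν x} ∩ W)
    {x : Euc n} (hx : ζ ((ℝ ∙ ν)ᗮ.orthogonalProjectionOnto x) = inner ℝ ν x) (hxW : x ∈ W) :
    x ∈ frontier Ω := by
  rw [hΩ.frontier_eq]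
  refine ⟨?_, fun h => (hΩW.subset ⟨h, hxW⟩).1.ne hx⟩
  have hlim : Tendsto (fun t : ℝ => x + t • ν) (𝓝[>] 0) (𝓝 x) := by
    have : ContinuousAt (fun t : ℝ => x + t • ν) 0 := by fun_prop
    simpa [ContinuousAt] using this.tendsto.mono_left nhdsWithin_le_nhds
  refine mem_closure_of_tendsto hlim ?_
  filter_upwards [hlim (hW.mem_nhds hxW), self_mem_nhdsWithin] with t htW ht
  refine (hΩW.symm.subset ⟨?_, htW⟩).1
  simp only [Set.mem_ofPred_eq, orthogonalProjectionOnto_add_smul, hx, inner_add_right,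
    inner_smul_right, real_inner_self_eq_norm_sq, hν]
  simpa using ht

/-- The parametrization of a graph over a hyperplane. -/
def graphMap (ν : Euc n) (ζ : (ℝ ∙ ν)ᗮ → ℝ) (v : (ℝ ∙ ν)ᗮ) : Euc n := (v : Euc n) + ζ v • ν

lemma graphMap_orthogonalProjectionOnto (hν : ‖ν‖ = 1) {x : Euc n}
    (hx : ζ ((ℝ ∙ ν)ᗮ.orthogonalProjectionOnto x) = inner ℝ ν x) :
    graphMap ν ζ ((ℝ ∙ ν)ᗮ.orthogonalProjectionOnto x) = x := by
  have h := Submodule.starProjection_add_starProjection_orthogonal (K := ℝ ∙ ν) x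
  rw [Submodule.starProjection_unit_singleton ℝ hν] at h
  rw [graphMap, hx, add_comm]
  exact h

lemma orthogonalProjectionOnto_graphMap (v : (ℝ ∙ ν)ᗮ) :
    (ℝ ∙ ν)ᗮ.orthogonalProjectionOnto (graphMap ν ζ v) = v := by
  rw [graphMap, orthogonalProjectionOnto_add_smul,
    Submodule.orthogonalProjectionOnto_mem_subspace_eq_self]

lemma inner_graphMap (hν : ‖ν‖ = 1) (v : (ℝ ∙ ν)ᗮ) : inner ℝ ν (graphMap ν ζ v) = ζ v := by
  have h : inner ℝ ν (v : Euc n) = 0 := Submodule.mem_orthogonal_singleton_iff_inner_right.1 v.2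
  rw [graphMap, inner_add_right, inner_smul_right, real_inner_self_eq_norm_sq, hν, h]
  simp

lemma lipschitzWith_graphMap {K : ℝ≥0} (hν : ‖ν‖ = 1) (hζ : LipschitzWith K ζ) :
    LipschitzWith (1 + K) (graphMap ν ζ) := by
  refine LipschitzWith.of_dist_le_mul fun v w => ?_
  have h1 : graphMap ν ζ v - graphMap ν ζ w = ((v - w : (ℝ ∙ ν)ᗮ) : Euc n) + (ζ v - ζ w) • ν := by
    simp [graphMap, sub_smul]
    abel
  rw [dist_eq_norm, h1]
  refine (norm_add_le _ _).trans ?_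
  rw [norm_smul, hν, mul_one, ← dist_eq_norm, ← Submodule.coe_norm, ← dist_eq_norm v w]
  push_cast
  linarith [hζ.dist_le_mul v w]

lemma lipschitzWith_orthogonalProjectionOnto (V : Submodule ℝ (Euc n)) :
    LipschitzWith 1 V.orthogonalProjectionOnto := by
  refine V.orthogonalProjectionOnto.lipschitz.weaken ?_
  exact_mod_cast V.orthogonalProjectionOnto_norm_le

lemma finrank_orthogonal_span_singleton_eq (hν : ‖ν‖ = 1) :
    Module.finrank ℝ (ℝ ∙ ν)ᗮ = n - 1 := by
  have h := Submodule.finrank_add_finrank_orthogonal (ℝ ∙ ν)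
  rw [finrank_span_singleton (by rintro rfl; simp at hν), finrank_euclideanSpace_fin] at h
  omega

/-- Hausdorff measure of balls in a hyperplane. -/
lemma exists_hausdorffMeasure_closedBall (hn : 1 ≤ n) (hν : ‖ν‖ = 1) :
    ∃ a : ℝ≥0, 0 < a ∧ ∀ (v : (ℝ ∙ ν)ᗮ) (r : ℝ), 0 ≤ r →
      Measure.hausdorffMeasure ((n : ℝ) - 1) (Metric.closedBall v r) =
        a * ENNReal.ofReal r ^ (n - 1) := by
  have hdim := finrank_orthogonal_span_singleton_eq hν
  -- As `1 ≤ n`, the real exponent `n - 1` is the dimension of the hyperplane, where Hausdorff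
  -- measure is a Haar measure and scales accordingly.
  have hd : ((n : ℝ) - 1) = (Module.finrank ℝ (ℝ ∙ ν)ᗮ : ℝ) := by
    rw [hdim]; push_cast [hn]; ring
  rw [hd]
  have hH : (Measure.hausdorffMeasure (Module.finrank ℝ (ℝ ∙ ν)ᗮ : ℝ) :
      Measure (ℝ ∙ ν)ᗮ).IsAddHaarMeasure := isAddHaarMeasure_hausdorffMeasure
  set μ : Measure (ℝ ∙ ν)ᗮ := Measure.hausdorffMeasure (Module.finrank ℝ (ℝ ∙ ν)ᗮ : ℝ)
  have hfin : μ (Metric.ball 0 1) ≠ ⊤ := Metric.isBounded_ball.measure_lt_top.ne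
  have hpos : μ (Metric.ball 0 1) ≠ 0 := (Metric.measure_ball_pos μ 0 one_pos).ne'
  refine ⟨(μ (Metric.ball 0 1)).toNNReal, ENNReal.toNNReal_pos hpos hfin, fun v r hr => ?_⟩
  rw [Measure.addHaar_closedBall μ v hr, hdim, ENNReal.ofReal_pow hr, mul_comm,
    ENNReal.coe_toNNReal hfin]

end Graph

/-! ### Size of surface measure on balls, and interior cones. -/

section Geometry

variable {Ω : Set (Euc n)}

lemma IsBoundedLipschitzDomain.isCompact_frontier (hΩ : IsBoundedLipschitzDomain Ω) :
    IsCompact (frontier Ω) :=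
  Metric.isCompact_of_isClosed_isBounded isClosed_frontier
    (hΩ.isBounded.closure.subset frontier_subset_closure)

lemma IsBoundedLipschitzDomain.frontier_nonempty (hn : 1 ≤ n) (hΩ : IsBoundedLipschitzDomain Ω) :
    (frontier Ω).Nonempty := by
  rw [Set.nonempty_iff_ne_empty, Ne, frontier_eq_empty_iff]
  rintro (h | h)
  · exact hΩ.isConnected.nonempty.ne_empty h
  · have : Nontrivial (Euc n) := by
      have : Nonempty (Fin n) := ⟨⟨0, hn⟩⟩
      infer_instance
    have hb := hΩ.isBounded
    rw [h] at hb
    exact NormedSpace.unbounded_univ ℝ (Euc n) hb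

/-- The surface measure of a ball of radius `r` is at most of order `r ^ (n - 1)`. -/
lemma IsBoundedLipschitzDomain.exists_surfaceMeasure_le (hn : 1 ≤ n)
    (hΩ : IsBoundedLipschitzDomain Ω) :
    ∃ C : ℝ≥0, ∀ (z : Euc n) (r : ℝ), 0 ≤ r →
      surfaceMeasure Ω (Metric.closedBall z r) ≤ C * ENNReal.ofReal r ^ (n - 1) := by
  -- The property passes to subsets and finite unions, so by compactness of the boundary it need
  -- only be checked near each point.
  let p : Set (Euc n) → Prop := fun S => ∃ C : ℝ≥0, ∀ (z : Euc n) (r : ℝ), 0 ≤ r →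
      Measure.hausdorffMeasure ((n : ℝ) - 1) (Metric.closedBall z r ∩ S) ≤
        C * ENNReal.ofReal r ^ (n - 1)
  have hp : p (frontier Ω) := by
    refine hΩ.isCompact_frontier.induction_on ⟨0, by simp⟩ ?_ ?_ ?_
    · rintro S T hST ⟨C, hC⟩
      exact ⟨C, fun z r hr => (measure_mono (Set.inter_subset_inter_right _ hST)).trans (hC z r hr)⟩
    · rintro S T ⟨C, hC⟩ ⟨D, hD⟩
      refine ⟨C + D, fun z r hr => ?_⟩
      rw [Set.inter_union_distrib_left, ENNReal.coe_add, add_mul]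
      exact (measure_union_le _ _).trans (add_le_add (hC z r hr) (hD z r hr))
    · intro x₀ hx₀
      obtain ⟨W, ν, ζ, K, hW, hxW, hν, hζ, hΩW⟩ := hΩ.boundary x₀ hx₀
      refine ⟨frontier Ω ∩ W, Filter.inter_mem self_mem_nhdsWithin
        (mem_nhdsWithin_of_mem_nhds (hW.mem_nhds hxW)), ?_⟩
      obtain ⟨a, -, ha⟩ := exists_hausdorffMeasure_closedBall hn hν
      refine ⟨(1 + K) ^ ((n : ℝ) - 1) * a, fun z r hr => ?_⟩
      have hd : (0 : ℝ) ≤ (n : ℝ) - 1 := by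
        have : (1 : ℝ) ≤ n := by exact_mod_cast hn
        linarith
      -- Projection does not increase distances, so the part of the graph in the ball is covered by
      -- the Lipschitz image of a ball of the same radius in the hyperplane.
      have hsub : Metric.closedBall z r ∩ (frontier Ω ∩ W) ⊆
          graphMap ν ζ '' Metric.closedBall ((ℝ ∙ ν)ᗮ.orthogonalProjectionOnto z) r := by
        rintro x ⟨hxz, hx, hxW⟩
        refine ⟨(ℝ ∙ ν)ᗮ.orthogonalProjectionOnto x, ?_, graphMap_orthogonalProjectionOnto hν
          (inner_eq_of_mem_frontier hΩ.isOpen hW hζ.continuous hΩW hx hxW)⟩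
        have := (lipschitzWith_orthogonalProjectionOnto (ℝ ∙ ν)ᗮ).dist_le_mul x z
        rw [NNReal.coe_one, one_mul] at this
        exact this.trans hxz
      refine (measure_mono hsub).trans
        (((lipschitzWith_graphMap hν hζ).hausdorffMeasure_image_le hd _).trans ?_)
      rw [ha _ _ hr, ENNReal.coe_mul, mul_assoc, ENNReal.coe_rpow_of_nonneg _ hd]
  obtain ⟨C, hC⟩ := hp
  refine ⟨C, fun z r hr => ?_⟩
  rw [surfaceMeasure, Measure.restrict_apply Metric.isClosed_closedBall.measurableSet]
  exact hC z r hr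

/-- The surface measure of a ball of radius `r` centred on the boundary is at least of order
`r ^ (n - 1)`. -/
lemma IsBoundedLipschitzDomain.exists_le_surfaceMeasure (hn : 1 ≤ n)
    (hΩ : IsBoundedLipschitzDomain Ω) (R : ℝ) :
    ∃ c : ℝ≥0, 0 < c ∧ ∀ x ∈ frontier Ω, ∀ r : ℝ, 0 < r → r ≤ R →
      c * ENNReal.ofReal r ^ (n - 1) ≤ surfaceMeasure Ω (Metric.closedBall x r) := by
  let p : Set (Euc n) → Prop := fun S => ∃ c : ℝ≥0, 0 < c ∧ ∃ δ : ℝ, 0 < δ ∧ ∀ x ∈ S, ∀ r : ℝ,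
      0 < r → r ≤ δ → c * ENNReal.ofReal r ^ (n - 1) ≤ surfaceMeasure Ω (Metric.closedBall x r)
  have hp : p (frontier Ω) := by
    refine hΩ.isCompact_frontier.induction_on ⟨1, one_pos, 1, one_pos, by simp⟩ ?_ ?_ ?_
    · rintro S T hST ⟨c, hc, δ, hδ, h⟩
      exact ⟨c, hc, δ, hδ, fun x hx => h x (hST hx)⟩
    · rintro S T ⟨c, hc, δ, hδ, h⟩ ⟨c', hc', δ', hδ', h'⟩
      refine ⟨min c c', lt_min hc hc', min δ δ', lt_min hδ hδ', ?_⟩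
      rintro x (hx | hx) r hr hrδ
      · refine le_trans ?_ (h x hx r hr (hrδ.trans (min_le_left _ _)))
        gcongr
        exact min_le_left _ _
      · refine le_trans ?_ (h' x hx r hr (hrδ.trans (min_le_right _ _)))
        gcongr
        exact min_le_right _ _
    · intro x₀ hx₀
      obtain ⟨W, ν, ζ, K, hW, hxW, hν, hζ, hΩW⟩ := hΩ.boundary x₀ hx₀
      obtain ⟨ε, hε, hεW⟩ := Metric.isOpen_iff.1 hW x₀ hxW
      refine ⟨frontier Ω ∩ Metric.ball x₀ (ε / 2), Filter.inter_mem self_mem_nhdsWithin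
        (mem_nhdsWithin_of_mem_nhds (Metric.ball_mem_nhds _ (by positivity))), ?_⟩
      obtain ⟨a, ha0, ha⟩ := exists_hausdorffMeasure_closedBall hn hν
      have hd : (0 : ℝ) ≤ (n : ℝ) - 1 := by
        have : (1 : ℝ) ≤ n := by exact_mod_cast hn
        linarith
      refine ⟨a * ((1 + K)⁻¹) ^ (n - 1), by positivity, ε / 3, by positivity, ?_⟩
      rintro x ⟨hx, hxx₀⟩ r hr hrε
      have hxW : x ∈ W := hεW (Metric.ball_subset_ball (by linarith) hxx₀)
      have hxg := inner_eq_of_mem_frontier hΩ.isOpen hW hζ.continuous hΩW hx hxW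
      set v := (ℝ ∙ ν)ᗮ.orthogonalProjectionOnto x with hv
      have hxv : graphMap ν ζ v = x := graphMap_orthogonalProjectionOnto hν hxg
      -- The measure of the boundary piece is at least that of its projection, which contains a ball
      -- of radius `r / (1 + K)` because the graph map is `(1 + K)`-Lipschitz.
      have hsub : Metric.closedBall v ((1 + K)⁻¹ * r) ⊆
          (ℝ ∙ ν)ᗮ.orthogonalProjectionOnto '' (Metric.closedBall x r ∩ frontier Ω) := by
        intro w hw
        have hdist : dist (graphMap ν ζ w) x ≤ r := by
          have h1 := (lipschitzWith_graphMap hν hζ).dist_le_mul w v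
          rw [hxv] at h1
          refine h1.trans ((mul_le_mul_of_nonneg_left hw (by positivity)).trans ?_)
          push_cast
          rw [← mul_assoc, mul_inv_cancel₀ (by positivity), one_mul]
        refine ⟨graphMap ν ζ w, ⟨hdist, ?_⟩, orthogonalProjectionOnto_graphMap w⟩
        refine mem_frontier_of_inner_eq hΩ.isOpen hW hν hΩW ?_ (hεW ?_)
        · rw [orthogonalProjectionOnto_graphMap, inner_graphMap hν]
        · have := dist_triangle (graphMap ν ζ w) x x₀
          rw [Metric.mem_ball] at hxx₀ ⊢
          linarith
      have hr' : (0 : ℝ) ≤ (1 + K)⁻¹ * r := by positivity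
      have h1 := (measure_mono hsub).trans
        ((lipschitzWith_orthogonalProjectionOnto (ℝ ∙ ν)ᗮ).hausdorffMeasure_image_le hd _)
      rw [ha _ _ hr', ENNReal.coe_one, ENNReal.one_rpow, one_mul] at h1
      rw [surfaceMeasure, Measure.restrict_apply Metric.isClosed_closedBall.measurableSet]
      refine le_trans (le_of_eq ?_) h1
      rw [ENNReal.ofReal_mul (by positivity), mul_pow, ENNReal.coe_mul, mul_assoc, ENNReal.coe_pow]
      congr 3
      rw [← ENNReal.ofReal_coe_nnreal]
  obtain ⟨c, hc, δ, hδ, h⟩ := hp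
  -- Radii up to `R` are shrunk by the fixed factor `min 1 (δ / max R 1)` to fall below `δ`, at the
  -- price of a smaller constant; `max R 1` keeps the denominator positive.
  have hm : 0 < min 1 (δ / max R 1) := lt_min one_pos (by positivity)
  refine ⟨c * (min 1 (δ / max R 1)).toNNReal ^ (n - 1),
    mul_pos hc (pow_pos (Real.toNNReal_pos.2 hm) _), fun x hx r hr hrR => ?_⟩
  set q := min 1 (δ / max R 1) with hq
  have hqr : q * r ≤ δ := by
    calc q * r ≤ δ / max R 1 * max R 1 := by
          gcongr
          · exact min_le_right _ _
          · exact hrR.trans (le_max_left _ _)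
      _ = δ := div_mul_cancel₀ _ (by positivity)
  refine le_trans (le_of_eq ?_) ((h x hx (q * r) (by positivity) hqr).trans
    (measure_mono (Metric.closedBall_subset_closedBall ?_)))
  · rw [ENNReal.ofReal_mul hm.le, mul_pow, ENNReal.coe_mul, mul_assoc, ENNReal.coe_pow]
    rfl
  · exact mul_le_of_le_one_left hr.le (min_le_left _ _)

/-- Each point of `P` is the vertex of a cone contained in `Ω`, with direction `ν`, aperture and
height bounded below. -/
def HasCones (Ω P : Set (Euc n)) (ν : Euc n) (c T : ℝ) : Prop :=
  ∀ x ∈ P, ∀ s : ℝ, 0 < s → s < T → ∀ w : Euc n, ‖w‖ < c →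
    Metric.ball (x + s • (ν + w)) (c * s) ⊆ Ω

/-- A displacement `s • (ν + v)` raises the height by at least `s (1 - ‖v‖)` and the graph by at
most `K s ‖v‖`, so the point stays above the graph as long as `(1 + K) ‖v‖ < 1`. -/
lemma IsBoundedLipschitzDomain.exists_hasCones (hΩ : IsBoundedLipschitzDomain Ω) {x₀ : Euc n}
    (hx₀ : x₀ ∈ frontier Ω) :
    ∃ (ν : Euc n) (c T δ : ℝ), ‖ν‖ = 1 ∧ 0 < c ∧ c ≤ 1 ∧ 0 < T ∧ 0 < δ ∧
      HasCones Ω (frontier Ω ∩ Metric.ball x₀ δ) ν c T := by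
  obtain ⟨W, ν, ζ, K, hW, hxW, hν, hζ, hΩW⟩ := hΩ.boundary x₀ hx₀
  obtain ⟨ε, hε, hεW⟩ := Metric.isOpen_iff.1 hW x₀ hxW
  have hK : (0 : ℝ) < 1 + K := by positivity
  have hc1 : (2 * (1 + K) : ℝ)⁻¹ ≤ 1 := by
    refine inv_le_one_of_one_le₀ ?_
    have : (0 : ℝ) ≤ K := K.2
    linarith
  -- The aperture `w` and the radius of the ball use up `c` each, so `2 * c = 1 / (1 + K)` in total.
  -- Displacements are below `3 * ε / 8`, and vertices lie within `ε / 2` of `x₀`, so everything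
  -- stays in the `ε`-ball inside `W`.
  refine ⟨ν, (2 * (1 + K))⁻¹, ε / 8, ε / 2, hν, by positivity, hc1, by positivity, by positivity,
    ?_⟩
  rintro x ⟨hx, hxx₀⟩ s hs hsT w hw z hz
  set c : ℝ := (2 * (1 + K))⁻¹ with hc
  have hcK : (1 + K) * (2 * c) = 1 := by rw [hc]; field_simp
  have hxW : x ∈ W := hεW (Metric.ball_subset_ball (by linarith) hxx₀)
  have hxg := inner_eq_of_mem_frontier hΩ.isOpen hW hζ.continuous hΩW hx hxW
  obtain ⟨v, hv, rfl⟩ : ∃ v : Euc n, ‖v‖ < 2 * c ∧ z = x + s • ν + s • v := by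
    refine ⟨s⁻¹ • (z - x - s • ν), ?_, ?_⟩
    · have h1 : s⁻¹ • (z - x - s • ν) = s⁻¹ • (z - (x + s • (ν + w))) + w := by
        rw [smul_add, ← add_assoc, ← sub_sub, ← sub_sub, smul_sub _ _ (s • w), smul_smul,
          inv_mul_cancel₀ hs.ne', one_smul, sub_add_cancel]
      rw [h1]
      refine (norm_add_le _ _).trans_lt ?_
      rw [norm_smul, norm_inv, Real.norm_of_nonneg hs.le, ← dist_eq_norm]
      have h2 : s⁻¹ * dist z (x + s • (ν + w)) < c := by
        rw [inv_mul_lt_iff₀ hs, mul_comm]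
        exact hz
      linarith
    · rw [smul_smul, mul_inv_cancel₀ hs.ne', one_smul]
      abel
  have hW' : x + s • ν + s • v ∈ W := by
    refine hεW ?_
    have h1 : dist (x + s • ν + s • v) x ≤ s * 1 + s * ‖v‖ := by
      rw [dist_eq_norm, add_assoc, add_sub_cancel_left]
      refine (norm_add_le _ _).trans ?_
      rw [norm_smul, norm_smul, hν, Real.norm_of_nonneg hs.le]
    have h2 := dist_triangle (x + s • ν + s • v) x x₀
    rw [Metric.mem_ball] at hxx₀ ⊢
    have h3 : s * ‖v‖ ≤ s * 2 := by
      gcongr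
      linarith
    linarith
  refine (hΩW.symm.subset ⟨?_, hW'⟩).1
  rw [Set.mem_ofPred_eq]
  set P := (ℝ ∙ ν)ᗮ.orthogonalProjectionOnto with hP
  have h1 : ζ (P (x + s • ν + s • v)) ≤ inner ℝ ν x + K * (s * ‖v‖) := by
    rw [← hxg, map_add, orthogonalProjectionOnto_add_smul]
    have h2 := hζ.dist_le_mul (P x + P (s • v)) (P x)
    rw [dist_eq_norm (P x + P (s • v)), add_sub_cancel_left] at h2
    have h3 : ‖P (s • v)‖ ≤ s * ‖v‖ := by
      have := (lipschitzWith_orthogonalProjectionOnto (ℝ ∙ ν)ᗮ).dist_le_mul (s • v) 0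
      rw [map_zero, dist_zero_right, dist_zero_right, norm_smul s v, Real.norm_of_nonneg hs.le,
        NNReal.coe_one, one_mul] at this
      exact this
    have h4 := le_abs_self (ζ (P x + P (s • v)) - ζ (P x))
    rw [← Real.dist_eq] at h4
    have h5 : (K : ℝ) * ‖P (s • v)‖ ≤ K * (s * ‖v‖) := by gcongr
    linarith
  refine h1.trans_lt ?_
  rw [inner_add_right, inner_add_right, inner_smul_right, inner_smul_right,
    real_inner_self_eq_norm_sq, hν]
  have h6 : -‖v‖ ≤ inner ℝ ν v := by
    have := (abs_le.1 (abs_real_inner_le_norm ν v)).1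
    rwa [hν, one_mul] at this
  have h7 : (1 + K) * ‖v‖ < 1 := (mul_lt_mul_of_pos_left hv hK).trans_eq hcK
  have h8 : s * (K * ‖v‖) < s * (1 + inner ℝ ν v) := by
    gcongr
    linarith
  linarith

lemma IsBoundedLipschitzDomain.isFiniteMeasure_surfaceMeasure (hn : 1 ≤ n)
    (hΩ : IsBoundedLipschitzDomain Ω) : IsFiniteMeasure (surfaceMeasure Ω) := by
  obtain ⟨C, hC⟩ := hΩ.exists_surfaceMeasure_le hn
  obtain ⟨R, hR⟩ := hΩ.isCompact_frontier.isBounded.subset_closedBall 0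
  refine ⟨?_⟩
  have h1 : surfaceMeasure Ω Set.univ = surfaceMeasure Ω (Metric.closedBall 0 (max R 0)) := by
    simp only [surfaceMeasure, Measure.restrict_apply MeasurableSet.univ,
      Measure.restrict_apply Metric.isClosed_closedBall.measurableSet, Set.univ_inter]
    rw [Set.inter_eq_right.2 (hR.trans (Metric.closedBall_subset_closedBall (le_max_left _ _)))]
  rw [h1]
  exact (hC 0 _ (le_max_right _ _)).trans_lt
    (ENNReal.mul_lt_top ENNReal.coe_lt_top (ENNReal.pow_lt_top ENNReal.ofReal_lt_top))

lemma ae_mem_frontier : ∀ᵐ x ∂surfaceMeasure Ω, x ∈ frontier Ω :=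
  ae_restrict_mem isClosed_frontier.measurableSet

end Geometry

/-! ### Weighted Cauchy–Schwarz, Hardy's inequality and scaling. -/

section Integrals

/-- Weighted Cauchy–Schwarz inequality. -/
lemma sq_lintegral_mul_le {α : Type*} [MeasurableSpace α] {μ : Measure α} {f k : α → ENNReal}
    (hf : AEMeasurable f μ) (hk : AEMeasurable k μ) :
    (∫⁻ a, f a * k a ∂μ) ^ 2 ≤ (∫⁻ a, k a ∂μ) * ∫⁻ a, f a ^ 2 * k a ∂μ := by
  have hsq : ∀ x : ENNReal, (x ^ (1 / 2 : ℝ)) ^ 2 = x := fun x => by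
    rw [← ENNReal.rpow_natCast, ← ENNReal.rpow_mul]
    norm_num
  -- Hölder's inequality applied to the factors `f √k` and `√k`.
  have h := ENNReal.lintegral_mul_le_Lp_mul_Lq μ Real.HolderConjugate.two_two
    (hf.mul (hk.pow_const (1 / 2 : ℝ))) (hk.pow_const (1 / 2 : ℝ))
  have h1 : ∀ a, ((f * fun a => k a ^ (1 / 2 : ℝ)) * fun a => k a ^ (1 / 2 : ℝ)) a = f a * k a := by
    intro a
    simp only [Pi.mul_apply]
    rw [mul_assoc, ← sq, hsq]
  have h2 : ∀ a, (f * fun a => k a ^ (1 / 2 : ℝ)) a ^ (2 : ℝ) = f a ^ 2 * k a := by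
    intro a
    rw [← Nat.cast_two, ENNReal.rpow_natCast, Pi.mul_apply, mul_pow]
    congr 1
    exact hsq _
  have h3 : ∀ a, (k a ^ (1 / 2 : ℝ)) ^ (2 : ℝ) = k a := by
    intro a
    rw [← Nat.cast_two, ENNReal.rpow_natCast]
    exact hsq _
  simp only [h1, h2, h3] at h
  calc (∫⁻ a, f a * k a ∂μ) ^ 2 ≤ _ := pow_le_pow_left' h 2
    _ = _ := by rw [mul_pow, hsq, hsq, mul_comm]

lemma lintegral_rpow_neg_half {s : ℝ} (hs : 0 < s) :
    ∫⁻ t in Set.Ioo 0 s, ENNReal.ofReal (t ^ (-(1 / 2) : ℝ)) =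
      ENNReal.ofReal (2 * s ^ (1 / 2 : ℝ)) := by
  have hInt : IntegrableOn (fun t : ℝ => t ^ (-(1 / 2) : ℝ)) (Set.Ioo 0 s) :=
    (intervalIntegral.integrableOn_Ioo_rpow_iff hs).2 (by norm_num)
  rw [← ofReal_integral_eq_lintegral_ofReal hInt]
  · rw [← integral_Ioc_eq_integral_Ioo, ← intervalIntegral.integral_of_le hs.le,
      integral_rpow (Or.inl (by norm_num))]
    congr 1
    ring_nf
  · filter_upwards [ae_restrict_mem measurableSet_Ioo] with t ht
    exact Real.rpow_nonneg ht.1.le _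

lemma lintegral_Ioi_rpow_neg_three_half {t : ℝ} (ht : 0 < t) :
    ∫⁻ s in Set.Ioi t, ENNReal.ofReal (s ^ (-(3 / 2) : ℝ)) =
      ENNReal.ofReal (2 * t ^ (-(1 / 2) : ℝ)) := by
  have hInt : IntegrableOn (fun t : ℝ => t ^ (-(3 / 2) : ℝ)) (Set.Ioi t) :=
    integrableOn_Ioi_rpow_of_lt (by norm_num) ht
  rw [← ofReal_integral_eq_lintegral_ofReal hInt]
  · rw [integral_Ioi_rpow_of_lt (by norm_num) ht]
    congr 1
    ring_nf
  · filter_upwards [ae_restrict_mem measurableSet_Ioi] with s hs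
    exact Real.rpow_nonneg (ht.trans hs).le _

/-- Hardy's inequality on an interval. -/
lemma lintegral_hardy {φ φ' : ℝ → ℝ} (hφ : ∀ t, HasDerivAt φ (φ' t) t) (hφ' : Continuous φ')
    (T : ℝ) :
    ∫⁻ s in Set.Ioo 0 T, (ENNReal.ofReal s ^ 2)⁻¹ * ‖φ 0 - φ s‖ₑ ^ 2 ≤
      4 * ∫⁻ s in Set.Ioo 0 T, ‖φ' s‖ₑ ^ 2 := by
  have hm : Measurable fun t => ENNReal.ofReal (t ^ (1 / 2 : ℝ)) * ‖φ' t‖ₑ ^ 2 := by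
    have := hφ'.measurable
    fun_prop
  have hpt : ∀ s ∈ Set.Ioo 0 T, (ENNReal.ofReal s ^ 2)⁻¹ * ‖φ 0 - φ s‖ₑ ^ 2 ≤
      ∫⁻ t in Set.Ioo 0 T, (Set.Ioi t).indicator
        (fun s => 2 * ENNReal.ofReal (s ^ (-(3 / 2) : ℝ))) s *
          (ENNReal.ofReal (t ^ (1 / 2 : ℝ)) * ‖φ' t‖ₑ ^ 2) := by
    intro s hs
    have h1 : ‖φ 0 - φ s‖ₑ ≤ ∫⁻ t in Set.Ioo 0 s, ‖φ' t‖ₑ := by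
      have : φ s - φ 0 = ∫ t in Set.Ioo 0 s, φ' t := by
        rw [← integral_Ioc_eq_integral_Ioo, ← intervalIntegral.integral_of_le hs.1.le]
        exact (intervalIntegral.integral_eq_sub_of_hasDerivAt (fun t _ => hφ t)
          (hφ'.intervalIntegrable _ _)).symm
      rw [← enorm_neg, neg_sub, this]
      exact enorm_integral_le_lintegral_enorm _
    -- The Cauchy–Schwarz weight `t^(-1/2)` has integral `2 s^(1/2)` on `(0, s)`. After division by
    -- `s²` the factor `2 s^(-3/2)` remains; its integral over `s > t` is `4 t^(-1/2)`, which
    -- cancels the `t^(1/2)` in front of `φ'(t)²` and leaves the constant `4`.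
    have h2 : ∫⁻ t in Set.Ioo 0 s, ‖φ' t‖ₑ = ∫⁻ t in Set.Ioo 0 s,
        (ENNReal.ofReal (t ^ (1 / 2 : ℝ)) * ‖φ' t‖ₑ) * ENNReal.ofReal (t ^ (-(1 / 2) : ℝ)) := by
      refine setLIntegral_congr_fun measurableSet_Ioo fun t ht => ?_
      rw [mul_right_comm, ← ENNReal.ofReal_mul (Real.rpow_nonneg ht.1.le _),
        ← Real.rpow_add ht.1]
      simp
    have h3 : ‖φ 0 - φ s‖ₑ ^ 2 ≤ ENNReal.ofReal (2 * s ^ (1 / 2 : ℝ)) *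
        ∫⁻ t in Set.Ioo 0 s, ENNReal.ofReal (t ^ (1 / 2 : ℝ)) * ‖φ' t‖ₑ ^ 2 := by
      refine (pow_le_pow_left' (h1.trans_eq h2) 2).trans ((sq_lintegral_mul_le ?_ ?_).trans_eq ?_)
      · have := hφ'.measurable
        fun_prop
      · fun_prop
      · rw [lintegral_rpow_neg_half hs.1]
        congr 1
        refine setLIntegral_congr_fun measurableSet_Ioo fun t ht => ?_
        rw [mul_pow, sq (ENNReal.ofReal _), mul_right_comm, mul_assoc (ENNReal.ofReal _),
          ← ENNReal.ofReal_mul (Real.rpow_nonneg ht.1.le _), ← Real.rpow_add ht.1]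
        simp
    have h4 : (ENNReal.ofReal s ^ 2)⁻¹ * ENNReal.ofReal (2 * s ^ (1 / 2 : ℝ)) =
        2 * ENNReal.ofReal (s ^ (-(3 / 2) : ℝ)) := by
      rw [← ENNReal.ofReal_pow hs.1.le, ← ENNReal.ofReal_inv_of_pos (by have := hs.1; positivity),
        ← ENNReal.ofReal_mul (by have := hs.1; positivity), ← ENNReal.ofReal_ofNat,
        ← ENNReal.ofReal_mul (by norm_num), ← Real.rpow_natCast, ← Real.rpow_neg hs.1.le,
        mul_left_comm, ← Real.rpow_add hs.1]
      norm_num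
    calc (ENNReal.ofReal s ^ 2)⁻¹ * ‖φ 0 - φ s‖ₑ ^ 2 ≤ (ENNReal.ofReal s ^ 2)⁻¹ *
          (ENNReal.ofReal (2 * s ^ (1 / 2 : ℝ)) *
            ∫⁻ t in Set.Ioo 0 s, ENNReal.ofReal (t ^ (1 / 2 : ℝ)) * ‖φ' t‖ₑ ^ 2) := by gcongr
      _ = ∫⁻ t in Set.Ioo 0 s, 2 * ENNReal.ofReal (s ^ (-(3 / 2) : ℝ)) *
            (ENNReal.ofReal (t ^ (1 / 2 : ℝ)) * ‖φ' t‖ₑ ^ 2) := by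
          rw [← mul_assoc, h4, lintegral_const_mul _ hm]
      _ = ∫⁻ t in Set.Ioo 0 s, (Set.Ioi t).indicator
            (fun s => 2 * ENNReal.ofReal (s ^ (-(3 / 2) : ℝ))) s *
              (ENNReal.ofReal (t ^ (1 / 2 : ℝ)) * ‖φ' t‖ₑ ^ 2) := by
          refine setLIntegral_congr_fun measurableSet_Ioo fun t ht => ?_
          rw [Set.indicator_of_mem (Set.mem_Ioi.2 ht.2)]
      _ ≤ _ := lintegral_mono_set (Set.Ioo_subset_Ioo_right hs.2.le)
  have hind : Measurable fun p : ℝ × ℝ => (Set.Ioi p.2).indicator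
      (fun s => 2 * ENNReal.ofReal (s ^ (-(3 / 2) : ℝ))) p.1 := by
    have : (fun p : ℝ × ℝ => (Set.Ioi p.2).indicator
      (fun s => 2 * ENNReal.ofReal (s ^ (-(3 / 2) : ℝ))) p.1) = {p : ℝ × ℝ | p.2 < p.1}.indicator
        (fun p => 2 * ENNReal.ofReal (p.1 ^ (-(3 / 2) : ℝ))) := by
      ext p
      simp [Set.indicator_apply]
    rw [this]
    exact Measurable.indicator (by fun_prop) (measurableSet_lt measurable_snd measurable_fst)
  refine (setLIntegral_mono' measurableSet_Ioo hpt).trans ?_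
  rw [lintegral_lintegral_swap ((hind.mul (hm.comp measurable_snd)).aemeasurable),
    ← lintegral_const_mul _ (by have := hφ'.measurable; fun_prop)]
  refine setLIntegral_mono' measurableSet_Ioo fun t ht => ?_
  have hind' : Measurable ((Set.Ioi t).indicator
      (fun s => 2 * ENNReal.ofReal (s ^ (-(3 / 2) : ℝ)))) :=
    Measurable.indicator (by fun_prop) measurableSet_Ioi
  rw [lintegral_mul_const _ hind']
  have h5 : ∫⁻ s in Set.Ioo 0 T, (Set.Ioi t).indicator
      (fun s => 2 * ENNReal.ofReal (s ^ (-(3 / 2) : ℝ))) s ≤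
        2 * ENNReal.ofReal (2 * t ^ (-(1 / 2) : ℝ)) := by
    refine (setLIntegral_le_lintegral _ _).trans ?_
    rw [lintegral_indicator measurableSet_Ioi, lintegral_const_mul _ (by fun_prop),
      lintegral_Ioi_rpow_neg_three_half ht.1]
  refine (mul_le_mul_left h5 _).trans_eq ?_
  rw [ENNReal.ofReal_mul (by norm_num), ENNReal.ofReal_ofNat, ← mul_assoc, ← mul_assoc,
    mul_assoc (2 * 2), ← ENNReal.ofReal_mul (Real.rpow_nonneg ht.1.le _), ← Real.rpow_add ht.1]
  norm_num

/-- Affine change of variables. -/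
lemma lintegral_comp_add_smul {G : Euc n → ENNReal} (hG : Measurable G) (a : Euc n) {s : ℝ}
    (hs : 0 < s) :
    ∫⁻ w, G (a + s • w) = (ENNReal.ofReal s ^ n)⁻¹ * ∫⁻ z, G z := by
  have h1 : ∫⁻ w, G (a + s • w) = ∫⁻ z, G (a + z) ∂(Measure.map (fun w : Euc n => s • w) volume) :=
    (lintegral_map (hG.comp (measurable_const_add a)) (measurable_const_smul s)).symm
  rw [h1, Measure.map_addHaar_smul _ hs.ne', lintegral_smul_measure,
    lintegral_add_left_eq_self, finrank_euclideanSpace_fin, abs_of_pos (by positivity),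
    ENNReal.ofReal_inv_of_pos (by positivity), ENNReal.ofReal_pow hs.le]
  rfl

end Integrals

/-! ### Integrals over interior cones. -/

section Cones

variable {Ω P : Set (Euc n)} {ν : Euc n} {c T : ℝ} {σ : Measure (Euc n)}

/-- The ball of radius `c * s` around `z` lies in `Ω`, which misses `P`. Together with
`dist_le_of_norm_sub_smul_lt`, the level at which a cone sees `z` is comparable to the distance from
`z` to `P`, whatever the vertex. -/
lemma HasCones.exists_dist (hcone : HasCones Ω P ν c T) (hPΩ : Disjoint P Ω) {x x' z : Euc n}
    {s : ℝ} (hx : x ∈ P) (hx' : x' ∈ P) (hs : 0 < s) (hsT : s < T)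
    (hz : ‖z - x - s • ν‖ < c * s) : z ∈ Ω ∧ c * s ≤ dist x' z := by
  have hw : ‖s⁻¹ • (z - x - s • ν)‖ < c := by
    rw [norm_smul, norm_inv, Real.norm_of_nonneg hs.le, inv_mul_lt_iff₀ hs, mul_comm]
    exact hz
  have hzx : x + s • (ν + s⁻¹ • (z - x - s • ν)) = z := by
    rw [smul_add, smul_smul, mul_inv_cancel₀ hs.ne', one_smul]
    abel
  have h := hcone x hx s hs hsT _ hw
  rw [hzx] at h
  refine ⟨h (Metric.mem_ball_self ((norm_nonneg _).trans_lt hz)), not_lt.1 fun hlt => ?_⟩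
  exact Set.disjoint_left.1 hPΩ hx' (h hlt)

lemma dist_le_of_norm_sub_smul_lt (hν : ‖ν‖ = 1) (hc1 : c ≤ 1) {x z : Euc n} {s : ℝ} (hs : 0 < s)
    (hz : ‖z - x - s • ν‖ < c * s) : dist x z ≤ 2 * s := by
  have h1 : z - x = (z - x - s • ν) + s • ν := by abel
  rw [dist_comm, dist_eq_norm, h1]
  refine (norm_add_le _ _).trans ?_
  rw [norm_smul, hν, Real.norm_of_nonneg hs.le]
  have : c * s ≤ 1 * s := by gcongr
  linarith

/-- The kernel that expresses integrals over cones as integrals over the ambient space. -/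
def coneKernel (ν : Euc n) (c : ℝ) (x : Euc n) (s : ℝ) (z : Euc n) : ENNReal :=
  {z : Euc n | ‖z - x - s • ν‖ < c * s}.indicator (fun _ => (ENNReal.ofReal s ^ n)⁻¹) z

lemma measurable_coneKernel (ν : Euc n) (c : ℝ) :
    Measurable fun p : Euc n × ℝ × Euc n => coneKernel ν c p.1 p.2.1 p.2.2 := by
  have h : (fun p : Euc n × ℝ × Euc n => coneKernel ν c p.1 p.2.1 p.2.2) =
      {p : Euc n × ℝ × Euc n | ‖p.2.2 - p.1 - p.2.1 • ν‖ < c * p.2.1}.indicator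
        (fun p => (ENNReal.ofReal p.2.1 ^ n)⁻¹) := by
    ext p
    simp [coneKernel, Set.indicator_apply]
  rw [h]
  refine Measurable.indicator (by fun_prop) (IsOpen.measurableSet (isOpen_lt ?_ ?_)) <;> fun_prop

/-- The substitution `z = x + s • (ν + w)` has Jacobian `s ^ n`, which accounts for the
normalisation of the kernel. -/
lemma lintegral_ball_eq_coneKernel {F : Euc n → ENNReal} (hF : Measurable F) (x : Euc n) {s : ℝ}
    (hs : 0 < s) :
    ∫⁻ w in Metric.ball 0 c, F (x + s • (ν + w)) = ∫⁻ z, coneKernel ν c x s z * F z := by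
  have hset : MeasurableSet {z : Euc n | ‖z - x - s • ν‖ < c * s} :=
    (isOpen_lt (by fun_prop) (by fun_prop)).measurableSet
  have h := lintegral_comp_add_smul (hF.indicator hset) (x + s • ν) hs
  have h1 : ∀ w : Euc n, {z : Euc n | ‖z - x - s • ν‖ < c * s}.indicator F (x + s • ν + s • w) =
      (Metric.ball 0 c).indicator (fun w => F (x + s • (ν + w))) w := by
    intro w
    have h2 : x + s • ν + s • w = x + s • (ν + w) := by rw [smul_add, add_assoc]
    have h3 : x + s • ν + s • w - x - s • ν = s • w := by abel
    have h4 : x + s • ν + s • w ∈ {z : Euc n | ‖z - x - s • ν‖ < c * s} ↔ w ∈ Metric.ball 0 c := by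
      rw [Set.mem_ofPred_eq, h3, norm_smul, Real.norm_of_nonneg hs.le, mul_comm c s,
        mul_lt_mul_iff_right₀ hs, Metric.mem_ball, dist_zero_right]
    by_cases hw : w ∈ Metric.ball 0 c
    · rw [Set.indicator_of_mem hw, Set.indicator_of_mem (h4.2 hw), h2]
    · rw [Set.indicator_of_notMem hw, Set.indicator_of_notMem fun h => hw (h4.1 h)]
  simp only [h1] at h
  rw [lintegral_indicator Metric.isOpen_ball.measurableSet] at h
  rw [h, ← lintegral_const_mul _ (hF.indicator hset)]
  refine lintegral_congr fun z => ?_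
  simp only [coneKernel, Set.indicator_apply]
  split_ifs <;> simp

/-- If one cone sees `z` at level `s'`, all cones see it at levels between `s' / κ` and `κ s'` with
`κ = 2 / c`. The vertices then lie in a ball of radius `2 κ s'`, the levels in an interval of length
`κ s'`, and the kernel is at most `(s' / κ)⁻ⁿ`; in the product of the three bounds the powers of
`s'` cancel. -/
lemma lintegral_coneKernel_le [SFinite σ] (hn : 1 ≤ n) {C : ℝ≥0}
    (hσ : ∀ (z : Euc n) (r : ℝ), 0 ≤ r →
      σ (Metric.closedBall z r) ≤ C * ENNReal.ofReal r ^ (n - 1))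
    (hν : ‖ν‖ = 1) (hc : 0 < c) (hc1 : c ≤ 1) (hcone : HasCones Ω P ν c T) (hP : MeasurableSet P)
    (hPΩ : Disjoint P Ω) (z : Euc n) :
    ∫⁻ x in P, ∫⁻ s in Set.Ioo 0 T, coneKernel ν c x s z ∂volume ∂σ ≤
      C * ENNReal.ofReal (2 ^ (n - 1) * (2 / c) ^ (2 * n)) := by
  by_cases hex : ∃ x ∈ P, ∃ s ∈ Set.Ioo 0 T, ‖z - x - s • ν‖ < c * s
  · obtain ⟨x', hx', s', hs', hz'⟩ := hex
    set κ := 2 / c with hκ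
    have hκ0 : 0 < κ := by positivity
    have hs'0 : 0 < s' := hs'.1
    have hbound : ∀ x ∈ P, ∀ s ∈ Set.Ioo 0 T, coneKernel ν c x s z ≤
        (Metric.closedBall z (2 * (κ * s'))).indicator (fun _ => 1) x *
          ((Set.Ioc 0 (κ * s')).indicator (fun _ => (ENNReal.ofReal (s' / κ) ^ n)⁻¹) s) := by
      intro x hx s hs
      by_cases hz : ‖z - x - s • ν‖ < c * s
      · have h1 := (hcone.exists_dist hPΩ hx hx' hs.1 hs.2 hz).2.trans
          (dist_le_of_norm_sub_smul_lt hν hc1 hs'.1 hz')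
        have h2 := (hcone.exists_dist hPΩ hx' hx hs'.1 hs'.2 hz').2.trans
          (dist_le_of_norm_sub_smul_lt hν hc1 hs.1 hz)
        have h3 : s ≤ κ * s' := by
          rw [hκ, div_mul_eq_mul_div, le_div_iff₀ hc]
          linarith
        have h4 : s' / κ ≤ s := by
          rw [hκ, div_div_eq_mul_div, div_le_iff₀ two_pos]
          linarith
        have h5 : x ∈ Metric.closedBall z (2 * (κ * s')) := by
          refine (dist_le_of_norm_sub_smul_lt hν hc1 hs.1 hz).trans ?_
          linarith
        have hzm : z ∈ {z : Euc n | ‖z - x - s • ν‖ < c * s} := hz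
        rw [coneKernel, Set.indicator_of_mem hzm, Set.indicator_of_mem h5,
          Set.indicator_of_mem (show s ∈ Set.Ioc 0 (κ * s') from ⟨hs.1, h3⟩), one_mul]
        gcongr
      · rw [coneKernel, Set.indicator_of_notMem (by simpa using hz)]
        exact zero_le
    calc ∫⁻ x in P, ∫⁻ s in Set.Ioo 0 T, coneKernel ν c x s z ∂volume ∂σ
        ≤ ∫⁻ x in P, ∫⁻ s in Set.Ioo 0 T,
          (Metric.closedBall z (2 * (κ * s'))).indicator (fun _ => 1) x *
          ((Set.Ioc 0 (κ * s')).indicator (fun _ => (ENNReal.ofReal (s' / κ) ^ n)⁻¹) s)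
            ∂volume ∂σ := setLIntegral_mono' hP fun x hx =>
              setLIntegral_mono' measurableSet_Ioo fun s hs => hbound x hx s hs
      _ ≤ ∫⁻ x, ∫⁻ s,
          (Metric.closedBall z (2 * (κ * s'))).indicator (fun _ => 1) x *
          ((Set.Ioc 0 (κ * s')).indicator (fun _ => (ENNReal.ofReal (s' / κ) ^ n)⁻¹) s)
            ∂volume ∂σ := (setLIntegral_le_lintegral _ _).trans
              (lintegral_mono fun x => setLIntegral_le_lintegral _ _)
      _ = σ (Metric.closedBall z (2 * (κ * s'))) *
          ((ENNReal.ofReal (s' / κ) ^ n)⁻¹ * ENNReal.ofReal (κ * s')) := by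
          have hmi : Measurable ((Set.Ioc 0 (κ * s')).indicator
              (fun _ => (ENNReal.ofReal (s' / κ) ^ n)⁻¹)) :=
            measurable_const.indicator measurableSet_Ioc
          simp only [lintegral_const_mul _ hmi]
          rw [lintegral_mul_const _
            (measurable_const.indicator Metric.isClosed_closedBall.measurableSet),
            lintegral_indicator_const Metric.isClosed_closedBall.measurableSet, one_mul,
            lintegral_indicator_const measurableSet_Ioc, Real.volume_Ioc, sub_zero]
      _ ≤ (C * ENNReal.ofReal (2 * (κ * s')) ^ (n - 1)) *
          ((ENNReal.ofReal (s' / κ) ^ n)⁻¹ * ENNReal.ofReal (κ * s')) := by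
          gcongr
          exact hσ _ _ (by positivity)
      _ = C * ENNReal.ofReal (2 ^ (n - 1) * κ ^ (2 * n)) := by
          rw [mul_assoc]
          congr 1
          rw [← ENNReal.ofReal_pow (by positivity), ← ENNReal.ofReal_pow (by positivity),
            ← ENNReal.ofReal_inv_of_pos (by positivity), ← ENNReal.ofReal_mul (by positivity),
            ← ENNReal.ofReal_mul (by positivity)]
          congr 1
          obtain ⟨m, rfl⟩ : ∃ m, n = m + 1 := ⟨n - 1, by omega⟩
          simp only [Nat.add_sub_cancel]
          rw [div_pow, inv_div]
          field_simp
          ring_nf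
  · push Not at hex
    have h0 : ∫⁻ x in P, ∫⁻ s in Set.Ioo 0 T, coneKernel ν c x s z ∂volume ∂σ =
        ∫⁻ x in P, ∫⁻ s in Set.Ioo 0 T, 0 ∂volume ∂σ :=
      setLIntegral_congr_fun hP fun x hx => setLIntegral_congr_fun measurableSet_Ioo fun s hs => by
        rw [coneKernel, Set.indicator_of_notMem (by simpa using hex x hx s hs)]
    rw [h0]
    simp

/-- Averages over the cones with vertices in `P` are controlled by the integral over `Ω`. -/
lemma lintegral_cones_le [SFinite σ] (hn : 1 ≤ n) {C : ℝ≥0}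
    (hσ : ∀ (z : Euc n) (r : ℝ), 0 ≤ r →
      σ (Metric.closedBall z r) ≤ C * ENNReal.ofReal r ^ (n - 1))
    (hν : ‖ν‖ = 1) (hc : 0 < c) (hc1 : c ≤ 1) (hcone : HasCones Ω P ν c T) (hP : MeasurableSet P)
    (hΩ : MeasurableSet Ω) (hPΩ : Disjoint P Ω) {F : Euc n → ENNReal} (hF : Measurable F) :
    ∫⁻ x in P, ∫⁻ s in Set.Ioo 0 T, ∫⁻ w in Metric.ball 0 c, F (x + s • (ν + w))
      ∂volume ∂volume ∂σ ≤
        C * ENNReal.ofReal (2 ^ (n - 1) * (2 / c) ^ (2 * n)) * ∫⁻ z in Ω, F z := by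
  have hk := measurable_coneKernel ν c
  calc ∫⁻ x in P, ∫⁻ s in Set.Ioo 0 T, ∫⁻ w in Metric.ball 0 c, F (x + s • (ν + w))
      ∂volume ∂volume ∂σ
      = ∫⁻ x in P, ∫⁻ s in Set.Ioo 0 T, ∫⁻ z in Ω, coneKernel ν c x s z * F z
        ∂volume ∂volume ∂σ := by
        refine setLIntegral_congr_fun hP fun x hx =>
          setLIntegral_congr_fun measurableSet_Ioo fun s hs => ?_
        rw [lintegral_ball_eq_coneKernel hF x hs.1, ← lintegral_indicator hΩ]
        refine lintegral_congr fun z => ?_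
        by_cases hz : z ∈ Ω
        · rw [Set.indicator_of_mem hz]
        · rw [Set.indicator_of_notMem hz, coneKernel, Set.indicator_of_notMem, zero_mul]
          exact fun hz' => hz (hcone.exists_dist hPΩ hx hx hs.1 hs.2 hz').1
    _ = ∫⁻ x in P, ∫⁻ z in Ω, ∫⁻ s in Set.Ioo 0 T, coneKernel ν c x s z * F z
        ∂volume ∂volume ∂σ := by
        refine lintegral_congr fun x => ?_
        refine lintegral_lintegral_swap (Measurable.aemeasurable ?_)
        exact (hk.comp measurable_prodMk_left).mul (hF.comp measurable_snd)
    _ = ∫⁻ z in Ω, ∫⁻ x in P, ∫⁻ s in Set.Ioo 0 T, coneKernel ν c x s z * F z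
        ∂volume ∂σ ∂volume := by
        refine lintegral_lintegral_swap (Measurable.aemeasurable ?_)
        refine Measurable.lintegral_prod_right'
          (f := fun q : (Euc n × Euc n) × ℝ => coneKernel ν c q.1.1 q.2 q.1.2 * F q.1.2) ?_
        refine Measurable.mul ?_ (hF.comp (by fun_prop))
        exact hk.comp (f := fun q : (Euc n × Euc n) × ℝ => (q.1.1, q.2, q.1.2)) (by fun_prop)
    _ ≤ ∫⁻ z in Ω, C * ENNReal.ofReal (2 ^ (n - 1) * (2 / c) ^ (2 * n)) * F z := by
        refine lintegral_mono fun z => ?_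
        have hkz : ∀ x, Measurable fun s => coneKernel ν c x s z := fun x =>
          hk.comp (f := fun s : ℝ => (x, s, z)) (by fun_prop)
        simp only [lintegral_mul_const _ (hkz _)]
        rw [lintegral_mul_const]
        · gcongr
          exact lintegral_coneKernel_le hn hσ hν hc hc1 hcone hP hPΩ z
        · exact Measurable.lintegral_prod_right' (f := fun q : Euc n × ℝ => coneKernel ν c q.1 q.2 z)
            (hk.comp (f := fun q : Euc n × ℝ => (q.1, q.2, z)) (by fun_prop))
    _ = _ := lintegral_const_mul _ hF

/-- The mean oscillation of `ψ` between the vertex `x` and the level `s` of the cone at `x`. -/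
def coneOsc (ν : Euc n) (c : ℝ) (ψ : Euc n → ℝ) (x : Euc n) (s : ℝ) : ENNReal :=
  ∫⁻ w in Metric.ball 0 c, ‖ψ x - ψ (x + s • (ν + w))‖ₑ ^ 2

lemma measurable_coneOsc {ψ : Euc n → ℝ} (hψ : Continuous ψ) :
    Measurable fun p : Euc n × ℝ => coneOsc ν c ψ p.1 p.2 := by
  refine Measurable.lintegral_prod_right'
    (f := fun q : (Euc n × ℝ) × Euc n => ‖ψ q.1.1 - ψ (q.1.1 + q.1.2 • (ν + q.2))‖ₑ ^ 2) ?_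
  exact Continuous.measurable (by fun_prop)

lemma enorm_sub_sq_le (a b d : ℝ) : ‖a - b‖ₑ ^ 2 ≤ 2 * (‖a - d‖ₑ ^ 2 + ‖b - d‖ₑ ^ 2) := by
  have h : ‖a - b‖ ^ 2 ≤ 2 * (‖a - d‖ ^ 2 + ‖b - d‖ ^ 2) := by
    simp only [Real.norm_eq_abs, sq_abs]
    nlinarith [sq_nonneg ((a - d) + (b - d))]
  simp only [← ofReal_norm, ← ENNReal.ofReal_pow (norm_nonneg _)]
  rw [← ENNReal.ofReal_add (by positivity) (by positivity), ← ENNReal.ofReal_ofNat,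
    ← ENNReal.ofReal_mul (by norm_num)]
  exact ENNReal.ofReal_le_ofReal h

/-- Two nearby vertices are compared through the intersection of their cones. -/
lemma volume_mul_enorm_sub_sq_le {ψ : Euc n → ℝ} (hψ : Continuous ψ) {x y : Euc n} {s : ℝ}
    (hs : 0 < s) (hxy : dist x y ≤ c / 2 * s) :
    volume (Metric.ball (0 : Euc n) (c / 2)) * ‖ψ x - ψ y‖ₑ ^ 2 ≤
      2 * (coneOsc ν c ψ x s + coneOsc ν c ψ y s) := by
  -- Translation by `v` carries the level-`s` slice of the cone at `x` to that at `y`. As `‖v‖ ≤ c /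
  -- 2`, the half-sized slice at `x` lies in both cones.
  set v := s⁻¹ • (x - y) with hv
  have hvn : ‖v‖ ≤ c / 2 := by
    rw [hv, norm_smul, norm_inv, Real.norm_of_nonneg hs.le, ← dist_eq_norm, inv_mul_le_iff₀ hs,
      mul_comm]
    exact hxy
  have hxv : ∀ w, y + s • (ν + (v + w)) = x + s • (ν + w) := fun w => by
    rw [hv]
    simp only [smul_add, smul_smul, mul_inv_cancel₀ hs.ne', one_smul]
    abel
  have hA : Measurable fun w => ‖ψ x - ψ (x + s • (ν + w))‖ₑ ^ 2 :=
    Continuous.measurable (by fun_prop)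
  have h1 : ∫⁻ w in Metric.ball 0 (c / 2), ‖ψ x - ψ (x + s • (ν + w))‖ₑ ^ 2 ≤
      coneOsc ν c ψ x s := by
    refine lintegral_mono_set fun w hw => ?_
    simp only [Metric.mem_ball, dist_zero_right] at hw ⊢
    linarith [norm_nonneg w]
  have h2 : ∫⁻ w in Metric.ball 0 (c / 2), ‖ψ y - ψ (x + s • (ν + w))‖ₑ ^ 2 ≤
      coneOsc ν c ψ y s := by
    rw [coneOsc, ← lintegral_indicator Metric.isOpen_ball.measurableSet,
      ← lintegral_indicator Metric.isOpen_ball.measurableSet,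
      ← lintegral_add_left_eq_self ((Metric.ball 0 c).indicator _) v]
    refine lintegral_mono fun w => ?_
    by_cases hw : w ∈ Metric.ball 0 (c / 2)
    · have hw' : v + w ∈ Metric.ball 0 c := by
        simp only [Metric.mem_ball, dist_zero_right] at hw ⊢
        linarith [norm_add_le v w]
      rw [Set.indicator_of_mem hw, Set.indicator_of_mem hw', hxv]
    · rw [Set.indicator_of_notMem hw]
      exact zero_le
  calc volume (Metric.ball (0 : Euc n) (c / 2)) * ‖ψ x - ψ y‖ₑ ^ 2
      = ∫⁻ w in Metric.ball (0 : Euc n) (c / 2), ‖ψ x - ψ y‖ₑ ^ 2 := by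
        rw [setLIntegral_const, mul_comm]
    _ ≤ ∫⁻ w in Metric.ball (0 : Euc n) (c / 2), 2 * (‖ψ x - ψ (x + s • (ν + w))‖ₑ ^ 2 +
          ‖ψ y - ψ (x + s • (ν + w))‖ₑ ^ 2) := lintegral_mono fun w => enorm_sub_sq_le _ _ _
    _ ≤ 2 * (coneOsc ν c ψ x s + coneOsc ν c ψ y s) := by
        rw [lintegral_const_mul' _ _ (by norm_num), lintegral_add_left hA]
        gcongr

/-- Hardy's inequality along each ray `t ↦ x + t • (ν + w)`. One factor `4` is Hardy's constant, the
other bounds `‖ν + w‖²`. -/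
lemma lintegral_coneOsc_le (hν : ‖ν‖ = 1) (hc1 : c ≤ 1) {ψ : Euc n → ℝ}
    (hψ : ContDiff ℝ ∞ ψ) (x : Euc n) :
    ∫⁻ s in Set.Ioo 0 T, (ENNReal.ofReal s ^ 2)⁻¹ * coneOsc ν c ψ x s ≤
      16 * ∫⁻ s in Set.Ioo 0 T, ∫⁻ w in Metric.ball 0 c, ‖fderiv ℝ ψ (x + s • (ν + w))‖ₑ ^ 2 := by
  have hD : Continuous (fderiv ℝ ψ) := hψ.continuous_fderiv (by simp)
  have hψc := hψ.continuous
  have hmw : ∀ s : ℝ, Measurable fun w => ‖ψ x - ψ (x + s • (ν + w))‖ₑ ^ 2 :=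
    fun s => Continuous.measurable (by fun_prop)
  have hmD : Measurable fun q : Euc n × ℝ => ‖fderiv ℝ ψ (x + q.2 • (ν + q.1))‖ₑ ^ 2 :=
    Continuous.measurable (by fun_prop)
  calc ∫⁻ s in Set.Ioo 0 T, (ENNReal.ofReal s ^ 2)⁻¹ * coneOsc ν c ψ x s
      = ∫⁻ s in Set.Ioo 0 T, ∫⁻ w in Metric.ball 0 c,
          (ENNReal.ofReal s ^ 2)⁻¹ * ‖ψ x - ψ (x + s • (ν + w))‖ₑ ^ 2 := by
        refine lintegral_congr fun s => ?_
        rw [coneOsc, lintegral_const_mul _ (hmw s)]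
    _ = ∫⁻ w in Metric.ball 0 c, ∫⁻ s in Set.Ioo 0 T,
          (ENNReal.ofReal s ^ 2)⁻¹ * ‖ψ x - ψ (x + s • (ν + w))‖ₑ ^ 2 := by
        refine lintegral_lintegral_swap (Measurable.aemeasurable (Measurable.mul (by fun_prop) ?_))
        exact Continuous.measurable (by fun_prop)
    _ ≤ ∫⁻ w in Metric.ball 0 c, 16 * ∫⁻ s in Set.Ioo 0 T,
          ‖fderiv ℝ ψ (x + s • (ν + w))‖ₑ ^ 2 := by
        refine setLIntegral_mono' Metric.isOpen_ball.measurableSet fun w hw => ?_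
        have hderiv : ∀ t : ℝ, HasDerivAt (fun t => ψ (x + t • (ν + w)))
            (fderiv ℝ ψ (x + t • (ν + w)) (ν + w)) t := by
          intro t
          have h1 : HasDerivAt (fun t : ℝ => x + t • (ν + w)) (ν + w) t := by
            simpa using ((hasDerivAt_id t).smul_const (ν + w)).const_add x
          exact ((hψ.differentiable (by simp) _).hasFDerivAt).comp_hasDerivAt t h1
        have h2 := lintegral_hardy hderiv (by fun_prop) T
        simp only [zero_smul, add_zero] at h2
        refine h2.trans ?_
        have h3 : ‖ν + w‖ₑ ≤ 2 := by
          rw [← ofReal_norm]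
          refine ENNReal.ofReal_le_of_le_toReal ((norm_add_le _ _).trans ?_)
          rw [ENNReal.toReal_ofNat]
          rw [Metric.mem_ball, dist_zero_right] at hw
          linarith
        have h4 : ∀ t : ℝ, ‖fderiv ℝ ψ (x + t • (ν + w)) (ν + w)‖ₑ ^ 2 ≤
            4 * ‖fderiv ℝ ψ (x + t • (ν + w))‖ₑ ^ 2 := by
          intro t
          calc _ ≤ (‖fderiv ℝ ψ (x + t • (ν + w))‖ₑ * 2) ^ 2 := by
                gcongr
                exact (ContinuousLinearMap.le_opENorm _ _).trans (by gcongr)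
            _ = _ := by rw [mul_pow, mul_comm]; norm_num
        calc _ ≤ 4 * ∫⁻ s in Set.Ioo 0 T, 4 * ‖fderiv ℝ ψ (x + s • (ν + w))‖ₑ ^ 2 := by
              gcongr
              exact h4 _
          _ = _ := by
              rw [lintegral_const_mul' _ _ (by norm_num), ← mul_assoc]
              norm_num
    _ = 16 * ∫⁻ w in Metric.ball 0 c, ∫⁻ s in Set.Ioo 0 T,
          ‖fderiv ℝ ψ (x + s • (ν + w))‖ₑ ^ 2 := lintegral_const_mul' _ _ (by norm_num)
    _ = _ := by
        congr 1
        exact lintegral_lintegral_swap hmD.aemeasurable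

/-- The weighted oscillation over the cones is controlled by the Dirichlet integral. -/
lemma exists_lintegral_coneOsc_le [SFinite σ] (hn : 1 ≤ n) {C : ℝ≥0}
    (hσ : ∀ (z : Euc n) (r : ℝ), 0 ≤ r →
      σ (Metric.closedBall z r) ≤ C * ENNReal.ofReal r ^ (n - 1))
    (hν : ‖ν‖ = 1) (hc : 0 < c) (hc1 : c ≤ 1) (hcone : HasCones Ω P ν c T) (hP : MeasurableSet P)
    (hΩ : MeasurableSet Ω) (hPΩ : Disjoint P Ω) :
    ∃ A : ℝ≥0, ∀ ψ : Euc n → ℝ, ContDiff ℝ ∞ ψ →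
      ∫⁻ x in P, ∫⁻ s in Set.Ioo 0 T, (ENNReal.ofReal s ^ 2)⁻¹ * coneOsc ν c ψ x s ∂volume ∂σ ≤
        A * ∫⁻ z in Ω, ‖fderiv ℝ ψ z‖ₑ ^ 2 := by
  refine ⟨16 * (C * (2 ^ (n - 1) * (2 / c) ^ (2 * n)).toNNReal), fun ψ hψ => ?_⟩
  have hD : Continuous (fderiv ℝ ψ) := hψ.continuous_fderiv (by simp)
  refine (lintegral_mono fun x => lintegral_coneOsc_le hν hc1 hψ x).trans ?_
  rw [lintegral_const_mul' _ _ (by norm_num)]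
  push_cast
  rw [mul_assoc]
  gcongr
  exact lintegral_cones_le hn hσ hν hc hc1 hcone hP hΩ hPΩ
    (F := fun z => ‖fderiv ℝ ψ z‖ₑ ^ 2) (Continuous.measurable (by fun_prop))

end Cones

/-! ### Boundary estimates on a patch with a common cone direction. -/

section PatchEstimates

variable {Ω P : Set (Euc n)} {ν : Euc n} {c T : ℝ} {σ : Measure (Euc n)}

/-- The kernel selecting the levels at which the cones of `x` and `y` are compared. -/
def levelKernel (c : ℝ) (x y : Euc n) (s : ℝ) : ENNReal :=
  {s : ℝ | dist x y ≤ c / 2 * s}.indicator (fun s => (ENNReal.ofReal s ^ (n + 1))⁻¹) s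

lemma measurable_levelKernel (c : ℝ) :
    Measurable fun p : Euc n × Euc n × ℝ => levelKernel c p.1 p.2.1 p.2.2 := by
  have h : (fun p : Euc n × Euc n × ℝ => levelKernel c p.1 p.2.1 p.2.2) =
      {p : Euc n × Euc n × ℝ | dist p.1 p.2.1 ≤ c / 2 * p.2.2}.indicator
        (fun p => (ENNReal.ofReal p.2.2 ^ (n + 1))⁻¹) := by
    ext p
    simp [levelKernel, Set.indicator_apply]
  rw [h]
  refine Measurable.indicator (by fun_prop) (IsClosed.measurableSet (isClosed_le ?_ ?_)) <;>
    fun_prop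

lemma levelKernel_comm (c : ℝ) (x y : Euc n) (s : ℝ) :
    levelKernel c x y s = levelKernel c y x s := by
  simp [levelKernel, dist_comm]

/-- With `t = dist x y` and `a = 2 t / c`, the cones overlap at every level in `(a, 2a)`, and these
levels are below `T` because `t < c * T / 4`. The length `a` times the smallest weight
`(2a)^(-(n+1))` is `t⁻ⁿ` up to a constant, so integrating the comparison over the interval
reproduces the quotient. -/
lemma enorm_sub_sq_div_le (hc : 0 < c) {ψ : Euc n → ℝ} (hψ : Continuous ψ) {x y : Euc n}
    (hxy : dist x y < c * T / 4) :
    ‖ψ x - ψ y‖ₑ ^ 2 / edist x y ^ n ≤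
      ENNReal.ofReal (2 ^ (n + 1) * (2 / c) ^ n) *
        ((volume (Metric.ball (0 : Euc n) (c / 2)))⁻¹ * 2) *
        ∫⁻ s in Set.Ioo 0 T, levelKernel c x y s * (coneOsc ν c ψ x s + coneOsc ν c ψ y s) := by
  rcases eq_or_ne x y with rfl | hne
  · simp
  set t := dist x y with ht
  have ht0 : 0 < t := dist_pos.2 hne
  set a := 2 / c * t with ha
  have ha0 : 0 < a := by positivity
  set v := volume (Metric.ball (0 : Euc n) (c / 2)) with hv
  have hv0 : v ≠ 0 := (Metric.measure_ball_pos _ _ (by positivity)).ne'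
  have hvt : v ≠ ⊤ := measure_ball_lt_top.ne
  have hsub : Set.Ioo a (2 * a) ⊆ Set.Ioo 0 T := by
    refine Set.Ioo_subset_Ioo ha0.le ?_
    have : 2 * a = t * 4 / c := by rw [ha]; ring
    rw [this, div_le_iff₀ hc]
    linarith
  have hK : (ENNReal.ofReal t ^ n)⁻¹ = ENNReal.ofReal (2 ^ (n + 1) * (2 / c) ^ n) *
      ((ENNReal.ofReal (2 * a) ^ (n + 1))⁻¹ * ENNReal.ofReal a) := by
    rw [← ENNReal.ofReal_pow ht0.le, ← ENNReal.ofReal_pow (by positivity),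
      ← ENNReal.ofReal_inv_of_pos (by positivity), ← ENNReal.ofReal_inv_of_pos (by positivity),
      ← ENNReal.ofReal_mul (by positivity), ← ENNReal.ofReal_mul (by positivity)]
    congr 1
    have h2c : 2 / c ≠ 0 := by positivity
    rw [ha]
    generalize 2 / c = M at h2c
    field_simp
    ring
  have hD : ∀ s ∈ Set.Ioo a (2 * a), (ENNReal.ofReal (2 * a) ^ (n + 1))⁻¹ * ‖ψ x - ψ y‖ₑ ^ 2 ≤
      v⁻¹ * 2 * (levelKernel c x y s * (coneOsc ν c ψ x s + coneOsc ν c ψ y s)) := by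
    intro s hs
    have hs0 : 0 < s := ha0.trans hs.1
    have hxs : dist x y ≤ c / 2 * s := by
      have h1 : c / 2 * a = t := by rw [ha]; field_simp
      rw [← ht, ← h1]
      have := hs.1
      gcongr
    have h1 := volume_mul_enorm_sub_sq_le (ν := ν) (c := c) hψ hs0 hxs
    have hmem : s ∈ {s : ℝ | dist x y ≤ c / 2 * s} := hxs
    rw [levelKernel, Set.indicator_of_mem hmem]
    calc (ENNReal.ofReal (2 * a) ^ (n + 1))⁻¹ * ‖ψ x - ψ y‖ₑ ^ 2
        = (ENNReal.ofReal (2 * a) ^ (n + 1))⁻¹ * (v⁻¹ * (v * ‖ψ x - ψ y‖ₑ ^ 2)) := by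
          rw [← mul_assoc v⁻¹, ENNReal.inv_mul_cancel hv0 hvt, one_mul]
      _ ≤ (ENNReal.ofReal s ^ (n + 1))⁻¹ *
            (v⁻¹ * (2 * (coneOsc ν c ψ x s + coneOsc ν c ψ y s))) := by
          gcongr
          exact hs.2.le
      _ = _ := by ring
  calc ‖ψ x - ψ y‖ₑ ^ 2 / edist x y ^ n
      = ENNReal.ofReal (2 ^ (n + 1) * (2 / c) ^ n) *
        ∫⁻ s in Set.Ioo a (2 * a), (ENNReal.ofReal (2 * a) ^ (n + 1))⁻¹ * ‖ψ x - ψ y‖ₑ ^ 2 := by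
        rw [setLIntegral_const, Real.volume_Ioo, edist_dist, div_eq_mul_inv, ← ht, hK]
        rw [show 2 * a - a = a by ring]
        ring
    _ ≤ ENNReal.ofReal (2 ^ (n + 1) * (2 / c) ^ n) *
        ∫⁻ s in Set.Ioo a (2 * a),
          v⁻¹ * 2 * (levelKernel c x y s * (coneOsc ν c ψ x s + coneOsc ν c ψ y s)) := by
        refine mul_le_mul_right ?_ _
        exact setLIntegral_mono' measurableSet_Ioo hD
    _ ≤ ENNReal.ofReal (2 ^ (n + 1) * (2 / c) ^ n) *
        ∫⁻ s in Set.Ioo 0 T,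
          v⁻¹ * 2 * (levelKernel c x y s * (coneOsc ν c ψ x s + coneOsc ν c ψ y s)) := by
        refine mul_le_mul_right ?_ _
        exact lintegral_mono_set hsub
    _ = _ := by
        rw [lintegral_const_mul' _ _ (ENNReal.mul_ne_top (ENNReal.inv_ne_top.2 hv0) (by norm_num)),
          mul_assoc (ENNReal.ofReal _)]

/-- The growth `s ^ (n - 1)` of the measure of balls against the weight `s^(-(n+1))` leaves exactly
the Hardy weight `s⁻²`. -/
lemma lintegral_levelKernel_le (hn : 1 ≤ n) {C : ℝ≥0}
    (hσ : ∀ (z : Euc n) (r : ℝ), 0 ≤ r →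
      σ (Metric.closedBall z r) ≤ C * ENNReal.ofReal r ^ (n - 1))
    (hc1 : c ≤ 1) (x : Euc n) {s : ℝ} (hs : 0 < s) :
    ∫⁻ y, levelKernel c x y s ∂σ ≤ C * (ENNReal.ofReal s ^ 2)⁻¹ := by
  have h1 : ∀ y, levelKernel c x y s ≤ (Metric.closedBall x s).indicator
      (fun _ => (ENNReal.ofReal s ^ (n + 1))⁻¹) y := by
    intro y
    by_cases hy : dist x y ≤ c / 2 * s
    · have hmem : s ∈ {s : ℝ | dist x y ≤ c / 2 * s} := hy
      have hmem' : y ∈ Metric.closedBall x s := by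
        rw [Metric.mem_closedBall, dist_comm]
        refine hy.trans ?_
        nlinarith
      rw [levelKernel, Set.indicator_of_mem hmem, Set.indicator_of_mem hmem']
    · rw [levelKernel, Set.indicator_of_notMem (by simpa using hy)]
      exact zero_le
  refine (lintegral_mono h1).trans ?_
  rw [lintegral_indicator_const Metric.isClosed_closedBall.measurableSet]
  calc _ ≤ (ENNReal.ofReal s ^ (n + 1))⁻¹ * (C * ENNReal.ofReal s ^ (n - 1)) := by
        gcongr
        exact hσ x s hs.le
    _ = C * ((ENNReal.ofReal s ^ (n + 1))⁻¹ * ENNReal.ofReal s ^ (n - 1)) := by ring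
    _ = _ := by
        congr 1
        rw [← ENNReal.ofReal_pow hs.le, ← ENNReal.ofReal_pow hs.le, ← ENNReal.ofReal_pow hs.le,
          ← ENNReal.ofReal_inv_of_pos (by positivity), ← ENNReal.ofReal_inv_of_pos (by positivity),
          ← ENNReal.ofReal_mul (by positivity)]
        congr 1
        obtain ⟨m, rfl⟩ : ∃ m, n = m + 1 := ⟨n - 1, by omega⟩
        simp only [Nat.add_sub_cancel]
        field_simp
        ring

lemma measurable_levelKernel_mul_coneOsc {ψ : Euc n → ℝ} (hψ : Continuous ψ) :
    Measurable fun p : (Euc n × Euc n) × ℝ =>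
      levelKernel c p.1.1 p.1.2 p.2 * coneOsc ν c ψ p.1.1 p.2 := by
  have h1 : Measurable fun p : (Euc n × Euc n) × ℝ => levelKernel c p.1.1 p.1.2 p.2 :=
    (measurable_levelKernel c).comp (f := fun p : (Euc n × Euc n) × ℝ => (p.1.1, p.1.2, p.2))
      (by fun_prop)
  have h2 : Measurable fun p : (Euc n × Euc n) × ℝ => coneOsc ν c ψ p.1.1 p.2 :=
    (measurable_coneOsc hψ).comp (f := fun p : (Euc n × Euc n) × ℝ => (p.1.1, p.2)) (by fun_prop)
  exact h1.mul h2

lemma measurable_lintegral_levelKernel_mul_coneOsc {ψ : Euc n → ℝ} (hψ : Continuous ψ) :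
    Measurable fun p : Euc n × Euc n =>
      ∫⁻ s in Set.Ioo 0 T, levelKernel c p.1 p.2 s * coneOsc ν c ψ p.1 s :=
  (measurable_levelKernel_mul_coneOsc hψ).lintegral_prod_right'

lemma lintegral_levelKernel_mul_coneOsc_le [SFinite σ] (hn : 1 ≤ n) {C : ℝ≥0}
    (hσ : ∀ (z : Euc n) (r : ℝ), 0 ≤ r →
      σ (Metric.closedBall z r) ≤ C * ENNReal.ofReal r ^ (n - 1))
    (hc1 : c ≤ 1) {ψ : Euc n → ℝ} (hψ : Continuous ψ) :
    ∫⁻ x in P, ∫⁻ y in P, ∫⁻ s in Set.Ioo 0 T,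
      levelKernel c x y s * coneOsc ν c ψ x s ∂volume ∂σ ∂σ ≤
        C * ∫⁻ x in P, ∫⁻ s in Set.Ioo 0 T,
          (ENNReal.ofReal s ^ 2)⁻¹ * coneOsc ν c ψ x s ∂volume ∂σ := by
  rw [← lintegral_const_mul' _ _ ENNReal.coe_ne_top]
  refine lintegral_mono fun x => ?_
  have hx : Measurable fun q : Euc n × ℝ => levelKernel c x q.1 q.2 * coneOsc ν c ψ x q.2 :=
    (measurable_levelKernel_mul_coneOsc hψ).comp (f := fun q : Euc n × ℝ => ((x, q.1), q.2))
      (by fun_prop)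
  rw [lintegral_lintegral_swap (f := fun y s => levelKernel c x y s * coneOsc ν c ψ x s)
    hx.aemeasurable, ← lintegral_const_mul' _ _ ENNReal.coe_ne_top]
  refine setLIntegral_mono' measurableSet_Ioo fun s hs => ?_
  have hkx : Measurable fun y => levelKernel c x y s :=
    (measurable_levelKernel c).comp (f := fun y : Euc n => (x, y, s)) (by fun_prop)
  rw [lintegral_mul_const _ hkx, ← mul_assoc]
  gcongr
  exact (setLIntegral_le_lintegral _ _).trans (lintegral_levelKernel_le hn hσ hc1 x hs.1)

/-- The oscillations at `x` and at `y` contribute equally, since the level kernel is symmetric.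
Integrating out the other variable leaves the weighted oscillation already controlled by the
Dirichlet integral. -/
lemma exists_gagliardo_patch_le [SFinite σ] (hn : 1 ≤ n) {C : ℝ≥0}
    (hσ : ∀ (z : Euc n) (r : ℝ), 0 ≤ r →
      σ (Metric.closedBall z r) ≤ C * ENNReal.ofReal r ^ (n - 1))
    (hν : ‖ν‖ = 1) (hc : 0 < c) (hc1 : c ≤ 1) (hcone : HasCones Ω P ν c T)
    (hP : MeasurableSet P) (hΩ : MeasurableSet Ω) (hPΩ : Disjoint P Ω) :
    ∃ A : ℝ≥0, ∀ ψ : Euc n → ℝ, ContDiff ℝ ∞ ψ →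
      ∫⁻ x in P, ∫⁻ y in P ∩ Metric.ball x (c * T / 4), ‖ψ x - ψ y‖ₑ ^ 2 / edist x y ^ n ∂σ ∂σ ≤
        A * ∫⁻ z in Ω, ‖fderiv ℝ ψ z‖ₑ ^ 2 := by
  obtain ⟨A, hA⟩ := exists_lintegral_coneOsc_le hn hσ hν hc hc1 hcone hP hΩ hPΩ
  obtain ⟨B, hB⟩ : ∃ B : ℝ≥0, B = ENNReal.ofReal (2 ^ (n + 1) * (2 / c) ^ n) *
        ((volume (Metric.ball (0 : Euc n) (c / 2)))⁻¹ * 2) :=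
    ⟨_, ENNReal.coe_toNNReal (ENNReal.mul_ne_top ENNReal.ofReal_ne_top (ENNReal.mul_ne_top
      (ENNReal.inv_ne_top.2 (Metric.measure_ball_pos _ _ (by positivity)).ne') (by norm_num)))⟩
  refine ⟨B * (2 * (C * A)), fun ψ hψ => ?_⟩
  obtain ⟨I, hIdef⟩ : ∃ I : Euc n → Euc n → ENNReal, ∀ x y, I x y =
    ∫⁻ s in Set.Ioo 0 T, levelKernel c x y s * coneOsc ν c ψ x s := ⟨_, fun _ _ => rfl⟩
  have hI : Measurable fun p : Euc n × Euc n => I p.1 p.2 := by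
    simp only [hIdef]
    exact measurable_lintegral_levelKernel_mul_coneOsc hψ.continuous
  have hIx : ∀ x, Measurable (I x) := fun x => hI.comp measurable_prodMk_left
  have hJ : ∫⁻ x in P, ∫⁻ y in P, I x y ∂σ ∂σ ≤ C * (A * ∫⁻ z in Ω, ‖fderiv ℝ ψ z‖ₑ ^ 2) := by
    simp only [hIdef]
    refine (lintegral_levelKernel_mul_coneOsc_le hn hσ hc1 hψ.continuous).trans ?_
    gcongr
    exact hA ψ hψ
  have hI' : Measurable fun p : Euc n × Euc n => I p.2 p.1 := hI.comp measurable_swap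
  have hJ' : ∫⁻ x in P, ∫⁻ y in P, I y x ∂σ ∂σ ≤ C * (A * ∫⁻ z in Ω, ‖fderiv ℝ ψ z‖ₑ ^ 2) := by
    rw [lintegral_lintegral_swap (f := fun x y => I y x) hI'.aemeasurable]
    exact hJ
  have hpt : ∀ x y, dist x y < c * T / 4 →
      ‖ψ x - ψ y‖ₑ ^ 2 / edist x y ^ n ≤ B * (I x y + I y x) := by
    intro x y hxy
    refine (enorm_sub_sq_div_le (ν := ν) hc hψ.continuous hxy).trans (le_of_eq ?_)
    have hm : Measurable fun s => levelKernel c x y s * coneOsc ν c ψ x s :=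
      (measurable_levelKernel_mul_coneOsc hψ.continuous).comp (f := fun s : ℝ => ((x, y), s))
        (by fun_prop)
    rw [hB]
    congr 1
    simp only [hIdef, levelKernel_comm c y x, mul_add]
    exact lintegral_add_left hm _
  calc ∫⁻ x in P, ∫⁻ y in P ∩ Metric.ball x (c * T / 4), ‖ψ x - ψ y‖ₑ ^ 2 / edist x y ^ n ∂σ ∂σ
      ≤ ∫⁻ x in P, ∫⁻ y in P, B * (I x y + I y x) ∂σ ∂σ := by
        refine lintegral_mono fun x => ?_
        refine (setLIntegral_mono' (hP.inter Metric.isOpen_ball.measurableSet) fun y hy => ?_).trans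
          (lintegral_mono_set Set.inter_subset_left)
        refine hpt x y ?_
        rw [dist_comm]
        exact hy.2
    _ = B * (∫⁻ x in P, ∫⁻ y in P, I x y ∂σ ∂σ + ∫⁻ x in P, ∫⁻ y in P, I y x ∂σ ∂σ) := by
        simp_rw [lintegral_const_mul' _ _ ENNReal.coe_ne_top, lintegral_add_left (hIx _)]
        rw [lintegral_add_left hI.lintegral_prod_right']
    _ ≤ B * (C * (A * ∫⁻ z in Ω, ‖fderiv ℝ ψ z‖ₑ ^ 2) +
          C * (A * ∫⁻ z in Ω, ‖fderiv ℝ ψ z‖ₑ ^ 2)) := by gcongr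
    _ = _ := by
        push_cast
        ring

/-- The square of the norm of `ψ` in `H¹(Ω)`. -/
def sobolevEnergy (Ω : Set (Euc n)) (ψ : Euc n → ℝ) : ENNReal :=
  (∫⁻ z in Ω, ‖ψ z‖ₑ ^ 2) + ∫⁻ z in Ω, ‖fderiv ℝ ψ z‖ₑ ^ 2

/-- The inequality `|ψ(x)|² ≤ 2 (|ψ(x) - ψ(z)|² + |ψ(z)|²)` is integrated over `z` in the cone at
`x`. The first term acquires the Hardy weight from `1 ≤ T² / s²`; the second is handled by the
overlap bound for cones. -/
lemma exists_lintegral_patch_le [SFinite σ] (hn : 1 ≤ n) {C : ℝ≥0}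
    (hσ : ∀ (z : Euc n) (r : ℝ), 0 ≤ r →
      σ (Metric.closedBall z r) ≤ C * ENNReal.ofReal r ^ (n - 1))
    (hν : ‖ν‖ = 1) (hc : 0 < c) (hc1 : c ≤ 1) (hT : 0 < T) (hcone : HasCones Ω P ν c T)
    (hP : MeasurableSet P) (hΩ : MeasurableSet Ω) (hPΩ : Disjoint P Ω) :
    ∃ A : ℝ≥0, ∀ ψ : Euc n → ℝ, ContDiff ℝ ∞ ψ →
      ∫⁻ x in P, ‖ψ x‖ₑ ^ 2 ∂σ ≤
        A * sobolevEnergy Ω ψ := by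
  obtain ⟨A, hA⟩ := exists_lintegral_coneOsc_le hn hσ hν hc hc1 hcone hP hΩ hPΩ
  set V := volume (Metric.ball (0 : Euc n) c) with hV
  set κ : ENNReal := V * ENNReal.ofReal T with hκ
  have hV0 : V ≠ 0 := (Metric.measure_ball_pos _ _ hc).ne'
  have hκ0 : κ ≠ 0 := mul_ne_zero hV0 (by simpa using hT)
  have hκt : κ ≠ ⊤ := ENNReal.mul_ne_top measure_ball_lt_top.ne ENNReal.ofReal_ne_top
  set D : ℝ≥0 := C * (2 ^ (n - 1) * (2 / c) ^ (2 * n)).toNNReal with hD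
  refine ⟨κ⁻¹.toNNReal * (2 * (T.toNNReal ^ 2 * A + D)), fun ψ hψ => ?_⟩
  have hψc := hψ.continuous
  have hmF : Measurable fun z => ‖ψ z‖ₑ ^ 2 := Continuous.measurable (by fun_prop)
  have hmw : ∀ (x : Euc n) (s : ℝ), Measurable fun w => ‖ψ x - ψ (x + s • (ν + w))‖ₑ ^ 2 :=
    fun x s => Continuous.measurable (by fun_prop)
  have hpt : ∀ x, κ * ‖ψ x‖ₑ ^ 2 ≤ 2 * (ENNReal.ofReal T ^ 2 *
      (∫⁻ s in Set.Ioo 0 T, (ENNReal.ofReal s ^ 2)⁻¹ * coneOsc ν c ψ x s) +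
      ∫⁻ s in Set.Ioo 0 T, ∫⁻ w in Metric.ball 0 c, ‖ψ (x + s • (ν + w))‖ₑ ^ 2) := by
    intro x
    have hs : ∀ s ∈ Set.Ioo 0 T, V * ‖ψ x‖ₑ ^ 2 ≤ 2 * (ENNReal.ofReal T ^ 2 *
        ((ENNReal.ofReal s ^ 2)⁻¹ * coneOsc ν c ψ x s) +
        ∫⁻ w in Metric.ball 0 c, ‖ψ (x + s • (ν + w))‖ₑ ^ 2) := by
      intro s hs
      have h1 : (1 : ENNReal) ≤ ENNReal.ofReal T ^ 2 * (ENNReal.ofReal s ^ 2)⁻¹ := by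
        rw [← div_eq_mul_inv, ENNReal.le_div_iff_mul_le (Or.inl (by simpa using hs.1))
          (Or.inl (by simp)), one_mul]
        gcongr
        exact hs.2.le
      calc V * ‖ψ x‖ₑ ^ 2 = ∫⁻ w in Metric.ball (0 : Euc n) c, ‖ψ x‖ₑ ^ 2 := by
            rw [setLIntegral_const, mul_comm]
        _ ≤ ∫⁻ w in Metric.ball (0 : Euc n) c, 2 * (‖ψ x - ψ (x + s • (ν + w))‖ₑ ^ 2 +
              ‖ψ (x + s • (ν + w))‖ₑ ^ 2) := by
            refine lintegral_mono fun w => ?_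
            have := enorm_sub_sq_le (ψ x) 0 (ψ (x + s • (ν + w)))
            rwa [sub_zero, zero_sub, enorm_neg] at this
        _ = 2 * (coneOsc ν c ψ x s + ∫⁻ w in Metric.ball 0 c, ‖ψ (x + s • (ν + w))‖ₑ ^ 2) := by
            rw [lintegral_const_mul' _ _ (by norm_num), lintegral_add_left (hmw x s)]
            rfl
        _ ≤ _ := by
            gcongr
            rw [← mul_assoc]
            exact le_mul_of_one_le_left' h1
    have hmE : Measurable fun s : ℝ => (ENNReal.ofReal s ^ 2)⁻¹ * coneOsc ν c ψ x s :=
      Measurable.mul (by fun_prop) ((measurable_coneOsc hψ.continuous).comp measurable_prodMk_left)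
    calc κ * ‖ψ x‖ₑ ^ 2 = ∫⁻ s in Set.Ioo 0 T, V * ‖ψ x‖ₑ ^ 2 := by
          rw [setLIntegral_const, Real.volume_Ioo, sub_zero, hκ]
          ring
      _ ≤ _ := setLIntegral_mono' measurableSet_Ioo hs
      _ = _ := by
          rw [lintegral_const_mul' _ _ (by norm_num), lintegral_add_left (hmE.const_mul _),
            lintegral_const_mul _ hmE]
  have hmE : Measurable fun x => ∫⁻ s in Set.Ioo 0 T, (ENNReal.ofReal s ^ 2)⁻¹ * coneOsc ν c ψ x s :=
    Measurable.lintegral_prod_right'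
      (f := fun q : Euc n × ℝ => (ENNReal.ofReal q.2 ^ 2)⁻¹ * coneOsc ν c ψ q.1 q.2)
      (Measurable.mul (by fun_prop) (measurable_coneOsc hψ.continuous))
  have hmain : κ * ∫⁻ x in P, ‖ψ x‖ₑ ^ 2 ∂σ ≤ 2 * (ENNReal.ofReal T ^ 2 *
      (A * ∫⁻ z in Ω, ‖fderiv ℝ ψ z‖ₑ ^ 2) + D * ∫⁻ z in Ω, ‖ψ z‖ₑ ^ 2) := by
    rw [← lintegral_const_mul _ hmF]
    refine (lintegral_mono hpt).trans ?_
    rw [lintegral_const_mul' _ _ (by norm_num), lintegral_add_left (hmE.const_mul _),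
      lintegral_const_mul _ hmE]
    gcongr
    · exact hA ψ hψ
    · rw [hD, ENNReal.coe_mul]
      exact lintegral_cones_le hn hσ hν hc hc1 hcone hP hΩ hPΩ hmF
  calc ∫⁻ x in P, ‖ψ x‖ₑ ^ 2 ∂σ = κ⁻¹ * (κ * ∫⁻ x in P, ‖ψ x‖ₑ ^ 2 ∂σ) := by
        rw [← mul_assoc, ENNReal.inv_mul_cancel hκ0 hκt, one_mul]
    _ ≤ κ⁻¹ * (2 * (ENNReal.ofReal T ^ 2 *
      (A * ∫⁻ z in Ω, ‖fderiv ℝ ψ z‖ₑ ^ 2) + D * ∫⁻ z in Ω, ‖ψ z‖ₑ ^ 2)) := by gcongr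
    _ ≤ κ⁻¹ * (2 * (ENNReal.ofReal T ^ 2 * A + D) *
        sobolevEnergy Ω ψ) := by
        rw [mul_assoc]
        gcongr
        rw [add_mul, ← mul_assoc]
        gcongr
        · exact le_add_self
        · exact le_self_add
    _ = _ := by
        push_cast
        rw [ENNReal.coe_toNNReal (ENNReal.inv_ne_top.2 hκ0), mul_assoc κ⁻¹]
        rfl

end PatchEstimates

/-! ### Trace inequality, uniqueness of traces and their Gagliardo regularity. -/

section TraceEstimates

variable {Ω : Set (Euc n)}

lemma disjoint_frontier_inter (hΩ : IsOpen Ω) (U : Set (Euc n)) :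
    Disjoint (frontier Ω ∩ U) Ω := by
  rw [hΩ.frontier_eq]
  exact Set.disjoint_left.2 fun x hx => hx.1.2

/-- The trace inequality for smooth functions. -/
lemma IsBoundedLipschitzDomain.exists_lintegral_surface_le (hn : 1 ≤ n)
    (hΩ : IsBoundedLipschitzDomain Ω) :
    ∃ A : ℝ≥0, ∀ ψ : Euc n → ℝ, ContDiff ℝ ∞ ψ →
      ∫⁻ x, ‖ψ x‖ₑ ^ 2 ∂surfaceMeasure Ω ≤ A * sobolevEnergy Ω ψ := by
  obtain ⟨C, hσ⟩ := hΩ.exists_surfaceMeasure_le hn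
  have hfin := hΩ.isFiniteMeasure_surfaceMeasure hn
  let p : Set (Euc n) → Prop := fun S => ∃ A : ℝ≥0, ∀ ψ : Euc n → ℝ, ContDiff ℝ ∞ ψ →
      ∫⁻ x in S, ‖ψ x‖ₑ ^ 2 ∂surfaceMeasure Ω ≤ A * sobolevEnergy Ω ψ
  have hp : p (frontier Ω) := by
    refine hΩ.isCompact_frontier.induction_on ⟨0, by simp⟩ ?_ ?_ ?_
    · rintro S S' hS ⟨A, hA⟩
      exact ⟨A, fun ψ hψ => (lintegral_mono_set hS).trans (hA ψ hψ)⟩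
    · rintro S S' ⟨A, hA⟩ ⟨B, hB⟩
      refine ⟨A + B, fun ψ hψ => (lintegral_union_le _ _ _).trans ?_⟩
      rw [ENNReal.coe_add, add_mul]
      exact add_le_add (hA ψ hψ) (hB ψ hψ)
    · intro x₀ hx₀
      obtain ⟨ν, c, T, δ, hν, hc, hc1, hT, hδ, hcone⟩ := hΩ.exists_hasCones hx₀
      refine ⟨frontier Ω ∩ Metric.ball x₀ δ, Filter.inter_mem self_mem_nhdsWithin
        (mem_nhdsWithin_of_mem_nhds (Metric.ball_mem_nhds _ hδ)), ?_⟩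
      exact exists_lintegral_patch_le hn hσ hν hc hc1 hT hcone
        (isClosed_frontier.measurableSet.inter Metric.isOpen_ball.measurableSet)
        hΩ.isOpen.measurableSet (disjoint_frontier_inter hΩ.isOpen _)
  obtain ⟨A, hA⟩ := hp
  refine ⟨A, fun ψ hψ => ?_⟩
  have := hA ψ hψ
  rwa [Measure.restrict_eq_self_of_ae_mem ae_mem_frontier] at this

/-- The near-diagonal part of the Gagliardo seminorm of a smooth function. -/
lemma IsBoundedLipschitzDomain.exists_gagliardo_near_le (hn : 1 ≤ n)
    (hΩ : IsBoundedLipschitzDomain Ω) :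
    ∃ (A : ℝ≥0) (r : ℝ), 0 < r ∧ ∀ ψ : Euc n → ℝ, ContDiff ℝ ∞ ψ →
      ∫⁻ x, ∫⁻ y in Metric.ball x r, ‖ψ x - ψ y‖ₑ ^ 2 / edist x y ^ n ∂surfaceMeasure Ω
        ∂surfaceMeasure Ω ≤ A * sobolevEnergy Ω ψ := by
  obtain ⟨C, hσ⟩ := hΩ.exists_surfaceMeasure_le hn
  have hfin := hΩ.isFiniteMeasure_surfaceMeasure hn
  let p : Set (Euc n) → Prop := fun S => ∃ (A : ℝ≥0) (r : ℝ), 0 < r ∧ ∀ ψ : Euc n → ℝ,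
    ContDiff ℝ ∞ ψ → ∫⁻ x in S, ∫⁻ y in Metric.ball x r,
      ‖ψ x - ψ y‖ₑ ^ 2 / edist x y ^ n ∂surfaceMeasure Ω ∂surfaceMeasure Ω ≤ A * sobolevEnergy Ω ψ
  have hp : p (frontier Ω) := by
    refine hΩ.isCompact_frontier.induction_on ⟨0, 1, one_pos, by simp⟩ ?_ ?_ ?_
    · rintro S S' hS ⟨A, r, hr, hA⟩
      exact ⟨A, r, hr, fun ψ hψ => (lintegral_mono_set hS).trans (hA ψ hψ)⟩
    · rintro S S' ⟨A, r, hr, hA⟩ ⟨B, r', hr', hB⟩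
      refine ⟨A + B, min r r', lt_min hr hr', fun ψ hψ => (lintegral_union_le _ _ _).trans ?_⟩
      rw [ENNReal.coe_add, add_mul]
      refine add_le_add (le_trans ?_ (hA ψ hψ)) (le_trans ?_ (hB ψ hψ))
      · exact lintegral_mono fun x =>
          lintegral_mono_set (Metric.ball_subset_ball (min_le_left _ _))
      · exact lintegral_mono fun x =>
          lintegral_mono_set (Metric.ball_subset_ball (min_le_right _ _))
    · intro x₀ hx₀
      obtain ⟨ν, c, T, δ, hν, hc, hc1, hT, hδ, hcone⟩ := hΩ.exists_hasCones hx₀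
      refine ⟨frontier Ω ∩ Metric.ball x₀ (δ / 2), Filter.inter_mem self_mem_nhdsWithin
        (mem_nhdsWithin_of_mem_nhds (Metric.ball_mem_nhds _ (by positivity))), ?_⟩
      have hPm : MeasurableSet (frontier Ω ∩ Metric.ball x₀ δ) :=
        isClosed_frontier.measurableSet.inter Metric.isOpen_ball.measurableSet
      have hPm' : MeasurableSet (frontier Ω ∩ Metric.ball x₀ (δ / 2)) :=
        isClosed_frontier.measurableSet.inter Metric.isOpen_ball.measurableSet
      obtain ⟨A, hA⟩ := exists_gagliardo_patch_le hn hσ hν hc hc1 hcone hPm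
        hΩ.isOpen.measurableSet (disjoint_frontier_inter hΩ.isOpen _)
      -- The radius `δ / 2` keeps `y` in the patch of size `δ` when `x` is in the half-sized one; `c
      -- * T / 4` is the range of the patch estimate.
      refine ⟨A, min (δ / 2) (c * T / 4), by positivity, fun ψ hψ => ?_⟩
      have hE : ∫⁻ z in Ω, ‖fderiv ℝ ψ z‖ₑ ^ 2 ≤ sobolevEnergy Ω ψ := le_add_self
      refine le_trans ?_ ((hA ψ hψ).trans (mul_le_mul_right hE _))
      refine (setLIntegral_mono' hPm' fun x hx => ?_).trans
        (lintegral_mono_set (Set.inter_subset_inter_right _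
          (Metric.ball_subset_ball (by linarith))))
      have hsub : Metric.ball x (min (δ / 2) (c * T / 4)) ≤ᵐ[surfaceMeasure Ω]
          ((frontier Ω ∩ Metric.ball x₀ δ) ∩ Metric.ball x (c * T / 4) : Set (Euc n)) := by
        filter_upwards [ae_mem_frontier] with y hyf hy
        replace hy : y ∈ Metric.ball x (min (δ / 2) (c * T / 4)) := hy
        rw [Metric.mem_ball, lt_min_iff] at hy
        refine ⟨⟨hyf, ?_⟩, hy.2⟩
        have h1 := dist_triangle y x x₀
        have h2 := hx.2
        rw [Metric.mem_ball] at h2 ⊢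
        linarith
      exact lintegral_mono' (Measure.restrict_mono' hsub le_rfl) le_rfl
  obtain ⟨A, r, hr, hA⟩ := hp
  refine ⟨A, r, hr, fun ψ hψ => ?_⟩
  have := hA ψ hψ
  rwa [Measure.restrict_eq_self_of_ae_mem ae_mem_frontier] at this

/-- The Gagliardo seminorm on the boundary of a smooth function is controlled by its norm in
`H¹(Ω)`. -/
lemma IsBoundedLipschitzDomain.exists_gagliardo_le (hn : 1 ≤ n)
    (hΩ : IsBoundedLipschitzDomain Ω) :
    ∃ A : ℝ≥0, ∀ ψ : Euc n → ℝ, ContDiff ℝ ∞ ψ →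
      ∫⁻ x, ∫⁻ y, ‖ψ x - ψ y‖ₑ ^ 2 / edist x y ^ n ∂surfaceMeasure Ω ∂surfaceMeasure Ω ≤
        A * sobolevEnergy Ω ψ := by
  obtain ⟨A, r, hr, hA⟩ := hΩ.exists_gagliardo_near_le hn
  obtain ⟨B, hB⟩ := hΩ.exists_lintegral_surface_le hn
  have hfin := hΩ.isFiniteMeasure_surfaceMeasure hn
  set σ := surfaceMeasure Ω with hσ
  obtain ⟨S, hS⟩ : ∃ S : ℝ≥0, S = σ Set.univ := ⟨_, ENNReal.coe_toNNReal (measure_ne_top σ _)⟩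
  obtain ⟨D, hD⟩ : ∃ D : ℝ≥0, D = (ENNReal.ofReal r ^ n)⁻¹ :=
    ⟨_, ENNReal.coe_toNNReal (ENNReal.inv_ne_top.2 (pow_ne_zero _ (by simpa using hr)))⟩
  refine ⟨A + 4 * (D * (S * B)), fun ψ hψ => ?_⟩
  have hψc := hψ.continuous
  have hm : Measurable fun x => ‖ψ x‖ₑ ^ 2 := Continuous.measurable (by fun_prop)
  have hmq : Measurable fun q : Euc n × Euc n => ‖ψ q.1 - ψ q.2‖ₑ ^ 2 / edist q.1 q.2 ^ n := by
    refine Measurable.div (Continuous.measurable (by fun_prop)) ?_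
    exact Continuous.measurable (by fun_prop)
  -- Off the diagonal the denominator is at least `r ^ n`; since the surface measure is finite, the
  -- `L²` trace inequality suffices there.
  have hfar : ∀ x, ∫⁻ y in (Metric.ball x r)ᶜ, ‖ψ x - ψ y‖ₑ ^ 2 / edist x y ^ n ∂σ ≤
      2 * D * (S * ‖ψ x‖ₑ ^ 2 + ∫⁻ y, ‖ψ y‖ₑ ^ 2 ∂σ) := by
    intro x
    have hpt : ∀ y ∈ (Metric.ball x r)ᶜ, ‖ψ x - ψ y‖ₑ ^ 2 / edist x y ^ n ≤
        2 * D * (‖ψ x‖ₑ ^ 2 + ‖ψ y‖ₑ ^ 2) := by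
      intro y hy
      have hy' : r ≤ dist x y := by
        rw [dist_comm]
        simpa using hy
      rw [div_eq_mul_inv, mul_right_comm, hD]
      have h1 := enorm_sub_sq_le (ψ x) (ψ y) 0
      rw [sub_zero, sub_zero] at h1
      gcongr
      rw [edist_dist]
      exact ENNReal.ofReal_le_ofReal hy'
    calc _ ≤ ∫⁻ y in (Metric.ball x r)ᶜ, 2 * D * (‖ψ x‖ₑ ^ 2 + ‖ψ y‖ₑ ^ 2) ∂σ :=
          setLIntegral_mono' Metric.isOpen_ball.measurableSet.compl hpt
      _ ≤ ∫⁻ y, 2 * D * (‖ψ x‖ₑ ^ 2 + ‖ψ y‖ₑ ^ 2) ∂σ := setLIntegral_le_lintegral _ _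
      _ = _ := by
          rw [lintegral_const_mul' _ _ (ENNReal.mul_ne_top (by norm_num) ENNReal.coe_ne_top),
            lintegral_add_left measurable_const, lintegral_const, hS, mul_comm (σ _)]
  calc ∫⁻ x, ∫⁻ y, ‖ψ x - ψ y‖ₑ ^ 2 / edist x y ^ n ∂σ ∂σ
      ≤ ∫⁻ x, (∫⁻ y in Metric.ball x r, ‖ψ x - ψ y‖ₑ ^ 2 / edist x y ^ n ∂σ) +
          2 * D * (S * ‖ψ x‖ₑ ^ 2 + ∫⁻ y, ‖ψ y‖ₑ ^ 2 ∂σ) ∂σ := by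
        refine lintegral_mono fun x => ?_
        rw [← lintegral_add_compl _ (Metric.isOpen_ball (x := x) (ε := r)).measurableSet]
        gcongr
        exact hfar x
    _ = (∫⁻ x, ∫⁻ y in Metric.ball x r, ‖ψ x - ψ y‖ₑ ^ 2 / edist x y ^ n ∂σ ∂σ) +
          4 * (D * (S * ∫⁻ y, ‖ψ y‖ₑ ^ 2 ∂σ)) := by
        rw [lintegral_add_right _ (by fun_prop),
          lintegral_const_mul' _ _ (ENNReal.mul_ne_top (by norm_num) ENNReal.coe_ne_top),
          lintegral_add_right _ measurable_const, lintegral_const_mul _ hm, lintegral_const, hS]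
        ring
    _ ≤ A * sobolevEnergy Ω ψ + 4 * (D * (S * (B * sobolevEnergy Ω ψ))) := by
        gcongr
        · exact hA ψ hψ
        · exact hB ψ hψ
    _ = _ := by
        push_cast
        ring

lemma eLpNorm_two_sq {α : Type*} [MeasurableSpace α] {μ : Measure α} (f : α → ℝ) :
    eLpNorm f 2 μ ^ 2 = ∫⁻ x, ‖f x‖ₑ ^ 2 ∂μ := by
  have h := eLpNorm_nnreal_pow_eq_lintegral (μ := μ) (f := f) (p := 2) two_ne_zero
  simpa using h

lemma tendsto_zero_of_sq {ι : Type*} {l : Filter ι} {f : ι → ENNReal}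
    (h : Tendsto (fun k => f k ^ 2) l (𝓝 0)) : Tendsto f l (𝓝 0) := by
  have h1 := h.ennrpow_const (1 / 2)
  have h2 : ∀ x : ENNReal, (x ^ 2) ^ (1 / 2 : ℝ) = x := fun x => by
    rw [← ENNReal.rpow_natCast, ← ENNReal.rpow_mul]
    norm_num
  simp only [h2] at h1
  rwa [ENNReal.zero_rpow_of_pos (by norm_num)] at h1

lemma enorm_fderiv_sq_le (ψ : Euc n → ℝ) (x : Euc n) :
    ‖fderiv ℝ ψ x‖ₑ ^ 2 ≤ n * ∑ i, ‖partialDeriv i ψ x‖ₑ ^ 2 := by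
  have h1 : ‖fderiv ℝ ψ x‖ ≤ ∑ i, ‖partialDeriv i ψ x‖ := by
    refine ContinuousLinearMap.opNorm_le_bound _ (by positivity) fun v => ?_
    have hv : v = ∑ i, v i • EuclideanSpace.single i (1 : ℝ) := by
      simpa using ((EuclideanSpace.basisFun (Fin n) ℝ).sum_repr v).symm
    conv_lhs => rw [hv, map_sum]
    refine (norm_sum_le _ _).trans ?_
    rw [Finset.sum_mul]
    refine Finset.sum_le_sum fun i _ => ?_
    rw [map_smul, norm_smul, mul_comm]
    exact mul_le_mul_of_nonneg_left (PiLp.norm_apply_le v i) (norm_nonneg _)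
  have h2 : ‖fderiv ℝ ψ x‖ ^ 2 ≤ n * ∑ i, ‖partialDeriv i ψ x‖ ^ 2 := by
    refine (pow_le_pow_left₀ (norm_nonneg _) h1 2).trans ?_
    have := sq_sum_le_card_mul_sum_sq (s := (Finset.univ : Finset (Fin n)))
      (f := fun i => ‖partialDeriv i ψ x‖)
    simpa using this
  simp only [← ofReal_norm, ← ENNReal.ofReal_pow (norm_nonneg _)]
  rw [← ENNReal.ofReal_natCast, ← ENNReal.ofReal_sum_of_nonneg (fun i _ => by positivity),
    ← ENNReal.ofReal_mul (by positivity)]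
  exact ENNReal.ofReal_le_ofReal h2

lemma sobolevEnergy_le {ψ : Euc n → ℝ} (hψ : ContDiff ℝ ∞ ψ) :
    sobolevEnergy Ω ψ ≤ eLpNorm ψ 2 (volume.restrict Ω) ^ 2 +
      n * ∑ i, eLpNorm (partialDeriv i ψ) 2 (volume.restrict Ω) ^ 2 := by
  have hc : ∀ i, Continuous (partialDeriv i ψ) := fun i => (contDiff_partialDeriv hψ i).continuous
  simp only [eLpNorm_two_sq]
  rw [sobolevEnergy, ← lintegral_finsetSum _
    (fun i _ => Continuous.measurable (by have := hc i; fun_prop)),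
    ← lintegral_const_mul' _ _ (ENNReal.natCast_ne_top n)]
  gcongr
  exact enorm_fderiv_sq_le ψ _

/-- A function in `H¹(Ω)` has at most one trace. -/
lemma IsTrace.unique (hn : 1 ≤ n) (hΩ : IsBoundedLipschitzDomain Ω) {u : L2 Ω}
    {g g' : L2Boundary Ω} (hg : IsTrace Ω u g) (hg' : IsTrace Ω u g') : g = g' := by
  obtain ⟨A, hA⟩ := hΩ.exists_lintegral_surface_le hn
  obtain ⟨-, ψ, hψ, ⟨hL, hD⟩, hB⟩ := hg
  obtain ⟨-, χ, hχ, ⟨hL', hD'⟩, hB'⟩ := hg'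
  have hsub : ∀ {μ : Measure (Euc n)} {a b : ℕ → Euc n → ℝ} {v : Lp ℝ 2 μ},
      (∀ k, Continuous (a k)) → (∀ k, Continuous (b k)) →
      Tendsto (fun k => eLpNorm (fun x => a k x - v x) 2 μ) atTop (𝓝 0) →
      Tendsto (fun k => eLpNorm (fun x => b k x - v x) 2 μ) atTop (𝓝 0) →
      Tendsto (fun k => eLpNorm (fun x => a k x - b k x) 2 μ) atTop (𝓝 0) := by
    intro μ a b v ha hb h1 h2
    have h3 := h1.add h2
    rw [add_zero] at h3
    refine tendsto_of_tendsto_of_tendsto_of_le_of_le tendsto_const_nhds h3 (fun k => zero_le)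
      fun k => ?_
    have hv := (Lp.memLp v).aestronglyMeasurable
    have h4 : (fun x => a k x - b k x) = (fun x => a k x - v x) - fun x => b k x - v x := by
      ext x
      simp
    rw [h4]
    exact eLpNorm_sub_le ((ha k).aestronglyMeasurable.sub hv)
      ((hb k).aestronglyMeasurable.sub hv) (by norm_num)
  have h1 := hsub (fun k => (hψ k).continuous) (fun k => (hχ k).continuous) hL hL'
  have h2 := fun i => hsub (fun k => (contDiff_partialDeriv (hψ k) i).continuous)
    (fun k => (contDiff_partialDeriv (hχ k) i).continuous) (hD i) (hD' i)
  -- Both sequences converge to `u` in `H¹(Ω)`, so the energy of `ψ k - χ k` tends to zero; the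
  -- trace inequality then forces the boundary values together.
  have hE : Tendsto (fun k => A * (eLpNorm (fun x => ψ k x - χ k x) 2 (volume.restrict Ω) ^ 2 +
      n * ∑ i, eLpNorm (fun x => partialDeriv i (ψ k) x - partialDeriv i (χ k) x) 2
        (volume.restrict Ω) ^ 2)) atTop (𝓝 0) := by
    have h3 : Tendsto (fun k => ∑ i, eLpNorm (fun x => partialDeriv i (ψ k) x -
        partialDeriv i (χ k) x) 2 (volume.restrict Ω) ^ 2) atTop (𝓝 (∑ _i : Fin n, 0 ^ 2)) :=
      tendsto_finsetSum _ fun i _ => ENNReal.Tendsto.pow (h2 i)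
    have h4 := ENNReal.Tendsto.const_mul (a := (A : ENNReal))
      ((ENNReal.Tendsto.pow (n := 2) h1).add (ENNReal.Tendsto.const_mul (a := (n : ENNReal)) h3
        (Or.inr (ENNReal.natCast_ne_top n)))) (Or.inr ENNReal.coe_ne_top)
    simpa using h4
  have hσ : Tendsto (fun k => eLpNorm (fun x => ψ k x - χ k x) 2 (surfaceMeasure Ω) ^ 2)
      atTop (𝓝 0) := by
    refine tendsto_of_tendsto_of_tendsto_of_le_of_le tendsto_const_nhds hE (fun k => zero_le)
      fun k => ?_
    have hsm : ContDiff ℝ ∞ (fun x => ψ k x - χ k x) := (hψ k).sub (hχ k)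
    have h5 := (hA _ hsm).trans (mul_le_mul_right (sobolevEnergy_le hsm) _)
    rw [← eLpNorm_two_sq] at h5
    have h6 : ∀ i, partialDeriv i (fun x => ψ k x - χ k x) =
        fun x => partialDeriv i (ψ k) x - partialDeriv i (χ k) x :=
      fun i => funext fun x => partialDeriv_sub (hψ k) (hχ k) i x
    simpa only [h6] using h5
  have hσ' : Tendsto (fun k => eLpNorm (fun x => ψ k x - χ k x) 2 (surfaceMeasure Ω))
      atTop (𝓝 0) := tendsto_zero_of_sq hσ
  have hgg : eLpNorm (fun x => g x - g' x) 2 (surfaceMeasure Ω) = 0 := by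
    refine le_antisymm (ge_of_tendsto' (x := atTop) (f := fun k : ℕ =>
      eLpNorm (fun x => ψ k x - g x) 2 (surfaceMeasure Ω) +
      (eLpNorm (fun x => ψ k x - χ k x) 2 (surfaceMeasure Ω) +
        eLpNorm (fun x => χ k x - g' x) 2 (surfaceMeasure Ω))) (by simpa using hB.add (hσ'.add hB'))
      fun k => ?_) zero_le
    have m1 := (hψ k).continuous.aestronglyMeasurable (μ := surfaceMeasure Ω)
    have m2 := (hχ k).continuous.aestronglyMeasurable (μ := surfaceMeasure Ω)
    have m3 := (Lp.memLp g).aestronglyMeasurable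
    have m4 := (Lp.memLp g').aestronglyMeasurable
    have h7 : (fun x => g x - g' x) = ((fun x => ψ k x - χ k x) + fun x => χ k x - g' x) -
        fun x => ψ k x - g x := by
      ext x
      simp
    rw [h7, add_comm (eLpNorm _ _ _) (_ + _)]
    exact (eLpNorm_sub_le ((m1.sub m2).add (m2.sub m4)) (m1.sub m3) (by norm_num)).trans
      (add_le_add_left (eLpNorm_add_le (m1.sub m2) (m2.sub m4) (by norm_num)) _)
  replace hgg := (eLpNorm_eq_zero_iff ((Lp.memLp g).aestronglyMeasurable.sub
    (Lp.memLp g').aestronglyMeasurable) two_ne_zero).1 hgg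
  exact Lp.ext (hgg.mono fun x hx => by simpa [sub_eq_zero] using hx)

/-- Lower semicontinuity of the Gagliardo seminorm. -/
lemma gagliardo_le_of_tendsto_ae {σ : Measure (Euc n)} [SFinite σ] {ψ : ℕ → Euc n → ℝ}
    {g : Euc n → ℝ} (hψ : ∀ k, Continuous (ψ k))
    (hae : ∀ᵐ x ∂σ, Tendsto (fun k => ψ k x) atTop (𝓝 (g x))) {M : ENNReal}
    (hM : ∀ᶠ k in atTop, ∫⁻ x, ∫⁻ y, ‖ψ k x - ψ k y‖ₑ ^ 2 / edist x y ^ n ∂σ ∂σ ≤ M) :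
    ∫⁻ x, ∫⁻ y, ‖g x - g y‖ₑ ^ 2 / edist x y ^ n ∂σ ∂σ ≤ M := by
  obtain ⟨q, hq⟩ : ∃ q : ℕ → Euc n → Euc n → ENNReal, ∀ k x y,
      q k x y = ‖ψ k x - ψ k y‖ₑ ^ 2 / edist x y ^ n := ⟨_, fun _ _ _ => rfl⟩
  simp only [← hq] at hM
  have hm : ∀ k, Measurable fun p : Euc n × Euc n => q k p.1 p.2 := by
    intro k
    have := hψ k
    simp only [hq]
    exact Measurable.div (Continuous.measurable (by fun_prop)) (Continuous.measurable (by fun_prop))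
  have hlim : ∀ᵐ x ∂σ, ∀ᵐ y ∂σ, ‖g x - g y‖ₑ ^ 2 / edist x y ^ n ≤
      liminf (fun k => q k x y) atTop := by
    filter_upwards [hae] with x hx
    filter_upwards [hae] with y hy
    simp only [hq]
    -- On the diagonal the numerator vanishes and the quotient is zero; off it the denominator is
    -- nonzero and the quotient passes to the limit.
    rcases eq_or_ne x y with rfl | hne
    · simp
    refine le_of_eq (Tendsto.liminf_eq ?_).symm
    refine ENNReal.Tendsto.div_const ?_ (Or.inr (pow_ne_zero _ (edist_pos.2 hne).ne'))
    exact ENNReal.Tendsto.pow ((continuous_enorm.tendsto _).comp (hx.sub hy))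
  calc ∫⁻ x, ∫⁻ y, ‖g x - g y‖ₑ ^ 2 / edist x y ^ n ∂σ ∂σ
      ≤ ∫⁻ x, liminf (fun k => ∫⁻ y, q k x y ∂σ) atTop ∂σ := by
        refine lintegral_mono_ae (hlim.mono fun x hx => (lintegral_mono_ae hx).trans ?_)
        exact lintegral_liminf_le fun k => (hm k).comp measurable_prodMk_left
    _ ≤ liminf (fun k => ∫⁻ x, ∫⁻ y, q k x y ∂σ ∂σ) atTop :=
        lintegral_liminf_le fun k => (hm k).lintegral_prod_right'
    _ ≤ M := liminf_le_of_frequently_le' hM.frequently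

lemma eventually_eLpNorm_le {μ : Measure (Euc n)} {a : ℕ → Euc n → ℝ} {v : Lp ℝ 2 μ}
    (ha : ∀ k, Continuous (a k))
    (h : Tendsto (fun k => eLpNorm (fun x => a k x - v x) 2 μ) atTop (𝓝 0)) :
    ∀ᶠ k in atTop, eLpNorm (a k) 2 μ ≤ 1 + eLpNorm v 2 μ := by
  filter_upwards [h.eventually (gt_mem_nhds one_pos)] with k hk
  have hv := (Lp.memLp v).aestronglyMeasurable
  have h2 : a k = (fun x => a k x - v x) + fun x => v x := by
    ext x
    simp
  calc eLpNorm (a k) 2 μ = eLpNorm ((fun x => a k x - v x) + fun x => v x) 2 μ := by rw [← h2]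
    _ ≤ _ := (eLpNorm_add_le ((ha k).aestronglyMeasurable.sub hv) hv (by norm_num)).trans
      (add_le_add_left hk.le _)

/-- Traces of functions in `H¹(Ω)` belong to `H^{1/2}(∂Ω)`. -/
lemma IsTrace.mem_HHalf (hn : 1 ≤ n) (hΩ : IsBoundedLipschitzDomain Ω) {u : L2 Ω}
    {g : L2Boundary Ω} (hg : IsTrace Ω u g) : g ∈ HHalf Ω := by
  obtain ⟨A, hA⟩ := hΩ.exists_gagliardo_le hn
  have hfin := hΩ.isFiniteMeasure_surfaceMeasure hn
  obtain ⟨-, ψ, hψ, ⟨hL, hD⟩, hB⟩ := hg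
  obtain ⟨M, hM⟩ : ∃ M : ENNReal, M = (1 + eLpNorm u 2 (volume.restrict Ω)) ^ 2 +
    n * ∑ i, (1 + eLpNorm (weakPartial Ω i u) 2 (volume.restrict Ω)) ^ 2 := ⟨_, rfl⟩
  have hMt : M < ⊤ := by
    have h1 : ∀ v : L2 Ω, (1 + eLpNorm v 2 (volume.restrict Ω)) ^ 2 < ⊤ := fun v =>
      ENNReal.pow_lt_top (ENNReal.add_lt_top.2 ⟨ENNReal.one_lt_top, (Lp.memLp v).2⟩)
    rw [hM]
    exact ENNReal.add_lt_top.2 ⟨h1 u, ENNReal.mul_lt_top (ENNReal.natCast_lt_top n)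
      (ENNReal.sum_lt_top.2 fun i _ => h1 _)⟩
  have hev : ∀ᶠ k in atTop, ∫⁻ x, ∫⁻ y, ‖ψ k x - ψ k y‖ₑ ^ 2 / edist x y ^ n
      ∂surfaceMeasure Ω ∂surfaceMeasure Ω ≤ A * M := by
    filter_upwards [eventually_eLpNorm_le (fun k => (hψ k).continuous) hL, eventually_all.2 fun i =>
      eventually_eLpNorm_le (fun k => (contDiff_partialDeriv (hψ k) i).continuous) (hD i)]
      with k h1 h2
    refine (hA _ (hψ k)).trans (mul_le_mul_right ((sobolevEnergy_le (hψ k)).trans ?_) _)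
    rw [hM]
    refine add_le_add (pow_le_pow_left' h1 2) (mul_le_mul_right (Finset.sum_le_sum fun i _ => ?_) _)
    exact pow_le_pow_left' (h2 i) 2
  -- The seminorms of `ψ k` are eventually bounded, so an almost everywhere convergent subsequence
  -- on the boundary is all that lower semicontinuity requires.
  have hmeas : TendstoInMeasure (surfaceMeasure Ω) ψ atTop g :=
    tendstoInMeasure_of_tendsto_eLpNorm (p := 2) two_ne_zero
      (fun k => (hψ k).continuous.aestronglyMeasurable) (Lp.memLp g).aestronglyMeasurable hB
  obtain ⟨ns, hns, hae⟩ := hmeas.exists_seq_tendsto_ae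
  exact (gagliardo_le_of_tendsto_ae (fun j => (hψ (ns j)).continuous) hae
    (hns.tendsto_atTop.eventually hev)).trans_lt (ENNReal.mul_lt_top ENNReal.coe_lt_top hMt)

end TraceEstimates

/-! ### The regularised kernel and its derivatives. -/

section Kernel

/-- The kernel `(|z|² + ε²)⁻ⁿ`. -/
def kern (ε : ℝ) (z : Euc n) : ℝ := ((‖z‖ ^ 2 + ε ^ 2) ^ n)⁻¹

/-- The logarithmic derivative of the kernel in the direction `i`. -/
def kernLog (ε : ℝ) (i : Fin n) (z : Euc n) : ℝ := -(2 * n * z i) / (‖z‖ ^ 2 + ε ^ 2)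

lemma kern_pos {ε : ℝ} (hε : 0 < ε) (z : Euc n) : 0 < kern ε z := by
  rw [kern]; positivity

lemma kern_nonneg (ε : ℝ) (z : Euc n) : 0 ≤ kern ε z := by
  rw [kern]; positivity

lemma kern_le {ε : ℝ} {z : Euc n} {a : ℝ} (ha : 0 < a) (h : a ≤ ‖z‖ ^ 2 + ε ^ 2) :
    kern ε z ≤ (a ^ n)⁻¹ := by
  rw [kern]
  gcongr

/-- Differentiation costs a factor `(‖z‖² + ε²)^(-1/2)`, with a constant independent of `ε`. -/
lemma abs_kernLog_sq_le {ε : ℝ} {i : Fin n} {z : Euc n} (h : 0 < ‖z‖ ^ 2 + ε ^ 2) :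
    kernLog ε i z ^ 2 ≤ 4 * n ^ 2 * (‖z‖ ^ 2 + ε ^ 2)⁻¹ := by
  have h1 : z i ^ 2 ≤ ‖z‖ ^ 2 + ε ^ 2 := by
    have := PiLp.norm_apply_le z i
    rw [Real.norm_eq_abs] at this
    nlinarith [sq_abs (z i), sq_nonneg ε, abs_nonneg (z i)]
  rw [kernLog, div_pow, div_le_iff₀ (by positivity)]
  have h2 : 4 * (n : ℝ) ^ 2 * (‖z‖ ^ 2 + ε ^ 2)⁻¹ * (‖z‖ ^ 2 + ε ^ 2) ^ 2 =
      4 * n ^ 2 * (‖z‖ ^ 2 + ε ^ 2) := by field_simp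
  rw [h2]
  have h3 : (-(2 * n * z i)) ^ 2 = 4 * (n : ℝ) ^ 2 * z i ^ 2 := by ring
  rw [h3]
  gcongr

lemma hasDerivAt_kern (hn : 1 ≤ n) {ε : ℝ} (hε : 0 < ε) (i : Fin n) (z : Euc n) (t : ℝ) :
    HasDerivAt (fun t : ℝ => kern ε (z + t • EuclideanSpace.single i (1 : ℝ)))
      (kernLog ε i (z + t • EuclideanSpace.single i (1 : ℝ)) *
        kern ε (z + t • EuclideanSpace.single i (1 : ℝ))) t := by
  have h1 : HasDerivAt (fun t : ℝ => z + t • EuclideanSpace.single i (1 : ℝ))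
      (EuclideanSpace.single i (1 : ℝ)) t := by
    simpa using ((hasDerivAt_id t).smul_const (EuclideanSpace.single i (1 : ℝ))).const_add z
  set v := z + t • EuclideanSpace.single i (1 : ℝ) with hv
  have h2 := ((h1.norm_sq.add_const (ε ^ 2)).fun_pow n).fun_inv (by positivity)
  rw [EuclideanSpace.inner_single_right] at h2
  refine h2.congr_deriv ?_
  simp only [kernLog, kern, ← hv]
  have hA : 0 < ‖v‖ ^ 2 + ε ^ 2 := by positivity
  have hp : (‖v‖ ^ 2 + ε ^ 2) ^ n = (‖v‖ ^ 2 + ε ^ 2) ^ (n - 1) * (‖v‖ ^ 2 + ε ^ 2) :=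
    (pow_sub_one_mul (by omega) _).symm
  rw [hp]
  simp only [conj_trivial, one_mul]
  field_simp

lemma contDiff_kern {ε : ℝ} (hε : 0 < ε) : ContDiff ℝ ∞ (kern (n := n) ε) := by
  refine ContDiff.inv ?_ fun z => by positivity
  exact ((contDiff_norm_sq ℝ).add contDiff_const).pow n

lemma measurable_kern (ε : ℝ) : Measurable (kern (n := n) ε) := by
  unfold kern
  fun_prop

lemma measurable_kernLog (ε : ℝ) (i : Fin n) : Measurable (kernLog ε i) := by
  unfold kernLog
  have : Measurable fun z : Euc n => z i := by fun_prop
  fun_prop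

end Kernel

/-! ### Weighted boundary averages and Jensen-type bounds. -/

section Average

variable {σ : Measure (Euc n)} {g : Euc n → ℝ}

/-- Normalization of the kernel. -/
def kernMass (σ : Measure (Euc n)) (ε : ℝ) (x : Euc n) : ℝ := ∫ y, kern ε (x - y) ∂σ

/-- The weighted average of `g` against the kernel centred at `x`. -/
def kernAvg (σ : Measure (Euc n)) (g : Euc n → ℝ) (ε : ℝ) (x : Euc n) : ℝ :=
  (∫ y, g y * kern ε (x - y) ∂σ) / kernMass σ ε x

/-- Jensen's inequality for the square. -/
lemma enorm_integral_div_sq_le {f k : Euc n → ℝ} (hf : AEStronglyMeasurable f σ)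
    (hk : Measurable k) (hk0 : ∀ y, 0 ≤ k y) (hki : Integrable k σ) (hZ : 0 < ∫ y, k y ∂σ) :
    ‖(∫ y, f y * k y ∂σ) / ∫ y, k y ∂σ‖ₑ ^ 2 ≤
      ∫⁻ y, ‖f y‖ₑ ^ 2 * ENNReal.ofReal (k y / ∫ y, k y ∂σ) ∂σ := by
  set Z := ∫ y, k y ∂σ with hZdef
  have h1 : (∫ y, f y * k y ∂σ) / Z = ∫ y, f y * (k y / Z) ∂σ := by
    rw [← integral_div]
    exact integral_congr_ae (Eventually.of_forall fun y => mul_div_assoc _ _ _)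
  have h2 : ∫⁻ y, ENNReal.ofReal (k y / Z) ∂σ = 1 := by
    rw [← ofReal_integral_eq_lintegral_ofReal (hki.div_const Z)
      (Eventually.of_forall fun y => div_nonneg (hk0 y) hZ.le), integral_div, ← hZdef,
      div_self hZ.ne', ENNReal.ofReal_one]
  have h3 : ‖∫ y, f y * (k y / Z) ∂σ‖ₑ ≤ ∫⁻ y, ‖f y‖ₑ * ENNReal.ofReal (k y / Z) ∂σ := by
    refine (enorm_integral_le_lintegral_enorm _).trans (le_of_eq (lintegral_congr fun y => ?_))
    rw [enorm_mul, Real.enorm_of_nonneg (div_nonneg (hk0 y) hZ.le)]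
  rw [h1]
  calc _ ≤ (∫⁻ y, ‖f y‖ₑ * ENNReal.ofReal (k y / Z) ∂σ) ^ 2 := pow_le_pow_left' h3 2
    _ ≤ _ := sq_lintegral_mul_le hf.enorm (by fun_prop)
    _ = _ := by rw [h2, one_mul]

lemma integrable_mul_kern (hg : Integrable g σ) {ε : ℝ} (hε : 0 < ε) (x : Euc n) :
    Integrable (fun y => g y * kern ε (x - y)) σ := by
  refine hg.mul_bdd (c := ((ε ^ 2) ^ n)⁻¹) ?_ (Eventually.of_forall fun y => ?_)
  · exact ((measurable_kern ε).comp (measurable_const.sub measurable_id)).aestronglyMeasurable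
  · rw [Real.norm_of_nonneg (kern_nonneg _ _)]
    exact kern_le (by positivity) (by nlinarith [sq_nonneg ‖x - y‖])

lemma integrable_mul_kernLog_mul_kern (hg : Integrable g σ) {ε : ℝ} (hε : 0 < ε) (i : Fin n)
    (x : Euc n) : Integrable (fun y => g y * (kernLog ε i (x - y) * kern ε (x - y))) σ := by
  have hm : Measurable fun y => kernLog ε i (x - y) :=
    (measurable_kernLog ε i).comp (measurable_const.sub measurable_id)
  have h := (integrable_mul_kern hg hε x).mul_bdd (c := 2 * n / ε) hm.aestronglyMeasurable
    (Eventually.of_forall fun y => ?_)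
  · exact h.congr (Eventually.of_forall fun y => by ring)
  · have h1 : 0 < ‖x - y‖ ^ 2 + ε ^ 2 := by positivity
    rw [Real.norm_eq_abs]
    refine abs_le_of_sq_le_sq (b := 2 * n / ε) ((abs_kernLog_sq_le h1).trans ?_) (by positivity)
    rw [div_pow, mul_pow, div_eq_mul_inv]
    norm_num
    gcongr
    nlinarith [sq_nonneg ‖x - y‖]

lemma hasDerivAt_integral_mul_kern (hn : 1 ≤ n) (hg : Integrable g σ) {ε : ℝ} (hε : 0 < ε)
    (i : Fin n) (x : Euc n) :
    HasDerivAt (fun t : ℝ => ∫ y, g y * kern ε (x + t • EuclideanSpace.single i (1 : ℝ) - y) ∂σ)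
      (∫ y, g y * (kernLog ε i (x - y) * kern ε (x - y)) ∂σ) 0 := by
  have hm : ∀ t : ℝ, Measurable fun y => kern ε (x + t • EuclideanSpace.single i (1 : ℝ) - y) :=
    fun t => (measurable_kern ε).comp (measurable_const.sub measurable_id)
  have hbd : ∀ z : Euc n, |kernLog ε i z * kern ε z| ≤ 2 * n / ε * ((ε ^ 2) ^ n)⁻¹ := by
    intro z
    have h1 : 0 < ‖z‖ ^ 2 + ε ^ 2 := by positivity
    rw [abs_mul, abs_of_nonneg (kern_nonneg _ _)]
    refine mul_le_mul ?_ (kern_le (by positivity) (by nlinarith [sq_nonneg ‖z‖]))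
      (kern_nonneg _ _) (by positivity)
    refine abs_le_of_sq_le_sq (b := 2 * n / ε) ((abs_kernLog_sq_le h1).trans ?_) (by positivity)
    rw [div_pow, mul_pow, div_eq_mul_inv]
    norm_num
    gcongr
    nlinarith [sq_nonneg ‖z‖]
  have h := (hasDerivAt_integral_of_dominated_loc_of_deriv_le (μ := σ) (x₀ := (0 : ℝ))
    (s := Set.univ)
    (F := fun t y => g y * kern ε (x + t • EuclideanSpace.single i (1 : ℝ) - y))
    (F' := fun t y => g y * (kernLog ε i (x + t • EuclideanSpace.single i (1 : ℝ) - y) *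
      kern ε (x + t • EuclideanSpace.single i (1 : ℝ) - y)))
    (bound := fun y => ‖g y‖ * (2 * n / ε * ((ε ^ 2) ^ n)⁻¹)) Filter.univ_mem
    (Eventually.of_forall fun t => hg.aestronglyMeasurable.mul (hm t).aestronglyMeasurable)
    (by simpa using integrable_mul_kern hg hε x)
    (by simpa using (integrable_mul_kernLog_mul_kern hg hε i x).aestronglyMeasurable)
    (Eventually.of_forall fun y t _ => ?_) (hg.norm.mul_const _)
    (Eventually.of_forall fun y t _ => ?_)).2
  · simpa using h
  · rw [norm_mul]
    exact mul_le_mul_of_nonneg_left (hbd _) (norm_nonneg _)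
  · have h1 := (hasDerivAt_kern hn hε i (x - y) t).const_mul (g y)
    have h2 : ∀ t : ℝ, x - y + t • EuclideanSpace.single i (1 : ℝ) =
        x + t • EuclideanSpace.single i (1 : ℝ) - y := fun t => by abel
    simpa only [h2] using h1

variable [IsFiniteMeasure σ]

lemma integrable_kern {ε : ℝ} (hε : 0 < ε) (x : Euc n) :
    Integrable (fun y => kern ε (x - y)) σ := by
  simpa using integrable_mul_kern (integrable_const (1 : ℝ)) hε x

lemma kernMass_pos (hσ : σ ≠ 0) {ε : ℝ} (hε : 0 < ε) (x : Euc n) : 0 < kernMass σ ε x := by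
  rw [kernMass, integral_pos_iff_support_of_nonneg (fun y => kern_nonneg _ _)
    (integrable_kern hε x)]
  have : Function.support (fun y => kern ε (x - y)) = Set.univ :=
    Set.eq_univ_of_forall fun y => (kern_pos hε _).ne'
  rw [this]
  exact Measure.measure_univ_pos.2 hσ

/-- The difference is the average of `g - b`, so Jensen's inequality applies. The choice `b = 0`
bounds the extension, `b = g y` enters the gradient bound, and `b = g x` measures the error on the
boundary. -/
lemma enorm_kernAvg_sub_sq_le (hσ : σ ≠ 0) (hg : Integrable g σ) {ε : ℝ} (hε : 0 < ε) (x : Euc n)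
    (b : ℝ) :
    ‖kernAvg σ g ε x - b‖ₑ ^ 2 ≤
      ∫⁻ y, ‖g y - b‖ₑ ^ 2 * ENNReal.ofReal (kern ε (x - y) / kernMass σ ε x) ∂σ := by
  have hZ := kernMass_pos hσ hε x
  have h1 : kernAvg σ g ε x - b = (∫ y, (g y - b) * kern ε (x - y) ∂σ) / kernMass σ ε x := by
    simp only [sub_mul]
    rw [integral_sub (integrable_mul_kern hg hε x) ((integrable_kern hε x).const_mul b),
      integral_const_mul, sub_div, kernAvg]
    congr 1
    rw [← kernMass, mul_div_assoc, div_self hZ.ne', mul_one]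
  rw [h1]
  exact enorm_integral_div_sq_le (hg.aestronglyMeasurable.sub aestronglyMeasurable_const)
    ((measurable_kern ε).comp (measurable_const.sub measurable_id)) (fun y => kern_nonneg _ _)
    (integrable_kern hε x) hZ

/-- The derivative of the average. -/
def kernAvgDeriv (σ : Measure (Euc n)) (g : Euc n → ℝ) (ε : ℝ) (i : Fin n) (x : Euc n) : ℝ :=
  ((∫ y, g y * (kernLog ε i (x - y) * kern ε (x - y)) ∂σ) * kernMass σ ε x -
    (∫ y, g y * kern ε (x - y) ∂σ) * ∫ y, kernLog ε i (x - y) * kern ε (x - y) ∂σ) /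
      kernMass σ ε x ^ 2

lemma hasDerivAt_kernAvg (hn : 1 ≤ n) (hσ : σ ≠ 0) (hg : Integrable g σ) {ε : ℝ} (hε : 0 < ε)
    (i : Fin n) (x : Euc n) :
    HasDerivAt (fun t : ℝ => kernAvg σ g ε (x + t • EuclideanSpace.single i (1 : ℝ)))
      (kernAvgDeriv σ g ε i x) 0 := by
  have h1 := hasDerivAt_integral_mul_kern hn hg hε i x
  have h2 := hasDerivAt_integral_mul_kern hn (integrable_const (1 : ℝ)) hε i x (σ := σ)
  simp only [one_mul] at h2
  have h3 := h1.fun_div h2 (by simpa [kernMass] using (kernMass_pos hσ hε x).ne')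
  simpa [kernAvg, kernAvgDeriv, kernMass] using h3

/-- The quotient rule gives the average of `(g y - a) * kernLog`, with `a` the average of `g`
itself. Jensen in `y`, then Jensen again for `g y - a` as an average over `y'`, leaves only
differences of `g`. -/
lemma enorm_kernAvgDeriv_sq_le (hσ : σ ≠ 0) (hg : Integrable g σ) {ε : ℝ} (hε : 0 < ε) (i : Fin n)
    (x : Euc n) :
    ‖kernAvgDeriv σ g ε i x‖ₑ ^ 2 ≤ ∫⁻ y, ∫⁻ y', ‖g y - g y'‖ₑ ^ 2 *
      ENNReal.ofReal (kernLog ε i (x - y) ^ 2 * (kern ε (x - y) / kernMass σ ε x) *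
        (kern ε (x - y') / kernMass σ ε x)) ∂σ ∂σ := by
  have hZ := kernMass_pos hσ hε x
  set a := kernAvg σ g ε x with ha
  have hm : Measurable fun y => kernLog ε i (x - y) :=
    (measurable_kernLog ε i).comp (measurable_const.sub measurable_id)
  have h1 : kernAvgDeriv σ g ε i x =
      (∫ y, ((g y - a) * kernLog ε i (x - y)) * kern ε (x - y) ∂σ) / kernMass σ ε x := by
    have h2 : ∀ y, ((g y - a) * kernLog ε i (x - y)) * kern ε (x - y) =
        g y * (kernLog ε i (x - y) * kern ε (x - y)) -
          a * (kernLog ε i (x - y) * kern ε (x - y)) := fun y => by ring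
    have h3 : Integrable (fun y => kernLog ε i (x - y) * kern ε (x - y)) σ := by
      simpa using integrable_mul_kernLog_mul_kern (integrable_const (1 : ℝ)) hε i x (σ := σ)
    simp only [h2]
    rw [integral_sub (integrable_mul_kernLog_mul_kern hg hε i x) (h3.const_mul a),
      integral_const_mul, kernAvgDeriv, ha, kernAvg]
    field_simp
  rw [h1]
  refine (enorm_integral_div_sq_le (k := fun y => kern ε (x - y))
    ((hg.aestronglyMeasurable.sub aestronglyMeasurable_const).mul
    hm.aestronglyMeasurable) ((measurable_kern ε).comp (measurable_const.sub measurable_id))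
    (fun y => kern_nonneg _ _) (integrable_kern hε x) hZ).trans ?_
  refine lintegral_mono fun y => ?_
  have h4 : ‖g y - a‖ₑ ^ 2 ≤ ∫⁻ y', ‖g y - g y'‖ₑ ^ 2 *
      ENNReal.ofReal (kern ε (x - y') / kernMass σ ε x) ∂σ := by
    have h5 := enorm_kernAvg_sub_sq_le hσ hg hε x (g y)
    rw [← enorm_neg, neg_sub] at h5
    refine h5.trans (le_of_eq (lintegral_congr fun y' => ?_))
    rw [← enorm_neg, neg_sub]
  calc ‖(g y - a) * kernLog ε i (x - y)‖ₑ ^ 2 *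
        ENNReal.ofReal (kern ε (x - y) / kernMass σ ε x)
      = ENNReal.ofReal (kernLog ε i (x - y) ^ 2 * (kern ε (x - y) / kernMass σ ε x)) *
        ‖g y - a‖ₑ ^ 2 := by
        have h6 : ‖kernLog ε i (x - y)‖ₑ ^ 2 = ENNReal.ofReal (kernLog ε i (x - y) ^ 2) := by
          rw [← ofReal_norm, ← ENNReal.ofReal_pow (norm_nonneg _), Real.norm_eq_abs, sq_abs]
        rw [enorm_mul, mul_pow, h6, ENNReal.ofReal_mul (sq_nonneg _)]
        ring
    _ ≤ _ := mul_le_mul_right h4 _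
    _ = _ := by
        rw [← lintegral_const_mul' _ _ ENNReal.ofReal_ne_top]
        refine lintegral_congr fun y' => ?_
        have h7 : 0 ≤ kernLog ε i (x - y) ^ 2 * (kern ε (x - y) / kernMass σ ε x) :=
          mul_nonneg (sq_nonneg _) (div_nonneg (kern_nonneg _ _) hZ.le)
        rw [ENNReal.ofReal_mul h7]
        ring

end Average

/-! ### Smoothness of the averages on the whole space. -/

section Smoothness

variable {σ : Measure (Euc n)} {g : Euc n → ℝ}

/-- Since `σ` lives on a bounded set, near `x` the kernel may be multiplied by a cutoff equal to `1`
at all the differences that occur. Locally the integral is thus a convolution with a compactly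
supported smooth function. -/
lemma contDiff_integral_mul_kern (hg : Integrable g σ) {R : ℝ} (hR : ∀ᵐ y ∂σ, ‖y‖ ≤ R) {ε : ℝ}
    (hε : 0 < ε) : ContDiff ℝ ∞ fun x => ∫ y, g y * kern ε (x - y) ∂σ := by
  rw [contDiff_iff_contDiffAt]
  intro x
  have hr : 0 < ‖x‖ + |R| + 1 := by positivity
  let χ : ContDiffBump (0 : Euc n) := ⟨‖x‖ + |R| + 1, ‖x‖ + |R| + 2, hr, by linarith⟩
  have hK : HasCompactSupport fun z => χ z * kern ε z := χ.hasCompactSupport.mul_right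
  have h := hK.contDiff_convolution_right (ContinuousLinearMap.mul ℝ ℝ) hg.locallyIntegrable
    (χ.contDiff.mul (contDiff_kern hε))
  refine h.contDiffAt.congr_of_eventuallyEq ?_
  filter_upwards [Metric.ball_mem_nhds x one_pos] with x' hx'
  rw [convolution]
  refine integral_congr_ae ?_
  filter_upwards [hR] with y hy
  have h1 : ‖x' - y‖ ≤ ‖x‖ + |R| + 1 := by
    have h2 : ‖x' - x‖ < 1 := by rwa [← dist_eq_norm]
    have h3 : x' - y = (x' - x) + x - y := by abel
    have h4 := norm_sub_le ((x' - x) + x) y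
    have h5 := norm_add_le (x' - x) x
    rw [h3]
    linarith [le_abs_self R]
  have h2 : χ (x' - y) = 1 := χ.one_of_mem_closedBall (by simpa using h1)
  simp [h2]

lemma contDiff_kernAvg [IsFiniteMeasure σ] (hσ : σ ≠ 0) (hg : Integrable g σ) {R : ℝ}
    (hR : ∀ᵐ y ∂σ, ‖y‖ ≤ R) {ε : ℝ} (hε : 0 < ε) : ContDiff ℝ ∞ (kernAvg σ g ε) := by
  refine (contDiff_integral_mul_kern hg hR hε).div ?_ fun x => (kernMass_pos hσ hε x).ne'
  have h := contDiff_integral_mul_kern (integrable_const (1 : ℝ)) hR hε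
  simp only [one_mul] at h
  exact h

lemma partialDeriv_kernAvg [IsFiniteMeasure σ] (hn : 1 ≤ n) (hσ : σ ≠ 0) (hg : Integrable g σ)
    {R : ℝ} (hR : ∀ᵐ y ∂σ, ‖y‖ ≤ R) {ε : ℝ} (hε : 0 < ε) (i : Fin n) (x : Euc n) :
    partialDeriv i (kernAvg σ g ε) x = kernAvgDeriv σ g ε i x := by
  have h1 : DifferentiableAt ℝ (kernAvg σ g ε) x :=
    ((contDiff_kernAvg hσ hg hR hε).differentiable (by simp)) x
  have h2 : HasLineDerivAt ℝ (kernAvg σ g ε) (kernAvgDeriv σ g ε i x) x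
      (EuclideanSpace.single i (1 : ℝ)) := hasDerivAt_kernAvg hn hσ hg hε i x
  rw [partialDeriv, ← h1.lineDeriv_eq_fderiv]
  exact h2.lineDeriv

end Smoothness

/-! ### Kernel bounds uniform in the regularisation. -/

section Bounds

variable {σ : Measure (Euc n)} [IsFiniteMeasure σ]

/-- With `ρ² = ‖x - y‖² + ε²`, the ball of radius `ρ` about `y` has measure at least `c ρ^(n-1)` and
the kernel is at least `(5 ρ²)⁻ⁿ` on it, so the mass is at least `(c / 5ⁿ) ρ^(-(n+1))`. Squaring
leaves only powers of `ρ²`. -/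
lemma le_kernMass_sq {c r : ℝ} (hc : 0 < c) {F : Set (Euc n)}
    (hF : ∀ y ∈ F, ∀ s, 0 < s → s ≤ r →
      ENNReal.ofReal c * ENNReal.ofReal s ^ (n - 1) ≤ σ (Metric.closedBall y s))
    (hn : 1 ≤ n) {ε : ℝ} (hε : 0 < ε) {x y : Euc n} (hy : y ∈ F)
    (hr : Real.sqrt (‖x - y‖ ^ 2 + ε ^ 2) ≤ r) :
    (c / 5 ^ n) ^ 2 ≤ kernMass σ ε x ^ 2 * (‖x - y‖ ^ 2 + ε ^ 2) ^ (n + 1) := by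
  set ρ := Real.sqrt (‖x - y‖ ^ 2 + ε ^ 2) with hρ
  have hA : 0 < ‖x - y‖ ^ 2 + ε ^ 2 := by positivity
  have hρ0 : 0 < ρ := Real.sqrt_pos.2 hA
  have hρ2 : ρ ^ 2 = ‖x - y‖ ^ 2 + ε ^ 2 := Real.sq_sqrt hA.le
  have h1 : c * ρ ^ (n - 1) ≤ σ.real (Metric.closedBall y ρ) := by
    have h := hF y hy ρ hρ0 hr
    rw [← ENNReal.ofReal_pow hρ0.le, ← ENNReal.ofReal_mul hc.le] at h
    exact (ENNReal.ofReal_le_iff_le_toReal (measure_ne_top _ _)).1 h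
  have h2 : σ.real (Metric.closedBall y ρ) * ((5 * ρ ^ 2) ^ n)⁻¹ ≤ kernMass σ ε x := by
    calc _ = ∫ z in Metric.closedBall y ρ, ((5 * ρ ^ 2) ^ n)⁻¹ ∂σ := by
          rw [setIntegral_const, smul_eq_mul]
      _ ≤ ∫ z in Metric.closedBall y ρ, kern ε (x - z) ∂σ := by
          refine setIntegral_mono_on (integrable_const _).integrableOn
            (integrable_kern hε x).integrableOn Metric.isClosed_closedBall.measurableSet
            fun z hz => ?_
          rw [kern]
          have h3 : ‖y - z‖ ≤ ρ := by rwa [← dist_eq_norm, dist_comm]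
          have h4 : ‖x - z‖ ≤ ‖x - y‖ + ‖y - z‖ := by
            simpa using norm_add_le (x - y) (y - z)
          gcongr
          nlinarith [norm_nonneg (x - z), norm_nonneg (x - y), norm_nonneg (y - z), sq_nonneg ε,
            sq_nonneg (‖x - y‖ - ‖y - z‖)]
      _ ≤ _ := setIntegral_le_integral (integrable_kern hε x)
          (Eventually.of_forall fun z => kern_nonneg _ _)
  have h5 : c / 5 ^ n ≤ kernMass σ ε x * ρ ^ (n + 1) := by
    calc c / 5 ^ n = c * ρ ^ (n - 1) * ((5 * ρ ^ 2) ^ n)⁻¹ * ρ ^ (n + 1) := by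
          obtain ⟨m, rfl⟩ : ∃ m, n = m + 1 := ⟨n - 1, by omega⟩
          rw [Nat.add_sub_cancel, mul_pow]
          field_simp
          ring
      _ ≤ _ := by
          refine mul_le_mul_of_nonneg_right (le_trans ?_ h2) (by positivity)
          exact mul_le_mul_of_nonneg_right h1 (by positivity)
  calc _ ≤ (kernMass σ ε x * ρ ^ (n + 1)) ^ 2 := pow_le_pow_left₀ (by positivity) h5 2
    _ = _ := by rw [← hρ2]; ring

/-- The algebraic inequality behind the gradient bound. -/
lemma inv_mul_inv_le {n : ℕ} {A A' Z k : ℝ} (hA : 0 < A) (hA' : 0 < A') (hZ : 0 < Z) (hk : 0 < k)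
    (h : k ^ 2 ≤ Z ^ 2 * A ^ (n + 1)) (h' : k ^ 2 ≤ Z ^ 2 * A' ^ (n + 1)) :
    A⁻¹ * ((A ^ n)⁻¹ / Z) * ((A' ^ n)⁻¹ / Z) ≤ 2 ^ n / k ^ 2 * ((A + A') ^ n)⁻¹ := by
  have e : A⁻¹ * ((A ^ n)⁻¹ / Z) * ((A' ^ n)⁻¹ / Z) = 1 / (Z ^ 2 * A ^ (n + 1) * A' ^ n) := by
    field_simp
    ring
  have e' : 2 ^ n / k ^ 2 * ((A + A') ^ n)⁻¹ = 1 / (k ^ 2 * ((A + A') / 2) ^ n) := by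
    rw [div_pow]; field_simp
  rw [e, e']
  refine one_div_le_one_div_of_le (by positivity) ?_
  -- The larger of `A` and `A'` is at least their mean; the hypothesis for the smaller one absorbs
  -- `Z ^ 2`.
  rcases le_total A A' with hle | hle
  · gcongr
    linarith
  · have h1 : ((A + A') / 2) ^ n ≤ A ^ n := by gcongr; linarith
    calc k ^ 2 * ((A + A') / 2) ^ n ≤ (Z ^ 2 * A' ^ (n + 1)) * A ^ n := by gcongr
      _ = Z ^ 2 * A' ^ n * A ^ n * A' := by ring
      _ ≤ Z ^ 2 * A' ^ n * A ^ n * A := by gcongr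
      _ = _ := by ring

/-- The final bound no longer contains `ε`, so it serves as a dominating function for the squared
derivatives. -/
lemma kernLog_sq_mul_le (hn : 1 ≤ n) {c r : ℝ} (hc : 0 < c) {F : Set (Euc n)}
    (hF : ∀ y ∈ F, ∀ s, 0 < s → s ≤ r →
      ENNReal.ofReal c * ENNReal.ofReal s ^ (n - 1) ≤ σ (Metric.closedBall y s))
    (hσ : σ ≠ 0) {ε : ℝ} (hε : 0 < ε) (i : Fin n) {x y y' : Euc n} (hy : y ∈ F) (hy' : y' ∈ F)
    (hr : Real.sqrt (‖x - y‖ ^ 2 + ε ^ 2) ≤ r) (hr' : Real.sqrt (‖x - y'‖ ^ 2 + ε ^ 2) ≤ r) :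
    ENNReal.ofReal (kernLog ε i (x - y) ^ 2 * (kern ε (x - y) / kernMass σ ε x) *
        (kern ε (x - y') / kernMass σ ε x)) ≤
      ENNReal.ofReal (4 * n ^ 2 * (2 ^ n / (c / 5 ^ n) ^ 2)) *
        (ENNReal.ofReal (‖x - y‖ ^ 2 + ‖x - y'‖ ^ 2) ^ n)⁻¹ := by
  have hZ := kernMass_pos hσ hε x
  have hA : 0 < ‖x - y‖ ^ 2 + ε ^ 2 := by positivity
  have hA' : 0 < ‖x - y'‖ ^ 2 + ε ^ 2 := by positivity
  have h1 := inv_mul_inv_le hA hA' hZ (by positivity : 0 < c / 5 ^ n)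
    (le_kernMass_sq hc hF hn hε hy hr) (le_kernMass_sq hc hF hn hε hy' hr')
  have h2 : kernLog ε i (x - y) ^ 2 * (kern ε (x - y) / kernMass σ ε x) *
        (kern ε (x - y') / kernMass σ ε x) ≤ 4 * n ^ 2 * (2 ^ n / (c / 5 ^ n) ^ 2) *
          ((‖x - y‖ ^ 2 + ε ^ 2 + (‖x - y'‖ ^ 2 + ε ^ 2)) ^ n)⁻¹ := by
    calc _ ≤ 4 * n ^ 2 * (‖x - y‖ ^ 2 + ε ^ 2)⁻¹ * (kern ε (x - y) / kernMass σ ε x) *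
        (kern ε (x - y') / kernMass σ ε x) := by
          have := abs_kernLog_sq_le (i := i) hA
          have := kern_nonneg ε (x - y)
          have := kern_nonneg ε (x - y')
          gcongr
      _ = 4 * n ^ 2 * ((‖x - y‖ ^ 2 + ε ^ 2)⁻¹ * (kern ε (x - y) / kernMass σ ε x) *
        (kern ε (x - y') / kernMass σ ε x)) := by ring
      _ ≤ 4 * n ^ 2 * (2 ^ n / (c / 5 ^ n) ^ 2 *
          ((‖x - y‖ ^ 2 + ε ^ 2 + (‖x - y'‖ ^ 2 + ε ^ 2)) ^ n)⁻¹) := by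
          refine mul_le_mul_of_nonneg_left h1 (by positivity)
      _ = _ := by ring
  refine (ENNReal.ofReal_le_ofReal h2).trans ?_
  rw [ENNReal.ofReal_mul (by positivity), ENNReal.ofReal_inv_of_pos (by positivity),
    ENNReal.ofReal_pow (by positivity)]
  gcongr
  · nlinarith [sq_nonneg ε]
  · nlinarith [sq_nonneg ε]

/-- A kernel `ρ^(-2n)` over a mass of at least order `ρ^(-(n+1))` is at most of order `ρ^(-(n-1))`,
where `ρ² = ‖x - y‖² + ε²`. Replacing `ρ` by `‖x - y‖` leaves a singularity that is locally
integrable in `ℝⁿ`. -/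
lemma kern_div_kernMass_le (hn : 1 ≤ n) {c r : ℝ} (hc : 0 < c) {F : Set (Euc n)}
    (hF : ∀ y ∈ F, ∀ s, 0 < s → s ≤ r →
      ENNReal.ofReal c * ENNReal.ofReal s ^ (n - 1) ≤ σ (Metric.closedBall y s))
    (hσ : σ ≠ 0) {ε : ℝ} (hε : 0 < ε) {x y : Euc n} (hy : y ∈ F)
    (hr : Real.sqrt (‖x - y‖ ^ 2 + ε ^ 2) ≤ r) :
    ENNReal.ofReal (kern ε (x - y) / kernMass σ ε x) ≤
      ENNReal.ofReal (c / 5 ^ n)⁻¹ * (ENNReal.ofReal ‖x - y‖ ^ (n - 1))⁻¹ := by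
  have hZ := kernMass_pos hσ hε x
  set A := ‖x - y‖ ^ 2 + ε ^ 2 with hAdef
  have hA : 0 < A := by positivity
  have h1 := le_kernMass_sq hc hF hn hε hy hr
  rw [← hAdef] at h1
  have h2 : c / 5 ^ n * Real.sqrt A ^ (n - 1) ≤ kernMass σ ε x * A ^ n := by
    refine le_of_sq_le_sq ?_ (by positivity)
    obtain ⟨m, rfl⟩ : ∃ m, n = m + 1 := ⟨n - 1, by omega⟩
    rw [Nat.add_sub_cancel, mul_pow, ← pow_mul, mul_comm m 2, pow_mul, Real.sq_sqrt hA.le]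
    calc _ ≤ _ := mul_le_mul_of_nonneg_right h1 (by positivity)
      _ = _ := by ring
  have h3 : kern ε (x - y) / kernMass σ ε x ≤ (c / 5 ^ n)⁻¹ * (Real.sqrt A ^ (n - 1))⁻¹ := by
    rw [kern, ← hAdef, ← mul_inv, div_eq_mul_inv, ← mul_inv, mul_comm (A ^ n)]
    exact inv_anti₀ (by positivity) h2
  refine (ENNReal.ofReal_le_ofReal h3).trans ?_
  rw [ENNReal.ofReal_mul (by positivity),
    ENNReal.ofReal_inv_of_pos (x := Real.sqrt A ^ (n - 1)) (by positivity),
    ENNReal.ofReal_pow (by positivity)]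
  gcongr
  exact Real.le_sqrt_of_sq_le (by rw [hAdef]; nlinarith [sq_nonneg ε])

/-- For `x` on the boundary the mass is at least of order `ε^(-(n+1))`. Bounding one half of the
kernel by `ε⁻ⁿ` and the other by `|x - y|⁻ⁿ` leaves a spare factor `ε`, the source of convergence on
the boundary. -/
lemma kern_div_kernMass_le_of_mem (hn : 1 ≤ n) {c r : ℝ} (hc : 0 < c) {F : Set (Euc n)}
    (hF : ∀ y ∈ F, ∀ s, 0 < s → s ≤ r →
      ENNReal.ofReal c * ENNReal.ofReal s ^ (n - 1) ≤ σ (Metric.closedBall y s))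
    (hσ : σ ≠ 0) {ε : ℝ} (hε : 0 < ε) (hεr : ε ≤ r) {x : Euc n} (hx : x ∈ F) (y : Euc n) :
    ENNReal.ofReal (kern ε (x - y) / kernMass σ ε x) ≤
      ENNReal.ofReal ((c / 5 ^ n)⁻¹ * ε) * (edist x y ^ n)⁻¹ := by
  have hZ := kernMass_pos hσ hε x
  have h1 := le_kernMass_sq hc hF hn hε hx (x := x) (by simpa [Real.sqrt_sq hε.le] using hεr)
  rw [sub_self, norm_zero, zero_pow two_ne_zero, zero_add, ← pow_mul, mul_comm 2, pow_mul,
    ← mul_pow] at h1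
  have h2 : c / 5 ^ n ≤ kernMass σ ε x * ε ^ (n + 1) := le_of_sq_le_sq h1 (by positivity)
  set A := ‖x - y‖ ^ 2 + ε ^ 2 with hAdef
  have hA : 0 < A := by positivity
  have hsA : ε ≤ Real.sqrt A := Real.le_sqrt_of_sq_le (by rw [hAdef]; nlinarith [sq_nonneg ‖x - y‖])
  have hxA : ‖x - y‖ ≤ Real.sqrt A := Real.le_sqrt_of_sq_le (by rw [hAdef]; nlinarith [sq_nonneg ε])
  have hAn : A ^ n = Real.sqrt A ^ n * Real.sqrt A ^ n := by
    rw [← mul_pow, Real.mul_self_sqrt hA.le]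
  have h3 : kern ε (x - y) / kernMass σ ε x ≤ (c / 5 ^ n)⁻¹ * ε * (Real.sqrt A ^ n)⁻¹ := by
    have hs : 0 < Real.sqrt A := Real.sqrt_pos.2 hA
    rw [kern, ← hAdef, hAn]
    have h4 : c / 5 ^ n ≤ kernMass σ ε x * ε * Real.sqrt A ^ n := by
      calc _ ≤ _ := h2
        _ = kernMass σ ε x * ε * ε ^ n := by ring
        _ ≤ _ := by gcongr
    rw [div_le_iff₀ hZ, inv_le_iff_one_le_mul₀ (by positivity)]
    have h5 : (c / 5 ^ n)⁻¹ * ε * (Real.sqrt A ^ n)⁻¹ * kernMass σ ε x *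
        (Real.sqrt A ^ n * Real.sqrt A ^ n) = (c / 5 ^ n)⁻¹ * (kernMass σ ε x * ε * Real.sqrt A ^ n) := by field_simp
    rw [h5]
    calc (1 : ℝ) = (c / 5 ^ n)⁻¹ * (c / 5 ^ n) := by field_simp
      _ ≤ _ := by gcongr
  refine (ENNReal.ofReal_le_ofReal h3).trans ?_
  rw [ENNReal.ofReal_mul (by positivity), ENNReal.ofReal_inv_of_pos (x := Real.sqrt A ^ n)
    (pow_pos (Real.sqrt_pos.2 hA) n), ENNReal.ofReal_pow (by positivity), edist_dist, dist_eq_norm]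
  gcongr

end Bounds

/-! ### Integrability of the dominating functions. -/

section Domination

variable {σ : Measure (Euc n)} {g : Euc n → ℝ}

/-- Centring at the midpoint and scaling by `t = ‖y - y'‖`, the parallelogram law turns the sum of
squares into `2 t² (‖z‖² + 1/4)`. Its power `-n` is integrable as `2n > n`, and the Jacobian `tⁿ`
against `t^(-2n)` leaves `t⁻ⁿ`. -/
lemma exists_lintegral_inv_sq_add_sq_le (hn : 1 ≤ n) : ∃ B : ENNReal, B ≠ ⊤ ∧ ∀ y y' : Euc n,
    y ≠ y' → ∫⁻ x, (ENNReal.ofReal (‖x - y‖ ^ 2 + ‖x - y'‖ ^ 2) ^ n)⁻¹ ≤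
      B * (edist y y' ^ n)⁻¹ := by
  have hInt : Integrable (fun z : Euc n => ((1 : ℝ) + ‖z‖ ^ 2) ^ (-(2 * n : ℝ) / 2)) volume := by
    refine integrable_rpow_neg_one_add_norm_sq ?_
    rw [finrank_euclideanSpace_fin]
    have : (1 : ℝ) ≤ n := by exact_mod_cast hn
    linarith
  have hrp : ∀ z : Euc n, ((1 : ℝ) + ‖z‖ ^ 2) ^ (-(2 * n : ℝ) / 2) =
      (((1 : ℝ) + ‖z‖ ^ 2) ^ n)⁻¹ := by
    intro z
    have h1 : -(2 * n : ℝ) / 2 = -(n : ℝ) := by ring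
    rw [h1, Real.rpow_neg (by positivity), Real.rpow_natCast]
  simp only [hrp] at hInt
  refine ⟨ENNReal.ofReal (2 ^ n) * ∫⁻ z : Euc n, ENNReal.ofReal ((((1 : ℝ) + ‖z‖ ^ 2) ^ n)⁻¹),
    ENNReal.mul_ne_top ENNReal.ofReal_ne_top hInt.lintegral_lt_top.ne, fun y y' hyy => ?_⟩
  set t := ‖y - y'‖ with ht
  have ht0 : 0 < t := norm_pos_iff.2 (sub_ne_zero.2 hyy)
  set m : Euc n := (2 : ℝ)⁻¹ • (y + y') with hm
  have hG : Measurable fun x : Euc n => (ENNReal.ofReal (‖x - y‖ ^ 2 + ‖x - y'‖ ^ 2) ^ n)⁻¹ := by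
    fun_prop
  have h1 := lintegral_comp_add_smul hG m ht0
  have hpt : ∀ z : Euc n, (ENNReal.ofReal (‖m + t • z - y‖ ^ 2 + ‖m + t • z - y'‖ ^ 2) ^ n)⁻¹ ≤
      (ENNReal.ofReal t ^ n)⁻¹ * (ENNReal.ofReal t ^ n)⁻¹ * (ENNReal.ofReal (2 ^ n) *
        ENNReal.ofReal ((((1 : ℝ) + ‖z‖ ^ 2) ^ n)⁻¹)) := by
    intro z
    have e1 : m + t • z - y = t • z - (2 : ℝ)⁻¹ • (y - y') := by rw [hm]; module
    have e2 : m + t • z - y' = t • z + (2 : ℝ)⁻¹ • (y - y') := by rw [hm]; module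
    have e3 := parallelogram_law_with_norm ℝ (t • z) ((2 : ℝ)⁻¹ • (y - y'))
    have e4 : ‖m + t • z - y‖ ^ 2 + ‖m + t • z - y'‖ ^ 2 =
        2 * (t ^ 2 * ‖z‖ ^ 2 + t ^ 2 / 4) := by
      rw [e1, e2]
      rw [norm_smul, norm_smul, ← ht, Real.norm_of_nonneg ht0.le] at e3
      norm_num at e3
      nlinarith [e3]
    have e5 : t ^ 2 * ((1 + ‖z‖ ^ 2) / 2) ≤ 2 * (t ^ 2 * ‖z‖ ^ 2 + t ^ 2 / 4) := by
      nlinarith [mul_nonneg (sq_nonneg t) (sq_nonneg ‖z‖)]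
    rw [e4, ← ENNReal.ofReal_pow (by positivity), ← ENNReal.ofReal_inv_of_pos (by positivity),
      ← ENNReal.ofReal_pow ht0.le, ← ENNReal.ofReal_inv_of_pos (by positivity),
      ← ENNReal.ofReal_mul (by positivity), ← ENNReal.ofReal_mul (by positivity),
      ← ENNReal.ofReal_mul (by positivity)]
    refine ENNReal.ofReal_le_ofReal ?_
    have e6 : (t ^ n)⁻¹ * (t ^ n)⁻¹ * (2 ^ n * ((1 + ‖z‖ ^ 2) ^ n)⁻¹) =
        ((t ^ 2 * ((1 + ‖z‖ ^ 2) / 2)) ^ n)⁻¹ := by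
      rw [mul_pow, div_pow, ← pow_mul, mul_comm 2 n, pow_mul]
      field_simp
    rw [e6]
    gcongr
  have h2 : ∫⁻ x, (ENNReal.ofReal (‖x - y‖ ^ 2 + ‖x - y'‖ ^ 2) ^ n)⁻¹ =
      ENNReal.ofReal t ^ n * ∫⁻ z,
        (ENNReal.ofReal (‖m + t • z - y‖ ^ 2 + ‖m + t • z - y'‖ ^ 2) ^ n)⁻¹ := by
    rw [h1, ← mul_assoc, ENNReal.mul_inv_cancel, one_mul]
    · exact pow_ne_zero _ (by simpa using ht0)
    · exact ENNReal.pow_ne_top ENNReal.ofReal_ne_top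
  rw [h2]
  have hp0 : ENNReal.ofReal t ^ n ≠ 0 := pow_ne_zero _ (by simpa using ht0)
  have hpt' : ENNReal.ofReal t ^ n ≠ ⊤ := ENNReal.pow_ne_top ENNReal.ofReal_ne_top
  calc _ ≤ ENNReal.ofReal t ^ n * ∫⁻ z : Euc n, (ENNReal.ofReal t ^ n)⁻¹ *
        (ENNReal.ofReal t ^ n)⁻¹ * (ENNReal.ofReal (2 ^ n) *
        ENNReal.ofReal ((((1 : ℝ) + ‖z‖ ^ 2) ^ n)⁻¹)) :=
        mul_le_mul_right (lintegral_mono hpt) _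
    _ = (ENNReal.ofReal t ^ n * (ENNReal.ofReal t ^ n)⁻¹) * (ENNReal.ofReal t ^ n)⁻¹ *
        (ENNReal.ofReal (2 ^ n) * ∫⁻ z : Euc n, ENNReal.ofReal ((((1 : ℝ) + ‖z‖ ^ 2) ^ n)⁻¹)) := by
        rw [lintegral_const_mul' _ _ (ENNReal.mul_ne_top (ENNReal.inv_ne_top.2 hp0)
          (ENNReal.inv_ne_top.2 hp0)), lintegral_const_mul' _ _ ENNReal.ofReal_ne_top]
        ring
    _ = _ := by
        rw [ENNReal.mul_inv_cancel hp0 hpt', one_mul, mul_comm, edist_dist, dist_eq_norm]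

/-- By Tonelli the integral in `x` is taken first, which turns the weight into the Gagliardo kernel.
On the diagonal `y = y'` the difference of `g` vanishes. -/
lemma exists_lintegral_gradient_bound_le (hn : 1 ≤ n) : ∃ B : ENNReal, B ≠ ⊤ ∧
    ∀ (σ : Measure (Euc n)) [SFinite σ] (g : Euc n → ℝ), Measurable g →
      ∫⁻ x, ∫⁻ y, ∫⁻ y', ‖g y - g y'‖ₑ ^ 2 *
        (ENNReal.ofReal (‖x - y‖ ^ 2 + ‖x - y'‖ ^ 2) ^ n)⁻¹ ∂σ ∂σ ≤
      B * ∫⁻ y, ∫⁻ y', ‖g y - g y'‖ₑ ^ 2 / edist y y' ^ n ∂σ ∂σ := by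
  obtain ⟨B, hB, hBle⟩ := exists_lintegral_inv_sq_add_sq_le hn
  refine ⟨B, hB, fun σ _ g hg => ?_⟩
  have hm : Measurable fun p : (Euc n × Euc n) × Euc n => ‖g p.1.2 - g p.2‖ₑ ^ 2 *
      (ENNReal.ofReal (‖p.1.1 - p.1.2‖ ^ 2 + ‖p.1.1 - p.2‖ ^ 2) ^ n)⁻¹ := by fun_prop
  have hm1 : Measurable fun p : Euc n × Euc n => ∫⁻ y', ‖g p.2 - g y'‖ₑ ^ 2 *
      (ENNReal.ofReal (‖p.1 - p.2‖ ^ 2 + ‖p.1 - y'‖ ^ 2) ^ n)⁻¹ ∂σ :=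
    Measurable.lintegral_prod_right' hm
  rw [lintegral_lintegral_swap hm1.aemeasurable, ← lintegral_const_mul' _ _ hB]
  refine lintegral_mono fun y => ?_
  have hm2 : Measurable fun p : Euc n × Euc n => ‖g y - g p.2‖ₑ ^ 2 *
      (ENNReal.ofReal (‖p.1 - y‖ ^ 2 + ‖p.1 - p.2‖ ^ 2) ^ n)⁻¹ := by fun_prop
  rw [lintegral_lintegral_swap hm2.aemeasurable, ← lintegral_const_mul' _ _ hB]
  refine lintegral_mono fun y' => ?_
  rw [lintegral_const_mul' _ _ (ENNReal.pow_ne_top enorm_ne_top)]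
  rcases eq_or_ne y y' with rfl | hyy
  · simp
  · calc _ ≤ _ := mul_le_mul_right (hBle y y' hyy) _
      _ = _ := by rw [div_eq_mul_inv]; ring

/-- The power `-(n-1)` is locally integrable in dimension `n`, and translation invariance makes the
bound independent of `y`. -/
lemma exists_setLIntegral_inv_norm_pow_le (hn : 1 ≤ n) (r : ℝ) : ∃ B : ENNReal, B ≠ ⊤ ∧
    ∀ y : Euc n, ∫⁻ x in Metric.ball y r, (ENNReal.ofReal ‖x - y‖ ^ (n - 1))⁻¹ ≤ B := by
  have hfin : Module.finrank ℝ (Euc n) = n := finrank_euclideanSpace_fin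
  have h1 : IntegrableOn (fun z : Euc n => (‖z‖ ^ (n - 1))⁻¹) (Metric.ball 0 r) volume := by
    refine integrableOn_ball_of_norm_le_rpow (C := 1) (α := ((n - 1 : ℕ) : ℝ)) (by rwa [hfin]) ?_
      (Eventually.of_forall fun z => ?_) (by fun_prop)
    · rw [hfin]; exact_mod_cast (by omega : n - 1 < n)
    · rw [Real.norm_of_nonneg (by positivity), one_mul, Real.rpow_neg (norm_nonneg _),
        Real.rpow_natCast]
  have : NeZero n := ⟨by omega⟩
  refine ⟨_, h1.lintegral_lt_top.ne, fun y => le_of_eq ?_⟩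
  rw [← lintegral_indicator Metric.isOpen_ball.measurableSet,
    ← lintegral_indicator Metric.isOpen_ball.measurableSet,
    ← lintegral_add_right_eq_self _ y]
  refine lintegral_congr_ae ?_
  have h0 : ∀ᵐ z : Euc n, z ≠ 0 := by
    rw [ae_iff]
    simp
  filter_upwards [h0] with z hz
  by_cases hzr : z ∈ Metric.ball (0 : Euc n) r
  · have hzr' : z + y ∈ Metric.ball y r := by simpa using hzr
    have hz' : 0 < ‖z‖ := norm_pos_iff.2 hz
    rw [Set.indicator_of_mem hzr, Set.indicator_of_mem hzr', add_sub_cancel_right,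
      ENNReal.ofReal_inv_of_pos (by positivity), ENNReal.ofReal_pow hz'.le]
  · have hzr' : z + y ∉ Metric.ball y r := by simpa using hzr
    rw [Set.indicator_of_notMem hzr, Set.indicator_of_notMem hzr']

lemma exists_setLIntegral_average_bound_le (hn : 1 ≤ n) (R : ℝ) : ∃ B : ENNReal, B ≠ ⊤ ∧
    ∀ (σ : Measure (Euc n)) [SFinite σ] (g : Euc n → ℝ) (Ω : Set (Euc n)), Measurable g →
      (∀ᵐ y ∂σ, Ω ⊆ Metric.ball y R) →
      ∫⁻ x in Ω, ∫⁻ y, ‖g y‖ₑ ^ 2 * (ENNReal.ofReal ‖x - y‖ ^ (n - 1))⁻¹ ∂σ ≤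
        B * ∫⁻ y, ‖g y‖ₑ ^ 2 ∂σ := by
  obtain ⟨B, hB, hBle⟩ := exists_setLIntegral_inv_norm_pow_le hn R
  refine ⟨B, hB, fun σ _ g Ω hg hΩ => ?_⟩
  have hm : Measurable fun p : Euc n × Euc n =>
      ‖g p.2‖ₑ ^ 2 * (ENNReal.ofReal ‖p.1 - p.2‖ ^ (n - 1))⁻¹ := by fun_prop
  rw [lintegral_lintegral_swap hm.aemeasurable, ← lintegral_const_mul' _ _ hB]
  refine lintegral_mono_ae ?_
  filter_upwards [hΩ] with y hy
  rw [lintegral_const_mul' _ _ (ENNReal.pow_ne_top enorm_ne_top), mul_comm]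
  exact mul_le_mul_left ((lintegral_mono_set hy).trans (hBle y)) _

end Domination

/-! ### Removing the regularisation inside the domain. -/

section Limits

variable {σ : Measure (Euc n)} {g : Euc n → ℝ}

lemma tendsto_integral_mul_of_bounded {α : Type*} [MeasurableSpace α] {μ : Measure α} {f : α → ℝ}
    (hf : Integrable f μ) {k : ℕ → α → ℝ} {k₀ : α → ℝ} {C : ℝ} (hk : ∀ j, Measurable (k j))
    (hC : ∀ j, ∀ᵐ y ∂μ, |k j y| ≤ C)
    (hlim : ∀ᵐ y ∂μ, Tendsto (fun j => k j y) atTop (𝓝 (k₀ y))) :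
    Tendsto (fun j => ∫ y, f y * k j y ∂μ) atTop (𝓝 (∫ y, f y * k₀ y ∂μ)) := by
  refine tendsto_integral_of_dominated_convergence (fun y => ‖f y‖ * C)
    (fun j => hf.aestronglyMeasurable.mul (hk j).aestronglyMeasurable) (hf.norm.mul_const C)
    (fun j => ?_) ?_
  · filter_upwards [hC j] with y hy
    rw [norm_mul]
    exact mul_le_mul_of_nonneg_left hy (norm_nonneg _)
  · filter_upwards [hlim] with y hy
    exact hy.const_mul _

lemma tendsto_kern {e : ℕ → ℝ} (he : Tendsto e atTop (𝓝 0)) {z : Euc n} (hz : z ≠ 0) :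
    Tendsto (fun j => kern (e j) z) atTop (𝓝 (kern 0 z)) := by
  unfold kern
  have hz' : 0 < ‖z‖ := norm_pos_iff.2 hz
  exact (((he.pow 2).const_add (‖z‖ ^ 2)).pow n).inv₀ (by positivity)

lemma tendsto_kernLog {e : ℕ → ℝ} (he : Tendsto e atTop (𝓝 0)) (i : Fin n) {z : Euc n}
    (hz : z ≠ 0) : Tendsto (fun j => kernLog (e j) i z) atTop (𝓝 (kernLog 0 i z)) := by
  unfold kernLog
  have hz' : 0 < ‖z‖ := norm_pos_iff.2 hz
  exact tendsto_const_nhds.div ((he.pow 2).const_add (‖z‖ ^ 2)) (by positivity)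

lemma abs_kern_le {ε d : ℝ} (hd : 0 < d) {z : Euc n} (hz : d ≤ ‖z‖) :
    |kern ε z| ≤ ((d ^ 2) ^ n)⁻¹ := by
  rw [abs_of_nonneg (kern_nonneg _ _)]
  exact kern_le (by positivity) (by nlinarith [sq_nonneg ε])

lemma abs_kernLog_mul_kern_le {ε d : ℝ} (hd : 0 < d) (i : Fin n) {z : Euc n} (hz : d ≤ ‖z‖) :
    |kernLog ε i z * kern ε z| ≤ 2 * n / d * ((d ^ 2) ^ n)⁻¹ := by
  have hz0 : 0 < ‖z‖ := hd.trans_le hz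
  rw [abs_mul]
  refine mul_le_mul ?_ (abs_kern_le hd hz) (abs_nonneg _) (by positivity)
  refine abs_le_of_sq_le_sq (b := 2 * n / d) ((abs_kernLog_sq_le (by positivity)).trans ?_)
    (by positivity)
  rw [div_pow, mul_pow, div_eq_mul_inv]
  norm_num
  gcongr
  nlinarith [sq_nonneg ε]

/-- At positive distance from the boundary the kernels are bounded uniformly in `ε`, so the limit
passes under the integral. -/
lemma tendsto_integral_mul_kern (hg : Integrable g σ) {x : Euc n} {d : ℝ} (hd : 0 < d)
    (hx : ∀ᵐ y ∂σ, d ≤ ‖x - y‖) {e : ℕ → ℝ} (he : Tendsto e atTop (𝓝 0)) :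
    Tendsto (fun j => ∫ y, g y * kern (e j) (x - y) ∂σ) atTop
      (𝓝 (∫ y, g y * kern 0 (x - y) ∂σ)) :=
  tendsto_integral_mul_of_bounded hg
    (fun _ => (measurable_kern _).comp (measurable_const.sub measurable_id))
    (fun _ => hx.mono fun _ hy => abs_kern_le hd hy)
    (hx.mono fun _ hy => tendsto_kern he (norm_pos_iff.1 (hd.trans_le hy)))

lemma tendsto_integral_mul_kernLog_mul_kern (hg : Integrable g σ) (i : Fin n) {x : Euc n} {d : ℝ}
    (hd : 0 < d) (hx : ∀ᵐ y ∂σ, d ≤ ‖x - y‖) {e : ℕ → ℝ} (he : Tendsto e atTop (𝓝 0)) :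
    Tendsto (fun j => ∫ y, g y * (kernLog (e j) i (x - y) * kern (e j) (x - y)) ∂σ) atTop
      (𝓝 (∫ y, g y * (kernLog 0 i (x - y) * kern 0 (x - y)) ∂σ)) :=
  tendsto_integral_mul_of_bounded hg
    (fun _ => ((measurable_kernLog _ i).comp (measurable_const.sub measurable_id)).mul
      ((measurable_kern _).comp (measurable_const.sub measurable_id)))
    (fun _ => hx.mono fun _ hy => abs_kernLog_mul_kern_le hd i hy)
    (hx.mono fun _ hy => (tendsto_kernLog he i (norm_pos_iff.1 (hd.trans_le hy))).mul
      (tendsto_kern he (norm_pos_iff.1 (hd.trans_le hy))))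

variable [IsFiniteMeasure σ]

lemma kernMass_zero_pos (hσ : σ ≠ 0) {x : Euc n} {d : ℝ} (hd : 0 < d)
    (hx : ∀ᵐ y ∂σ, d ≤ ‖x - y‖) : 0 < kernMass σ 0 x := by
  have hm : Measurable fun y => kern 0 (x - y) :=
    (measurable_kern 0).comp (measurable_const.sub measurable_id)
  have hInt : Integrable (fun y => kern 0 (x - y)) σ := by
    refine Integrable.of_bound hm.aestronglyMeasurable (((d ^ 2) ^ n)⁻¹) ?_
    filter_upwards [hx] with y hy using abs_kern_le hd hy
  rw [kernMass, integral_pos_iff_support_of_nonneg (fun y => kern_nonneg _ _) hInt,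
    pos_iff_ne_zero]
  intro h0
  rw [measure_eq_zero_iff_ae_notMem] at h0
  refine hσ (ae_eq_bot.1 (Filter.eventually_false_iff_eq_bot.1 ?_))
  filter_upwards [h0, hx] with y hy hy'
  have h1 : 0 < ‖x - y‖ := hd.trans_le hy'
  exact hy (by rw [Function.mem_support, kern]; positivity)

lemma tendsto_kernMass {x : Euc n} {d : ℝ} (hd : 0 < d) (hx : ∀ᵐ y ∂σ, d ≤ ‖x - y‖)
    {e : ℕ → ℝ} (he : Tendsto e atTop (𝓝 0)) :
    Tendsto (fun j => kernMass σ (e j) x) atTop (𝓝 (kernMass σ 0 x)) := by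
  have h := tendsto_integral_mul_of_bounded (μ := σ) (integrable_const (1 : ℝ))
    (k := fun j y => kern (e j) (x - y)) (k₀ := fun y => kern 0 (x - y)) (C := ((d ^ 2) ^ n)⁻¹)
    (fun j => (measurable_kern _).comp (measurable_const.sub measurable_id))
    (fun j => hx.mono fun y hy => abs_kern_le hd hy)
    (hx.mono fun y hy => tendsto_kern he (norm_pos_iff.1 (hd.trans_le hy)))
  simp only [one_mul] at h
  exact h

lemma tendsto_kernAvg (hσ : σ ≠ 0) (hg : Integrable g σ) {x : Euc n} {d : ℝ} (hd : 0 < d)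
    (hx : ∀ᵐ y ∂σ, d ≤ ‖x - y‖) {e : ℕ → ℝ} (he : Tendsto e atTop (𝓝 0)) :
    Tendsto (fun j => kernAvg σ g (e j) x) atTop (𝓝 (kernAvg σ g 0 x)) :=
  (tendsto_integral_mul_kern hg hd hx he).div (tendsto_kernMass hd hx he)
    (kernMass_zero_pos hσ hd hx).ne'

lemma tendsto_kernAvgDeriv (hσ : σ ≠ 0) (hg : Integrable g σ) (i : Fin n) {x : Euc n} {d : ℝ}
    (hd : 0 < d) (hx : ∀ᵐ y ∂σ, d ≤ ‖x - y‖) {e : ℕ → ℝ} (he : Tendsto e atTop (𝓝 0)) :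
    Tendsto (fun j => kernAvgDeriv σ g (e j) i x) atTop (𝓝 (kernAvgDeriv σ g 0 i x)) := by
  have h1 := tendsto_integral_mul_kernLog_mul_kern (σ := σ) (integrable_const (1 : ℝ)) i hd hx he
  simp only [one_mul] at h1
  exact (((tendsto_integral_mul_kernLog_mul_kern hg i hd hx he).mul
    (tendsto_kernMass hd hx he)).sub ((tendsto_integral_mul_kern hg hd hx he).mul h1)).div
    ((tendsto_kernMass hd hx he).pow 2) (pow_ne_zero _ (kernMass_zero_pos hσ hd hx).ne')

end Limits

/-! ### Dominated convergence in `L²`. -/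

section L2Limit

/-- The pointwise limit `F` inherits the bound `G`, so `|f j - F|² ≤ 4 G` dominates the error. -/
lemma exists_tendsto_eLpNorm_of_dominated {α : Type*} [MeasurableSpace α] {μ : Measure α}
    {f : ℕ → α → ℝ} (hf : ∀ j, AEStronglyMeasurable (f j) μ) {G : α → ENNReal}
    (hG : ∫⁻ x, G x ∂μ ≠ ⊤) (hb : ∀ j, ∀ᵐ x ∂μ, ‖f j x‖ₑ ^ 2 ≤ G x)
    (hl : ∀ᵐ x ∂μ, ∃ l, Tendsto (fun j => f j x) atTop (𝓝 l)) :
    (∀ j, MemLp (f j) 2 μ) ∧ ∃ u : Lp ℝ 2 μ,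
      Tendsto (fun j => eLpNorm (fun x => f j x - u x) 2 μ) atTop (𝓝 0) := by
  have hmem : ∀ h : α → ℝ, AEStronglyMeasurable h μ → (∀ᵐ x ∂μ, ‖h x‖ₑ ^ 2 ≤ G x) →
      MemLp h 2 μ := by
    intro h hh hhG
    refine ⟨hh, ?_⟩
    have h1 : eLpNorm h 2 μ ^ 2 < ⊤ := by
      rw [eLpNorm_two_sq]
      exact (lintegral_mono_ae hhG).trans_lt hG.lt_top
    by_contra h2
    rw [not_lt, top_le_iff] at h2
    simp [h2] at h1
  obtain ⟨F, hFm, hF⟩ := exists_stronglyMeasurable_limit_of_tendsto_ae hf hl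
  have hFG : ∀ᵐ x ∂μ, ‖F x‖ₑ ^ 2 ≤ G x := by
    filter_upwards [hF, ae_all_iff.2 hb] with x hx hbx
    exact le_of_tendsto ((ENNReal.continuous_pow 2).continuousAt.tendsto.comp
      ((continuous_enorm.tendsto _).comp hx)) (Eventually.of_forall hbx)
  have hFmem := hmem F hFm.aestronglyMeasurable hFG
  refine ⟨fun j => hmem _ (hf j) (hb j), hFmem.toLp F, ?_⟩
  refine tendsto_zero_of_sq ?_
  have h0 : ∀ j, eLpNorm (fun x => f j x - hFmem.toLp F x) 2 μ ^ 2 =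
      ∫⁻ x, ‖f j x - F x‖ₑ ^ 2 ∂μ := by
    intro j
    rw [eLpNorm_two_sq]
    refine lintegral_congr_ae ?_
    filter_upwards [hFmem.coeFn_toLp] with x hx
    rw [hx]
  simp only [h0]
  have h1 := tendsto_lintegral_of_dominated_convergence' (μ := μ)
    (F := fun j x => ‖f j x - F x‖ₑ ^ 2) (f := fun _ => 0) (fun x => 2 * (G x + G x))
    (fun j => ((hf j).sub hFm.aestronglyMeasurable).enorm.pow_const 2) (fun j => ?_) ?_ ?_
  · simpa using h1
  · filter_upwards [hb j, hFG] with x h1 h2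
    refine (enorm_sub_sq_le _ _ 0).trans ?_
    rw [sub_zero, sub_zero]
    gcongr
  · have : ∀ x, 2 * (G x + G x) = 4 * G x := fun x => by ring
    simp only [this]
    rw [lintegral_const_mul' _ _ (by simp)]
    exact ENNReal.mul_ne_top (by simp) hG
  · filter_upwards [hF] with x hx
    have h2 : Tendsto (fun j => f j x - F x) atTop (𝓝 0) := by
      simpa using hx.sub_const (F x)
    have h3 := (ENNReal.continuous_pow 2).continuousAt.tendsto.comp
      ((continuous_enorm.tendsto _).comp h2)
    simpa [Function.comp_def] using h3

end L2Limit

/-! ### Extension of boundary data from `H^{1/2}(∂Ω)` to `H¹(Ω)`. -/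

section Extension

variable {Ω : Set (Euc n)}

lemma ne_zero_surfaceMeasure (hn : 1 ≤ n) (hΩ : IsBoundedLipschitzDomain Ω) :
    surfaceMeasure Ω ≠ 0 := by
  intro h
  obtain ⟨x, hx⟩ := hΩ.frontier_nonempty hn
  obtain ⟨c, hc, hle⟩ := hΩ.exists_le_surfaceMeasure hn 1
  have h1 := hle x hx 1 one_pos le_rfl
  rw [h] at h1
  simp at h1
  exact hc.ne' h1

lemma exists_le_norm_sub_of_mem (hΩ : IsOpen Ω) {x : Euc n} (hx : x ∈ Ω) :
    ∃ d, 0 < d ∧ ∀ y ∈ frontier Ω, d ≤ ‖x - y‖ := by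
  obtain ⟨d, hd, hball⟩ := Metric.isOpen_iff.1 hΩ x hx
  refine ⟨d, hd, fun y hy => ?_⟩
  by_contra! h
  rw [← dist_eq_norm, dist_comm] at h
  rw [hΩ.frontier_eq] at hy
  exact hy.2 (hball h)

/-- Dominated convergence gives `L²` limits of the functions and of their derivatives, and
closedness of the weak derivative matches the two. The pointwise limits only have to exist; none is
identified. -/
lemma isTrace_of_dominated (hΩ : IsOpen Ω) {ψ : ℕ → Euc n → ℝ} (hψ : ∀ j, ContDiff ℝ ∞ (ψ j))
    {G : Euc n → ENNReal} (hG : ∫⁻ x in Ω, G x ≠ ⊤) (hb : ∀ j, ∀ x ∈ Ω, ‖ψ j x‖ₑ ^ 2 ≤ G x)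
    (hl : ∀ x ∈ Ω, ∃ l, Tendsto (fun j => ψ j x) atTop (𝓝 l))
    {G' : Euc n → ENNReal} (hG' : ∫⁻ x in Ω, G' x ≠ ⊤)
    (hb' : ∀ i j, ∀ x ∈ Ω, ‖partialDeriv i (ψ j) x‖ₑ ^ 2 ≤ G' x)
    (hl' : ∀ i, ∀ x ∈ Ω, ∃ l, Tendsto (fun j => partialDeriv i (ψ j) x) atTop (𝓝 l))
    {g : L2Boundary Ω}
    (hg : Tendsto (fun k => eLpNorm (fun x => ψ k x - g x) 2 (surfaceMeasure Ω)) atTop (𝓝 0)) :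
    ∃ u : L2 Ω, IsTrace Ω u g := by
  have hΩm := hΩ.measurableSet
  obtain ⟨hmem, u, hu⟩ := exists_tendsto_eLpNorm_of_dominated
    (fun j => (hψ j).continuous.aestronglyMeasurable) hG
    (fun j => (ae_restrict_iff' hΩm).2 (Eventually.of_forall (hb j)))
    ((ae_restrict_iff' hΩm).2 (Eventually.of_forall hl))
  have hD : ∀ i, (∀ j, MemLp (partialDeriv i (ψ j)) 2 (volume.restrict Ω)) ∧ ∃ v : L2 Ω,
      Tendsto (fun j => eLpNorm (fun x => partialDeriv i (ψ j) x - v x) 2 (volume.restrict Ω))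
        atTop (𝓝 0) := fun i => exists_tendsto_eLpNorm_of_dominated
    (fun j => (contDiff_partialDeriv (hψ j) i).continuous.aestronglyMeasurable) hG'
    (fun j => (ae_restrict_iff' hΩm).2 (Eventually.of_forall (hb' i j)))
    ((ae_restrict_iff' hΩm).2 (Eventually.of_forall (hl' i)))
  choose hmem' v hv using hD
  have hlim : ∀ {f : ℕ → Euc n → ℝ} (hf : ∀ j, MemLp (f j) 2 (volume.restrict Ω)) (w : L2 Ω),
      Tendsto (fun j => eLpNorm (fun x => f j x - w x) 2 (volume.restrict Ω)) atTop (𝓝 0) →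
      Tendsto (fun j => (hf j).toLp (f j)) atTop (𝓝 w) := by
    intro f hf w hw
    rw [Lp.tendsto_Lp_iff_tendsto_eLpNorm']
    refine hw.congr fun j => eLpNorm_congr_ae ?_
    filter_upwards [(hf j).coeFn_toLp] with x hx
    rw [Pi.sub_apply, hx]
  have hweak : ∀ i, HasWeakPartial Ω i u (v i) := fun i =>
    HasWeakPartial.of_tendsto (fun j => hasWeakPartial_of_contDiff (hψ j) (hmem j).coeFn_toLp
      (hmem' i j).coeFn_toLp) (hlim hmem u hu) (hlim (hmem' i) (v i) (hv i))
  refine ⟨u, fun i => ⟨v i, hweak i⟩, ψ, hψ, ⟨hu, fun i => ?_⟩, hg⟩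
  rw [(hweak i).weakPartial_eq hΩ]
  exact hv i

/-- Every function in `H^{1/2}(∂Ω)` is the trace of a function in `H¹(Ω)`. -/
theorem exists_isTrace (hn : 1 ≤ n) (hΩ : IsBoundedLipschitzDomain Ω) {g : L2Boundary Ω}
    (hg : g ∈ HHalf Ω) : ∃ u : L2 Ω, IsTrace Ω u g := by
  have := hΩ.isFiniteMeasure_surfaceMeasure hn
  have hσ := ne_zero_surfaceMeasure hn hΩ
  have hgm : Measurable g := (Lp.stronglyMeasurable g).measurable
  have hgi : Integrable g (surfaceMeasure Ω) := (Lp.memLp g).integrable (by norm_num)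
  obtain ⟨R, hR0, hR⟩ := hΩ.isBounded.closure.exists_pos_norm_le
  have hF : ∀ y ∈ frontier Ω, ‖y‖ ≤ R := fun y hy => hR y (frontier_subset_closure hy)
  have hΩR : ∀ x ∈ Ω, ‖x‖ ≤ R := fun x hx => hR x (subset_closure hx)
  have haeR : ∀ᵐ y ∂surfaceMeasure Ω, ‖y‖ ≤ R := ae_mem_frontier.mono hF
  -- For `x ∈ Ω`, `y ∈ ∂Ω` and `ε ≤ 1` the radius `√(‖x - y‖² + ε²)` is at most `2 * R + 1`, so one
  -- lower bound covers all radii that occur.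
  obtain ⟨c, hc, hle⟩ := hΩ.exists_le_surfaceMeasure hn (2 * R + 1)
  have hlow : ∀ y ∈ frontier Ω, ∀ s, 0 < s → s ≤ 2 * R + 1 →
      ENNReal.ofReal c * ENNReal.ofReal s ^ (n - 1) ≤
        surfaceMeasure Ω (Metric.closedBall y s) := by
    simpa only [ENNReal.ofReal_coe_nnreal] using hle
  have hc' : (0 : ℝ) < c := hc
  have hsqrt : ∀ x ∈ Ω, ∀ y ∈ frontier Ω, ∀ ε : ℝ, 0 < ε → ε ≤ 1 →
      Real.sqrt (‖x - y‖ ^ 2 + ε ^ 2) ≤ 2 * R + 1 := by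
    intro x hx y hy ε hε hε1
    have h1 := norm_sub_le x y
    have h2 := hΩR x hx
    have h3 := hF y hy
    refine Real.sqrt_le_iff.2 ⟨by positivity, ?_⟩
    nlinarith [norm_nonneg (x - y)]
  obtain ⟨B, hB, hBle⟩ := exists_lintegral_gradient_bound_le hn
  obtain ⟨B', hB', hBle'⟩ := exists_setLIntegral_average_bound_le hn (2 * R + 1)
  obtain ⟨e, he, he1, he0⟩ : ∃ e : ℕ → ℝ, (∀ j, 0 < e j) ∧ (∀ j, e j ≤ 1) ∧
      Tendsto e atTop (𝓝 0) :=
    ⟨fun j => 1 / ((j : ℝ) + 1), fun j => Nat.one_div_pos_of_nat,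
      fun j => by rw [div_le_one (by positivity)]; linarith [(Nat.cast_nonneg j : (0 : ℝ) ≤ j)],
      tendsto_one_div_add_atTop_nhds_zero_nat⟩
  refine isTrace_of_dominated hΩ.isOpen (ψ := fun j => kernAvg (surfaceMeasure Ω) g (e j))
    (G := fun x => ENNReal.ofReal ((c : ℝ) / 5 ^ n)⁻¹ * ∫⁻ y, ‖g y‖ₑ ^ 2 *
      (ENNReal.ofReal ‖x - y‖ ^ (n - 1))⁻¹ ∂surfaceMeasure Ω)
    (G' := fun x => ENNReal.ofReal (4 * n ^ 2 * (2 ^ n / (c / 5 ^ n) ^ 2)) *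
      ∫⁻ y, ∫⁻ y', ‖g y - g y'‖ₑ ^ 2 * (ENNReal.ofReal (‖x - y‖ ^ 2 + ‖x - y'‖ ^ 2) ^ n)⁻¹
        ∂surfaceMeasure Ω ∂surfaceMeasure Ω)
    (fun j => contDiff_kernAvg hσ hgi haeR (he j)) ?_ (fun j x hx => ?_) (fun x hx => ?_) ?_
    (fun i j x hx => ?_) (fun i x hx => ?_) ?_
  · rw [lintegral_const_mul' _ _ ENNReal.ofReal_ne_top]
    refine ENNReal.mul_ne_top ENNReal.ofReal_ne_top (ne_top_of_le_ne_top ?_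
      (hBle' (surfaceMeasure Ω) g Ω hgm (haeR.mono fun y hy x hx => ?_)))
    · refine ENNReal.mul_ne_top hB' ?_
      rw [← eLpNorm_two_sq]
      exact ENNReal.pow_ne_top (Lp.eLpNorm_ne_top g)
    · rw [mem_ball_iff_norm]
      linarith [norm_sub_le x y, hΩR x hx]
  · have h := enorm_kernAvg_sub_sq_le hσ hgi (he j) x 0
    simp only [sub_zero] at h
    refine h.trans ?_
    rw [← lintegral_const_mul' _ _ ENNReal.ofReal_ne_top]
    refine lintegral_mono_ae (ae_mem_frontier.mono fun y hy => ?_)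
    calc _ ≤ _ := mul_le_mul_right (kern_div_kernMass_le hn hc' hlow hσ (he j) hy
          (hsqrt x hx y hy _ (he j) (he1 j))) _
      _ = _ := by ring
  · obtain ⟨d, hd, hdist⟩ := exists_le_norm_sub_of_mem hΩ.isOpen hx
    exact ⟨_, tendsto_kernAvg hσ hgi hd (ae_mem_frontier.mono hdist) he0⟩
  · rw [lintegral_const_mul' _ _ ENNReal.ofReal_ne_top]
    refine ENNReal.mul_ne_top ENNReal.ofReal_ne_top (ne_top_of_le_ne_top ?_
      ((setLIntegral_le_lintegral _ _).trans (hBle (surfaceMeasure Ω) g hgm)))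
    exact ENNReal.mul_ne_top hB (ne_of_lt hg)
  · rw [partialDeriv_kernAvg hn hσ hgi haeR (he j)]
    refine (enorm_kernAvgDeriv_sq_le hσ hgi (he j) i x).trans ?_
    rw [← lintegral_const_mul' _ _ ENNReal.ofReal_ne_top]
    refine lintegral_mono_ae (ae_mem_frontier.mono fun y hy => ?_)
    rw [← lintegral_const_mul' _ _ ENNReal.ofReal_ne_top]
    refine lintegral_mono_ae (ae_mem_frontier.mono fun y' hy' => ?_)
    calc _ ≤ _ := mul_le_mul_right (kernLog_sq_mul_le hn hc' hlow hσ (he j) i hy hy'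
          (hsqrt x hx y hy _ (he j) (he1 j)) (hsqrt x hx y' hy' _ (he j) (he1 j))) _
      _ = _ := by ring
  · obtain ⟨d, hd, hdist⟩ := exists_le_norm_sub_of_mem hΩ.isOpen hx
    refine ⟨_, (tendsto_kernAvgDeriv hσ hgi i hd (ae_mem_frontier.mono hdist) he0).congr
      fun j => ?_⟩
    rw [partialDeriv_kernAvg hn hσ hgi haeR (he j)]
  · refine tendsto_zero_of_sq ?_
    -- With `b = g x` in Jensen's inequality, the spare factor `e j` multiplies the Gagliardo
    -- integral of `g`, which is finite by hypothesis.
    have hup : ∀ j, eLpNorm (fun x => kernAvg (surfaceMeasure Ω) g (e j) x - g x) 2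
        (surfaceMeasure Ω) ^ 2 ≤ ENNReal.ofReal (((c : ℝ) / 5 ^ n)⁻¹ * e j) *
          ∫⁻ x, ∫⁻ y, ‖g x - g y‖ₑ ^ 2 / edist x y ^ n ∂surfaceMeasure Ω ∂surfaceMeasure Ω := by
      intro j
      rw [eLpNorm_two_sq, ← lintegral_const_mul' _ _ ENNReal.ofReal_ne_top]
      refine lintegral_mono_ae (ae_mem_frontier.mono fun x hx => ?_)
      refine (enorm_kernAvg_sub_sq_le hσ hgi (he j) x (g x)).trans ?_
      rw [← lintegral_const_mul' _ _ ENNReal.ofReal_ne_top]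
      refine lintegral_mono fun y => ?_
      have h1 := kern_div_kernMass_le_of_mem hn hc' hlow hσ (he j)
        (by linarith [he1 j] : e j ≤ 2 * R + 1) hx y
      calc _ ≤ _ := mul_le_mul_right h1 _
        _ = _ := by
          rw [← enorm_neg, neg_sub]
          simp only [div_eq_mul_inv]
          ring
    refine tendsto_of_tendsto_of_tendsto_of_le_of_le tendsto_const_nhds ?_
      (fun _ => zero_le) hup
    have h2 : Tendsto (fun j => ENNReal.ofReal (((c : ℝ) / 5 ^ n)⁻¹ * e j)) atTop (𝓝 0) := by
      have h3 := he0.const_mul ((c : ℝ) / 5 ^ n)⁻¹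
      rw [mul_zero] at h3
      rw [← ENNReal.ofReal_zero]
      exact (ENNReal.continuous_ofReal.tendsto 0).comp h3
    have h4 := ENNReal.Tendsto.mul_const h2 (b := ∫⁻ x, ∫⁻ y, ‖g x - g y‖ₑ ^ 2 / edist x y ^ n
      ∂surfaceMeasure Ω ∂surfaceMeasure Ω) (Or.inr (ne_of_lt hg))
    rwa [zero_mul] at h4

end Extension

/-! ### The trace map takes values in `H^{1/2}(∂Ω)`. -/

section TraceMap

variable {Ω : Set (Euc n)}

lemma IsTrace.trace_eq (hn : 1 ≤ n) (hΩ : IsBoundedLipschitzDomain Ω) {u : L2 Ω}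
    {g : L2Boundary Ω} (hg : IsTrace Ω u g) : trace Ω u = g := by
  have h : ∃ g : L2Boundary Ω, IsTrace Ω u g := ⟨g, hg⟩
  rw [trace, dif_pos h]
  exact IsTrace.unique hn hΩ h.choose_spec hg

lemma zero_mem_HHalf : (0 : L2Boundary Ω) ∈ HHalf Ω := by
  have h0 : ∀ᵐ x ∂surfaceMeasure Ω, (0 : L2Boundary Ω) x = 0 := Lp.coeFn_zero _ _ _
  rw [HHalf, Set.mem_ofPred_eq]
  refine lt_of_eq_of_lt ?_ ENNReal.zero_lt_top
  rw [lintegral_congr_ae (g := fun _ => 0), lintegral_zero]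
  filter_upwards [h0] with x hx
  rw [lintegral_congr_ae (g := fun _ => 0), lintegral_zero]
  filter_upwards [h0] with y hy
  rw [hx, hy]
  simp

lemma trace_mem_HHalf (hn : 1 ≤ n) (hΩ : IsBoundedLipschitzDomain Ω) (u : L2 Ω) :
    trace Ω u ∈ HHalf Ω := by
  by_cases h : ∃ g : L2Boundary Ω, IsTrace Ω u g
  · obtain ⟨g, hg⟩ := h
    rw [hg.trace_eq hn hΩ]
    exact hg.mem_HHalf hn hΩ
  -- The default value `0` also lies in `HHalf Ω`, so this inclusion does not require every function
  -- of `H¹(Ω)` to have a trace.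
  · rw [trace, dif_neg h]
    exact zero_mem_HHalf

end TraceMap

end ConstrainedSobolev

end

/-! ### The constrained spaces. -/

open ConstrainedSobolev
theorem mainTheorem4 {n : ℕ} (hn : 1 ≤ n) (Ω : Set (ConstrainedSobolev.Euc n))
    (hΩ : ConstrainedSobolev.IsBoundedLipschitzDomain Ω)
    (Lc : Submodule ℝ (ConstrainedSobolev.L2 Ω))
    (hLc : IsClosed (Lc : Set (ConstrainedSobolev.L2 Ω)))
    (m : ℕ) (φ : Fin m → ConstrainedSobolev.L2 Ω)
    (hφ : ∀ i, φ i ∈ ConstrainedSobolev.H1 Ω)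
    (hspan : Lcᗮ = Submodule.span ℝ (Set.range φ)) :
    ConstrainedSobolev.trace Ω ''
        (ConstrainedSobolev.H1 Ω ∩ (Lc : Set (ConstrainedSobolev.L2 Ω))) =
      ConstrainedSobolev.HHalf Ω ∧
    closure (ConstrainedSobolev.H10 Ω ∩ (Lc : Set (ConstrainedSobolev.L2 Ω))) =
      (Lc : Set (ConstrainedSobolev.L2 Ω)) ∧
    ∃ C : ℝ, 0 < C ∧ ∀ v ∈ Lcᗮ,
      v ∈ ConstrainedSobolev.H1 Ω ∧ ConstrainedSobolev.h1Norm Ω v ≤ C * ‖v‖ := by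
  have hfd : FiniteDimensional ℝ Lcᗮ := by
    rw [hspan]
    exact FiniteDimensional.span_of_finite ℝ (Set.finite_range φ)
  have hD := dense_testSubmodule hΩ.isOpen
  have hH1 : Lcᗮ ≤ H1Submodule Ω := by
    rw [hspan, Submodule.span_le]
    rintro _ ⟨i, rfl⟩
    exact hφ i
  refine ⟨Set.Subset.antisymm ?_ fun g hg => ?_, Set.Subset.antisymm ?_ ?_, ?_⟩
  · rintro _ ⟨u, -, rfl⟩
    exact trace_mem_HHalf hn hΩ u
  · obtain ⟨u, hu⟩ := exists_isTrace hn hΩ hg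
    obtain ⟨T, hT, hPT⟩ := exists_section_of_dense (V := Lcᗮ) hD
    -- Subtracting the test function `T (P u)` removes the component in `Lcᗮ` and keeps the trace
    -- equal to `g`.
    have hw := hu.sub_test hΩ.isOpen (hT (Lcᗮ.orthogonalProjectionOnto u))
    refine ⟨u - T (Lcᗮ.orthogonalProjectionOnto u), ⟨hw.1, ?_⟩, hw.trace_eq hn hΩ⟩
    refine mem_of_orthogonalProjectionOnto_orthogonal_eq_zero hLc ?_
    rw [map_sub, hPT, sub_self]
  · exact closure_minimal Set.inter_subset_right hLc
  -- Test functions in `Lc` are already dense in `Lc`, and they form a subset of `H10 Ω ∩ Lc`.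
  · conv_lhs => rw [← closure_inter_eq_of_dense hD hLc]
    exact closure_mono (Set.inter_subset_inter_left _
      fun v hv => mem_H10_of_mem_testSubmodule hΩ.isOpen hv)
  · obtain ⟨C, hC, hle⟩ := exists_h1Norm_le hΩ.isOpen Lcᗮ hH1
    exact ⟨C, hC, fun v hv => ⟨hH1 hv, hle v hv⟩⟩
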